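/- **Conventions.** Fix $N,M\ge 0$ and $c,k_1,k_2\in\mathbb C$. Greek indices run over $0,1,\dots,N+M$ and Latin indices over $1,\dots,N+M$. Set $\deg\mu=0$ for $\mu\le N$, $\deg\mu=1$ for $\mu>N$; repeated indices are summed. In an exponent of $(-)$ a symbol stands for its degree; brackets of operators are graded commutators, $[A,B]=AB-(-)^{AB}BA$. Vector fields $\xi=\xi^\mu\partial_\mu$ are homogeneous, $\deg\xi^\mu=\deg\xi+\deg\mu$, and their components $\xi^\mu(x)$ are finite sums of monomials in $e^{\pm ix^0}$, $x^1,\dots,x^{N+M}$ (where $x^0=t$ is $2\pi$-periodic time, $x^1,\dots,x^N$ commute and $x^{N+1},\dots,x^{N+M}$ anticommute); $\partial_\mu$ are left derivatives, $$[\xi,\eta]^\nu=\xi^\mu\partial_\mu\eta^\nu-(-)^{\xi\eta}\eta^\mu\partial_\mu\xi^\nu,\qquad \operatorname{div}\xi=(-)^{\xi\mu+\mu}\partial_\mu\xi^\mu .$$ A field on the circle is $A(t)=\sum_{n\in\mathbb Z}A_ne^{-int}$, $\int dt\,A(t)=2\pi A_0$, $A^>=\sum_{n>0}A_ne^{-int}$,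 $A^<=\sum_{n\le0}A_ne^{-int}$, and $\delta$ is the delta function on the circle. **Hypotheses.** On a complex vector space $W$ let $q^i(t),p_j(t)$ (of degrees $\deg i,\deg j$), $L(t)$ (even) and $T^\mu_\nu(t)$ (of degree $\deg\mu+\deg\nu$) be fields with $[p_j(s),q^i(t)]=\delta^i_j\delta(s-t)$, $[q^i(s),q^j(t)]=[p_i(s),p_j(t)]=0$, $$[L(s),L(t)]=(L(s)+L(t))\dot\delta(s-t)+\tfrac{c}{24\pi i}\big(\dddot\delta(s-t)+\dot\delta(s-t)\big),\qquad [L(s),T^\mu_\nu(t)]=T^\mu_\nu(s)\dot\delta(s-t),$$ $$[T^\mu_\nu(s),T^\sigma_\tau(t)]=\big(\delta^\sigma_\nu T^\mu_\tau(s)-(-)^{(\mu+\nu)(\sigma+\tau)}\delta^\mu_\tau T^\sigma_\nu(s)\big)\delta(s-t)-\tfrac1{2\pi i}\big(k_1(-)^\mu\delta^\mu_\tau\delta^\sigma_\nu+k_2(-)^{\mu+\sigma}\delta^\mu_\nu\delta^\sigma_\tau\big)\dot\delta(s-t),$$ all brackets of $q,p$ with $L,T$ being zero, and such that each vector of $W$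 is annihilated by all modes of $q^i,p_j,L,T^\mu_\nu$ of sufficiently negative frequency $n$. Put $q^0(t)=t$ and, for a function $f$, $\dot f(q(t))=\dot q^\rho(t)\,\partial_\rho f(q(t))$ and $\ddot f=\frac{d}{dt}\dot f$; in $\partial_\nu\dot f$ the derivative does not act on $\dot q$, so $\partial_\nu\dot f=(-)^{\nu\rho}\dot q^\rho\partial_\nu\partial_\rho f$. Let $\tilde\xi^i(t)=\xi^i(q(t))-\xi^0(q(t))\dot q^i(t)$ and $$\mathcal L_\xi=\int dt\,\Big\{\tilde\xi^ip_i^<+(-)^{\xi i+i}p_i^>\tilde\xi^i+\xi^0(q)L+(-)^{(\xi+\mu)\nu+\mu}\partial_\nu\xi^\mu(q)\,T^\nu_\mu\Big\}.$$ **Theorem.** (a) On each vector all series in these definitions and in $\mathrm{ext}$ below have only finitely many nonzero terms, and for all homogeneous $\xi,\eta$ $$[\mathcal L_\xi,\mathcal L_\eta]=\mathcal L_{[\xi,\eta]}+\mathrm{ext}(\xi,\eta),$$ where, all functions being evaluated at $q(t)$, $$\begin{aligned}\mathrm{ext}(\xi,\eta)=\tfrac1{2\pi i}\int dt\,\Big\{&(1+k_1)(-)^{(\xi+\eta+\nu)\nu}\partial_\nu\dot\xi^\mu\,\partial_\mu\eta^\nu+k_2\operatorname{div}\dot\xi\,\operatorname{div}\eta\\&+(-)^{(\xi+\eta+\nu)\nu}\partial_\nu\xi^0\,\dot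 q^\rho\partial_\rho\dot\eta^\nu-\dot q^\rho\partial_\rho\dot\xi^\mu\,\partial_\mu\eta^0-\dot\xi^0\,\dot q^\rho\partial_\rho\dot\eta^0+\dot q^\rho\partial_\rho\dot\xi^0\,\dot\eta^0\\&+\tfrac12\operatorname{div}\dot\xi\,\dot\eta^0-\tfrac12\dot\xi^0\operatorname{div}\dot\eta-\Big(2-\tfrac{c+2(N-M)}{12}\Big)\ddot\xi^0\dot\eta^0-\tfrac{c+2(N-M)}{12}\dot\xi^0\eta^0\\&+\tfrac i2\big(\operatorname{div}\xi\,\dot\eta^0-\dot\xi^0\operatorname{div}\eta\big)\Big\}.\end{aligned}$$ Moreover $[\mathcal L_\xi,q^i(t)]=\xi^i(q(t))-\xi^0(q(t))\dot q^i(t)$ and $[\mathrm{ext}(\xi,\eta),q^i(t)]=0$. The extension is not central: if $N+M>0$ and $W\ne0$, then $[\mathcal L_\zeta,\mathrm{ext}(\xi,\eta)]\neq0$ for some homogeneous $\xi,\eta,\zeta$. (b) Let $\mathcal F$ be the Fock module of $q^i,p_j$, i.e. the superpolynomials in the modes $q^i_n$ $(n\ge0)$ and $p_{j,n}$ $(n>0)$,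 with vacuum $|0\rangle$ annihilated by the modes $q^i_n$ $(n<0)$ and $p_{j,n}$ $(n\le0)$. Let $V$ be a complex vector space with fields $L,T^\mu_\nu$ satisfying the above brackets, each vector being annihilated by all modes of sufficiently negative frequency. Then $\mathcal F\otimes V$ (super tensor product) satisfies the hypotheses of (a), so it carries the operators $\mathcal L_\xi$ and $\mathrm{ext}(\xi,\eta)$. It is a lowest-energy module. With $L_0=-i\int dt\,L(t)$ and $H=-i\mathcal L_{\partial_0}$: if $V$ is spanned by eigenvectors of $L_0$ with eigenvalues in $h+\mathbb N$ ($\mathbb N=\{0,1,2,\dots\}$), then $\mathcal F\otimes V$ is spanned by eigenvectors of $H$ with eigenvalues in $h+\mathbb N$. If $v\in V$ satisfies $L_0v=hv$ and is annihilated by all modes of $L$ and $T^\mu_\nu$ with $n<0$, then $H(|0\rangle\otimes v)=h\,|0\rangle\otimes v$, and $\mathcal L_\xi(|0\rangle\otimes v)=0$ for every homogeneous $\xi$ whose components contain only monomials with a factor $e^{imt}$, $m<0$. -/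

import Mathlib

open scoped TensorProduct

noncomputable section

namespace SuperTraj

/-! ### Indices and signs -/

/-- Spatial indices: `N` bosonic directions followed by `M` fermionic ones. -/
abbrev SIdx (N M : ℕ) := Fin N ⊕ Fin M

/-- Space-time indices: `none` is the (bosonic) time direction `0`. -/
abbrev Idx (N M : ℕ) := Option (SIdx N M)

/-- Parity of a spatial index. -/
def sdeg {N M : ℕ} : SIdx N M → ZMod 2
  | Sum.inl _ => 0
  | Sum.inr _ => 1

/-- Parity of a space-time index. -/
def deg {N M : ℕ} : Idx N M → ZMod 2
  | none => 0
  | some i => sdeg i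

/-- The sign `(-1)^a`. -/
def sgn (a : ZMod 2) : ℂ := if a = 0 then 1 else -1

/-- `AB - (-1)^s BA`; this is the graded commutator when `s = deg A * deg B`. -/
def sbr {W : Type*} [AddCommGroup W] [Module ℂ W] (s : ZMod 2) (A B : Module.End ℂ W) :
    Module.End ℂ W :=
  A * B - sgn s • (B * A)

/-! ### Superpolynomials

`SuperPoly A O` has the basis of monomials `z^a θ_S`, where `a : A` is an exponent of the
commuting variables and `θ_S` is the product, in increasing order, of the anticommuting variables
`θ_o`, `o ∈ S`. -/

abbrev SuperPoly (A O : Type*) := (A × Finset O) →₀ ℂ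

section SuperPoly

variable {A O : Type*} [LinearOrder O]

/-- The sign produced by moving `θ_o` to its place in `θ_S`. -/
def oddSign (o : O) (S : Finset O) : ℂ := (-1) ^ (S.filter fun x => x < o).card

/-- Left multiplication by `θ_o`. -/
def mulOdd (o : O) : SuperPoly A O →ₗ[ℂ] SuperPoly A O :=
  Finsupp.linearCombination ℂ fun m : A × Finset O =>
    if o ∈ m.2 then (0 : SuperPoly A O)
    else Finsupp.single (m.1, insert o m.2) (oddSign o m.2)

/-- The left derivative with respect to `θ_o`. -/
def derOdd (o : O) : SuperPoly A O →ₗ[ℂ] SuperPoly A O :=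
  Finsupp.linearCombination ℂ fun m : A × Finset O =>
    if o ∈ m.2 then Finsupp.single (m.1, m.2.erase o) (oddSign o m.2)
    else (0 : SuperPoly A O)

/-- The product: `θ_S θ_T` is `0` if `S` and `T` meet, and otherwise `±θ_(S ∪ T)`, the sign
counting the inversions. -/
def SuperPoly.mul [Add A] (f g : SuperPoly A O) : SuperPoly A O :=
  f.sum fun m a => g.sum fun n b =>
    if Disjoint m.2 n.2 then
      Finsupp.single (m.1 + n.1, m.2 ∪ n.2)
        ((-1) ^ ((m.2 ×ˢ n.2).filter fun x => x.2 < x.1).card * (a * b))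
    else 0

/-- `f` is homogeneous of parity `p`. -/
def HasParity (p : ZMod 2) (f : SuperPoly A O) : Prop :=
  ∀ m ∈ f.support, (m.2.card : ZMod 2) = p

end SuperPoly

/-! ### Functions and vector fields on super space-time -/

/-- Functions on `(N+1|M)`-dimensional super space-time, periodic in time: the monomial
`((m, a), S)` stands for `e^{imt} x^a θ_S`. -/
abbrev STFun (N M : ℕ) := SuperPoly (ℤ × (Fin N →₀ ℕ)) (Fin M)

/-- The (left) partial derivative `∂_μ`. -/
def pd {N M : ℕ} : Idx N M → (STFun N M →ₗ[ℂ] STFun N M)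
  | none => Finsupp.linearCombination ℂ fun m : (ℤ × (Fin N →₀ ℕ)) × Finset (Fin M) =>
      (Finsupp.single m (Complex.I * (m.1.1 : ℂ)) : STFun N M)
  | some (Sum.inl i) =>
      Finsupp.linearCombination ℂ fun m : (ℤ × (Fin N →₀ ℕ)) × Finset (Fin M) =>
        (Finsupp.single ((m.1.1, m.1.2 - Finsupp.single i 1), m.2) (m.1.2 i : ℂ) : STFun N M)
  | some (Sum.inr j) => derOdd j

/-- A vector field `ξ = ξ^μ ∂_μ`, given by its components. -/
abbrev VF (N M : ℕ) := Idx N M → STFun N M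

/-- `ξ` is homogeneous of parity `p`, i.e. `deg ξ^μ = p + deg μ`. -/
def VF.IsHomog {N M : ℕ} (p : ZMod 2) (ξ : VF N M) : Prop :=
  ∀ μ, HasParity (p + deg μ) (ξ μ)

/-- `[ξ,η]^ν = ξ^μ ∂_μ η^ν - (-)^{ξη} η^μ ∂_μ ξ^ν`, for `ξ`, `η` of parities `p`, `r`. -/
def VF.bracket {N M : ℕ} (p r : ZMod 2) (ξ η : VF N M) : VF N M := fun ν =>
  ∑ μ, ((ξ μ).mul (pd μ (η ν)) - sgn (p * r) • (η μ).mul (pd μ (ξ ν)))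

/-- `div ξ = (-)^{ξμ+μ} ∂_μ ξ^μ`, for `ξ` of parity `p`. -/
def VF.div {N M : ℕ} (p : ZMod 2) (ξ : VF N M) : STFun N M :=
  ∑ μ, sgn (p * deg μ + deg μ) • pd μ (ξ μ)

/-- The generator `∂_0` of time translations. -/
def VF.time (N M : ℕ) : VF N M := fun μ =>
  if μ = none then Finsupp.single ((0, 0), ∅) 1 else 0

/-! ### Operator-valued fields on the circle -/

section Fields

variable {W : Type*} [AddCommGroup W] [Module ℂ W]

/-- A field `A(t) = ∑_n A_n e^{-int}`, given by its Fourier modes. -/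
abbrev Fld (W : Type*) [AddCommGroup W] [Module ℂ W] := ℤ → Module.End ℂ W

/-- On each vector only finitely many of the operators are nonzero. -/
def LocFin (f : ℤ → Module.End ℂ W) : Prop :=
  ∀ w, (Function.support fun b => f b w).Finite

open Classical in
/-- The sum of a locally finite family of operators (`0` if the family is not locally finite). -/
def locSum (f : ℤ → Module.End ℂ W) : Module.End ℂ W :=
  if h : LocFin f then
    { toFun := fun w => ∑ᶠ b, f b w
      map_add' := fun v w => by
        simp only [map_add]
        exact finsum_add_distrib (h v) (h w)
      map_smul' := fun a w => by
        simp only [map_smul, RingHom.id_apply]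
        exact (smul_finsum a _).symm }
  else 0

/-- The product `A(t) B(t)`: its `n`-th mode is `∑_b A_{n-b} B_b`. -/
def fmul (A B : Fld W) : Fld W := fun n => locSum fun b => A (n - b) * B b

/-- The series that define `A(t) B(t)` are locally finite. -/
def MulOK (A B : Fld W) : Prop := ∀ n, LocFin fun b => A (n - b) * B b

/-- The function `e^{imt}`. -/
def fexp (m : ℤ) : Fld W := fun n => if n = -m then 1 else 0

/-- The time derivative. -/
def fdt (A : Fld W) : Fld W := fun n => (-Complex.I * (n : ℂ)) • A n

/-- `∫ dt A(t)` over the circle. -/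
def integ (A : Fld W) : Module.End ℂ W := (2 * Real.pi : ℂ) • A 0

/-- The part `A^>(t)` with frequencies `n > 0`. -/
def fpos (A : Fld W) : Fld W := fun n => if 0 < n then A n else 0

/-- The part `A^<(t)` with frequencies `n ≤ 0`. -/
def fneg (A : Fld W) : Fld W := fun n => if n ≤ 0 then A n else 0

end Fields

/-! ### The operators of the construction -/

/-- Modes of the trajectory `q^i(t) = ∑ q^i_n e^{-int}`, of its momentum
`p_j(t) = (1/2π) ∑ p_{j,n} e^{-int}`, of `L(t) = (i/2π) ∑ L_n e^{-int}` and of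
`T^μ_ν(t) = (1/2π) ∑ T^μ_{ν,n} e^{-int}`. The laws are in `TrajOps.IsRep`. -/
structure TrajOps (N M : ℕ) (W : Type*) [AddCommGroup W] [Module ℂ W] where
  q : SIdx N M → ℤ → Module.End ℂ W
  p : SIdx N M → ℤ → Module.End ℂ W
  L : ℤ → Module.End ℂ W
  T : Idx N M → Idx N M → ℤ → Module.End ℂ W

/-- The Virasoro algebra with central charge `c`, the affine Kac-Moody superalgebra of
`gl(N+1|M)` with central charges `k₁`, `k₂`, and their compatibility, in Fourier modes. In terms of
the fields, with `δ` the delta function on the circle: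
`[L(s), L(t)] = (L(s) + L(t)) δ'(s-t) + (c / 24πi) (δ'''(s-t) + δ'(s-t))`,
`[L(s), T^μ_ν(t)] = T^μ_ν(s) δ'(s-t)`,
`[T^μ_ν(s), T^σ_τ(t)] = (δ^σ_ν T^μ_τ(s) - (-)^{(μ+ν)(σ+τ)} δ^μ_τ T^σ_ν(s)) δ(s-t)
  - (1/2πi) (k₁ (-)^μ δ^μ_τ δ^σ_ν + k₂ (-)^{μ+σ} δ^μ_ν δ^σ_τ) δ'(s-t)`. -/
structure IsVirKM {N M : ℕ} {V : Type*} [AddCommGroup V] [Module ℂ V] (c k₁ k₂ : ℂ)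
    (L : ℤ → Module.End ℂ V) (T : Idx N M → Idx N M → ℤ → Module.End ℂ V) : Prop where
  vir : ∀ m n, sbr 0 (L m) (L n) = ((n : ℂ) - m) • L (m + n) -
    (if m + n = 0 then c / 12 * ((m : ℂ) ^ 3 - m) else 0) • 1
  compat : ∀ m n μ ν, sbr 0 (L m) (T μ ν n) = (n : ℂ) • T μ ν (m + n)
  km : ∀ m n μ ν σ τ, sbr ((deg μ + deg ν) * (deg σ + deg τ)) (T μ ν m) (T σ τ n) =
    (if σ = ν then T μ τ (m + n) else 0)
    - sgn ((deg μ + deg ν) * (deg σ + deg τ)) • (if μ = τ then T σ ν (m + n) else 0)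
    + (if m + n = 0 then
        (m : ℂ) * ((if μ = τ ∧ σ = ν then k₁ * sgn (deg μ) else 0)
          + (if μ = ν ∧ σ = τ then k₂ * sgn (deg μ + deg σ) else 0))
       else 0) • 1

/-- Every vector is annihilated by all modes of sufficiently negative frequency. -/
def Truncated {V : Type*} [AddCommGroup V] [Module ℂ V] (A : ℤ → Module.End ℂ V) : Prop :=
  ∀ v, ∃ K : ℤ, ∀ n < K, A n v = 0

/-- The laws: the graded Heisenberg algebra `[p_j(s), q^i(t)] = δ^i_j δ(s-t)`,
`[q, q] = [p, p] = 0`; the algebra of `L` and `T`; `q` and `p` commute, in the graded sense,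
with `L` and `T`; and the energy condition that makes the composite fields well defined. -/
structure TrajOps.IsRep {N M : ℕ} {W : Type*} [AddCommGroup W] [Module ℂ W]
    (R : TrajOps N M W) (c k₁ k₂ : ℂ) : Prop where
  pq : ∀ j i m n, sbr (sdeg j * sdeg i) (R.p j m) (R.q i n) =
    if i = j ∧ m + n = 0 then 1 else 0
  qq : ∀ i j m n, sbr (sdeg i * sdeg j) (R.q i m) (R.q j n) = 0
  pp : ∀ i j m n, sbr (sdeg i * sdeg j) (R.p i m) (R.p j n) = 0
  virkm : IsVirKM c k₁ k₂ R.L R.T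
  Lq : ∀ m i n, sbr 0 (R.L m) (R.q i n) = 0
  Lp : ∀ m i n, sbr 0 (R.L m) (R.p i n) = 0
  Tq : ∀ μ ν m i n, sbr ((deg μ + deg ν) * sdeg i) (R.T μ ν m) (R.q i n) = 0
  Tp : ∀ μ ν m i n, sbr ((deg μ + deg ν) * sdeg i) (R.T μ ν m) (R.p i n) = 0
  trunc_q : ∀ i, Truncated (R.q i)
  trunc_p : ∀ i, Truncated (R.p i)
  trunc_L : Truncated R.L
  trunc_T : ∀ μ ν, Truncated (R.T μ ν)

namespace TrajOps

variable {N M : ℕ} {W : Type*} [AddCommGroup W] [Module ℂ W] (R : TrajOps N M W)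

/-- The field `p_j(t)`. -/
def pField (j : SIdx N M) : Fld W := fun n => (1 / (2 * Real.pi) : ℂ) • R.p j n

/-- The field `L(t)`. -/
def LField : Fld W := fun n => (Complex.I / (2 * Real.pi) : ℂ) • R.L n

/-- The field `T^μ_ν(t)`. -/
def TField (μ ν : Idx N M) : Fld W := fun n => (1 / (2 * Real.pi) : ℂ) • R.T μ ν n

/-- The velocity `dq^μ/dt`, where `q^0(t) = t`. -/
def qdot : Idx N M → Fld W
  | none => fexp 0
  | some i => fdt (R.q i)

/-- The variables of `x^a θ_S`, in order. -/
def word (a : Fin N →₀ ℕ) (S : Finset (Fin M)) : List (SIdx N M) :=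
  (List.finRange N).flatMap (fun i => List.replicate (a i) (Sum.inl i)) ++
    (S.sort (· ≤ ·)).map Sum.inr

/-- The product `q^{i_1}(t) ⋯ q^{i_k}(t)`. -/
def evWord (l : List (SIdx N M)) : Fld W := l.foldr (fun i A => fmul (R.q i) A) (fexp 0)

/-- `f(q(t))`; multiplication by `e^{imt}` shifts the modes by `m`. -/
def ev (f : STFun N M) : Fld W :=
  f.sum fun m a => a • fun n => R.evWord (word m.1.2 m.2) (n + m.1.1)

/-- `ḟ(q(t)) = q̇^ρ ∂_ρ f(q(t))`. -/
def evDot (f : STFun N M) : Fld W := ∑ ρ, fmul (R.qdot ρ) (R.ev (pd ρ f))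

/-- `q̇^ρ ∂_ρ ḟ(q(t))`, with `∂_ρ` acting on functions of position only, that is,
`∂_ρ ḟ = (-)^{ρσ} q̇^σ ∂_ρ ∂_σ f`. -/
def evDot2 (f : STFun N M) : Fld W :=
  ∑ ρ, fmul (R.qdot ρ)
    (∑ σ, sgn (deg ρ * deg σ) • fmul (R.qdot σ) (R.ev (pd ρ (pd σ f))))

/-- `ξ̃^i(t) = ξ^i(q(t)) - ξ^0(q(t)) q̇^i(t)`. -/
def xiTilde (ξ : VF N M) (i : SIdx N M) : Fld W :=
  R.ev (ξ (some i)) - fmul (R.ev (ξ none)) (R.qdot (some i))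

/-- The normal-ordered generator `𝓛_ξ`, for `ξ` of parity `p`. -/
def gen (p : ZMod 2) (ξ : VF N M) : Module.End ℂ W :=
  (∑ i, integ (fmul (R.xiTilde ξ i) (fneg (R.pField i))
      + sgn (p * sdeg i + sdeg i) • fmul (fpos (R.pField i)) (R.xiTilde ξ i)))
  + integ (fmul (R.ev (ξ none)) R.LField)
  + ∑ μ, ∑ ν, sgn ((p + deg μ) * deg ν + deg μ) •
      integ (fmul (R.ev (pd ν (ξ μ))) (R.TField ν μ))

/-- The extension `ext(ξ,η)`, for `ξ`, `η` of parities `p`, `r`. -/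
def ext (c k₁ k₂ : ℂ) (p r : ZMod 2) (ξ η : VF N M) : Module.End ℂ W :=
  (1 / (2 * Real.pi * Complex.I) : ℂ) • integ (
    (1 + k₁) • (∑ μ, ∑ ν, sgn ((p + r + deg ν) * deg ν) •
        fmul (R.evDot (pd ν (ξ μ))) (R.ev (pd μ (η ν))))
    + k₂ • fmul (R.evDot (ξ.div p)) (R.ev (η.div r))
    + (∑ ν, sgn ((p + r + deg ν) * deg ν) • fmul (R.ev (pd ν (ξ none))) (R.evDot2 (η ν)))
    - (∑ μ, fmul (R.evDot2 (ξ μ)) (R.ev (pd μ (η none))))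
    - fmul (R.evDot (ξ none)) (R.evDot2 (η none))
    + fmul (R.evDot2 (ξ none)) (R.evDot (η none))
    + (1 / 2 : ℂ) • fmul (R.evDot (ξ.div p)) (R.evDot (η none))
    - (1 / 2 : ℂ) • fmul (R.evDot (ξ none)) (R.evDot (η.div r))
    - (2 - (c + 2 * ((N : ℂ) - M)) / 12) •
        fmul (fdt (R.evDot (ξ none))) (R.evDot (η none))
    - ((c + 2 * ((N : ℂ) - M)) / 12) • fmul (R.evDot (ξ none)) (R.ev (η none))
    + (Complex.I / 2) • (fmul (R.ev (ξ.div p)) (R.evDot (η none))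
        - fmul (R.evDot (ξ none)) (R.ev (η.div r))))

/-- Homogeneous functionals of the trajectory, of the given parity: the fields built from `e^{imt}`
and `q^i(t)` by time derivatives, linear combinations and products. -/
inductive QFun : ZMod 2 → Fld W → Prop
  | zero (p : ZMod 2) : QFun p 0
  | exp (m : ℤ) : QFun 0 (fexp m)
  | traj (i : SIdx N M) : QFun (sdeg i) (R.q i)
  | dt {p : ZMod 2} {A : Fld W} : QFun p A → QFun p (fdt A)
  | add {p : ZMod 2} {A B : Fld W} : QFun p A → QFun p B → QFun p (A + B)
  | smul {p : ZMod 2} (a : ℂ) {A : Fld W} : QFun p A → QFun p (a • A)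
  | mul {p r : ZMod 2} {A B : Fld W} : QFun p A → QFun r B → QFun (p + r) (fmul A B)

end TrajOps

/-! ### The Fock module -/

/-- Superpolynomials in the creation operators `q^i_n`, `n ≥ 0`, and `p_{i,n}`, `n > 0`. The
variable `(i, k)` stands for `q^i_k` if `k ≥ 0`, and for `p_{i,-k}` if `k < 0`. -/
abbrev Fock (N M : ℕ) := SuperPoly ((Fin N × ℤ) →₀ ℕ) (Fin M ×ₗ ℤ)

namespace Fock

variable {N M : ℕ}

/-- Left multiplication by the variable `(i, k)`. -/
def mulVar : SIdx N M → ℤ → (Fock N M →ₗ[ℂ] Fock N M)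
  | Sum.inl i, k => Finsupp.linearCombination ℂ
      fun m : ((Fin N × ℤ) →₀ ℕ) × Finset (Fin M ×ₗ ℤ) =>
        (Finsupp.single (m.1 + Finsupp.single (i, k) 1, m.2) 1 : Fock N M)
  | Sum.inr j, k => mulOdd (toLex (j, k))

/-- The left derivative with respect to the variable `(i, k)`. -/
def derVar : SIdx N M → ℤ → (Fock N M →ₗ[ℂ] Fock N M)
  | Sum.inl i, k => Finsupp.linearCombination ℂ
      fun m : ((Fin N × ℤ) →₀ ℕ) × Finset (Fin M ×ₗ ℤ) =>
        (Finsupp.single (m.1 - Finsupp.single (i, k) 1, m.2) (m.1 (i, k) : ℂ) : Fock N M)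
  | Sum.inr j, k => derOdd (toLex (j, k))

/-- The modes of the trajectory: negative frequencies annihilate the vacuum. -/
def q (i : SIdx N M) (n : ℤ) : Module.End ℂ (Fock N M) :=
  if 0 ≤ n then mulVar i n else -(sgn (sdeg i)) • derVar i n

/-- The modes of the momentum: non-positive frequencies annihilate the vacuum. -/
def p (i : SIdx N M) (n : ℤ) : Module.End ℂ (Fock N M) :=
  if 0 < n then mulVar i (-n) else derVar i (-n)

/-- The operator `(-1)^{a deg}`, where `deg` is the parity on the Fock module. -/
def koszul (a : ZMod 2) : Module.End ℂ (Fock N M) :=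
  Finsupp.linearCombination ℂ fun m : ((Fin N × ℤ) →₀ ℕ) × Finset (Fin M ×ₗ ℤ) =>
    (Finsupp.single m (sgn (a * (m.2.card : ZMod 2))) : Fock N M)

/-- The vacuum. -/
def vac (N M : ℕ) : Fock N M := Finsupp.single (0, ∅) 1

/-- The operators on the (super) tensor product of the Fock module and a module `V` of the `L_n`
and `T^μ_{ν,n}`: an odd operator on `V` changes sign when it passes an odd Fock vector. -/
def ops {V : Type*} [AddCommGroup V] [Module ℂ V] (L : ℤ → Module.End ℂ V)
    (T : Idx N M → Idx N M → ℤ → Module.End ℂ V) : TrajOps N M (Fock N M ⊗[ℂ] V) where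
  q := fun i n => TensorProduct.map (q i n) LinearMap.id
  p := fun i n => TensorProduct.map (p i n) LinearMap.id
  L := fun n => TensorProduct.map LinearMap.id (L n)
  T := fun μ ν n => TensorProduct.map (koszul (deg μ + deg ν)) (T μ ν n)

end Fock

end SuperTraj

end

noncomputable section

namespace SuperTraj

/-! ### Signs and graded commutators -/

/-! The modes of `q` supercommute and each vector is annihilated by sufficiently negative
frequencies. Any factor of a product of functionals of q(t) can therefore be made to act first, so
such products are locally finite. The functionals span a supercommutative ring `QRing` with
derivation `d` = d/dt, and f ↦ f(q(t)) is a homomorphism from functions into it (`ev_mul`) obeying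
the chain rule `d_ev`. Identities between infinite sums of operators are proved by exhibiting both
sides as the sum of one locally finite family (`HasLS.unique`).

By `gen_eq` the generator splits into parts linear in p, in L and in T, called `dop`, `lop` and
`topp`. The p-part acts on f(q) as ξ^μ∂_μ f - ξ^0 ḟ. Since L generates reparametrizations, the
L-part supplies the missing ξ^0 d/dt on the coefficients of T (`sbr_dop_lop_topp`), and the
analogous terms cancel in the coefficient of L (`lop_bracket`). The brackets of T give the
commutator of the Jacobian matrices of ξ and η. Together with the transport of these matrices this
is the Jacobian of [ξ,η], by the Leibniz rule (`ev_pd_bracket`). Hence, up to anomalies, the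
generators represent the vector fields.

The anomalies are the central terms of L and T and the double contractions between two p-parts.
Wick's theorem `sbr_nord_nord` gives a double contraction of the modes m and n the weight θ(m) -
θ(n). For fixed k = n - m only finitely many n contribute. The mode p_{i,n} acts on ξ̃^j with
coefficients at most linear in n, since ξ̃^j contains first velocities only. So the sums over n are
sums of powers up to the second and are polynomials in k, that is, polynomials in `d`
(`hasLS_double_contraction`).

It remains to recognize the result. The part quadratic in the Jacobians of ξ̃ and η̃ gives, after
integration by parts, the terms with coefficient 1 + k₁ that do not come from T and the terms with
q̇^ρ∂_ρ of a velocity (`tr_sum_d_jac_mul_jac`). The mixed part contains the supertrace div ξ - ξ̇^0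
of the Jacobian (`sum_sgn_jac`). The last part counts the directions with sign and shifts c to c +
2(N - M). `contraction_eq_ext` adds everything up.

The extension is not central because e^{-it}∂_0 and x^i∂_0 produce the mode q^i_{-1}, which
e^{it}∂_i moves to the identity. On the Fock module the normal-ordered energy is a number operator
weighted by |n|, which gives the spectrum. On a vacuum vector each term of a generator with negative
exponents contains an annihilating mode that can be made to act first. -/

theorem sgn_add (a b : ZMod 2) : sgn (a + b) = sgn a * sgn b := by
  revert a b
  have h : ∀ a : ZMod 2, a = 0 ∨ a = 1 := by decide
  intro a b
  rcases h a with rfl | rfl <;> rcases h b with rfl | rfl <;>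
    simp [sgn, show (1 + 1 : ZMod 2) = 0 from rfl]

@[simp] theorem sgn_zero : sgn 0 = 1 := by simp [sgn]

@[simp] theorem sgn_mul_self (a : ZMod 2) : sgn a * sgn a = 1 := by
  unfold sgn; split_ifs <;> norm_num

theorem sgn_cancel (a : ZMod 2) {V : Type*} [AddCommGroup V] [Module ℂ V] (v : V) :
    sgn a • sgn a • v = v := by
  rw [smul_smul, sgn_mul_self, one_smul]

section Sbr

variable {W : Type*} [AddCommGroup W] [Module ℂ W]

theorem sbr_def (s : ZMod 2) (A B : Module.End ℂ W) : sbr s A B = A * B - sgn s • (B * A) := rfl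

theorem sbr_eq_zero_iff {s : ZMod 2} {A B : Module.End ℂ W} :
    sbr s A B = 0 ↔ A * B = sgn s • (B * A) := by
  rw [sbr_def, sub_eq_zero]

theorem sbr_swap (s : ZMod 2) (A B : Module.End ℂ W) :
    sbr s B A = -(sgn s • sbr s A B) := by
  simp only [sbr_def, smul_sub, sgn_cancel]; abel

theorem sbr_swap_zero {s : ZMod 2} {A B : Module.End ℂ W} (h : sbr s A B = 0) :
    sbr s B A = 0 := by
  rw [sbr_swap, h]; simp

theorem sbr_add_right (s : ZMod 2) (A B C : Module.End ℂ W) :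
    sbr s A (B + C) = sbr s A B + sbr s A C := by
  simp only [sbr_def, mul_add, add_mul, smul_add]; abel

theorem sbr_add_left (s : ZMod 2) (A B C : Module.End ℂ W) :
    sbr s (A + B) C = sbr s A C + sbr s B C := by
  simp only [sbr_def, mul_add, add_mul, smul_add]; abel

theorem sbr_smul_right (s : ZMod 2) (a : ℂ) (A B : Module.End ℂ W) :
    sbr s A (a • B) = a • sbr s A B := by
  simp only [sbr_def, mul_smul_comm, smul_mul_assoc, smul_sub]
  rw [smul_comm]

theorem sbr_smul_left (s : ZMod 2) (a : ℂ) (A B : Module.End ℂ W) :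
    sbr s (a • A) B = a • sbr s A B := by
  simp only [sbr_def, mul_smul_comm, smul_mul_assoc, smul_sub]
  rw [smul_comm]

@[simp] theorem sbr_zero_right (s : ZMod 2) (A : Module.End ℂ W) : sbr s A 0 = 0 := by
  simp [sbr_def]

@[simp] theorem sbr_zero_left (s : ZMod 2) (A : Module.End ℂ W) : sbr s 0 A = 0 := by
  simp [sbr_def]

theorem sbr_sum_right {ι : Type*} (s : ZMod 2) (A : Module.End ℂ W) (t : Finset ι)
    (B : ι → Module.End ℂ W) : sbr s A (∑ i ∈ t, B i) = ∑ i ∈ t, sbr s A (B i) := by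
  simp only [sbr_def, Finset.mul_sum, Finset.sum_mul, Finset.smul_sum, Finset.sum_sub_distrib]

theorem sbr_sum_left {ι : Type*} (s : ZMod 2) (A : Module.End ℂ W) (t : Finset ι)
    (B : ι → Module.End ℂ W) : sbr s (∑ i ∈ t, B i) A = ∑ i ∈ t, sbr s (B i) A := by
  simp only [sbr_def, Finset.mul_sum, Finset.sum_mul, Finset.smul_sum, Finset.sum_sub_distrib]

/-- The exponents s and t are free and need not come from parities of operators: the identity holds
in any associative algebra because `sgn` is multiplicative. No grading of `W` is therefore ever
needed. Parities enter only as labels in the exponents, through s = deg A · deg B. -/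
theorem sbr_mul_right (s t : ZMod 2) (A B C : Module.End ℂ W) :
    sbr (s + t) A (B * C) = sbr s A B * C + sgn s • (B * sbr t A C) := by
  simp only [sbr_def, sgn_add, sub_mul, mul_sub, smul_sub, smul_mul_assoc, mul_smul_comm,
    smul_smul, mul_assoc]
  abel

theorem sbr_mul_left (s t : ZMod 2) (A B C : Module.End ℂ W) :
    sbr (s + t) (A * B) C = A * sbr s B C + sgn s • (sbr t A C * B) := by
  simp only [sbr_def, sgn_add, sub_mul, mul_sub, smul_sub, smul_mul_assoc, mul_smul_comm,
    smul_smul, mul_assoc]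
  abel

/-- The graded Jacobi identity. -/
theorem sbr_sbr (s t u : ZMod 2) (A B C : Module.End ℂ W) :
    sbr (t + s) A (sbr u B C) =
      sbr (t + u) (sbr s A B) C + sgn s • sbr (s + u) B (sbr t A C) := by
  simp only [sbr_def, sgn_add, sub_mul, mul_sub, smul_sub, smul_mul_assoc, mul_smul_comm,
    smul_smul, mul_assoc]
  have h : sgn s * (sgn s * sgn u) = sgn u := by rw [← mul_assoc, sgn_mul_self, one_mul]
  rw [h]
  simp only [mul_comm, mul_left_comm]
  simp only [← mul_assoc, sgn_mul_self, one_mul]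
  abel_nf

end Sbr

/-! ### Locally finite sums -/

section HasLS

variable {W : Type*} [AddCommGroup W] [Module ℂ W] {ι κ : Type*}

/-- On each vector only finitely many of the operators are nonzero. -/
def LF (f : ι → Module.End ℂ W) : Prop := ∀ w, (Function.support fun b => f b w).Finite

/-- `S` is the sum of the locally finite family `f`. -/
def HasLS (f : ι → Module.End ℂ W) (S : Module.End ℂ W) : Prop :=
  LF f ∧ ∀ w, ∑ᶠ b, f b w = S w

theorem locSum_apply {f : ℤ → Module.End ℂ W} (h : LocFin f) (w : W) :
    locSum f w = ∑ᶠ b, f b w := by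
  rw [locSum, dif_pos h]; rfl

theorem LocFin.hasLS {f : ℤ → Module.End ℂ W} (h : LocFin f) : HasLS f (locSum f) :=
  ⟨h, fun w => (locSum_apply h w).symm⟩

/-- The basic tool for operator identities: a composite operator is known only through its values as
a sum, so two of them are compared by rewriting their families of terms into each other. -/
theorem HasLS.unique {f : ι → Module.End ℂ W} {S T : Module.End ℂ W} (hS : HasLS f S)
    (hT : HasLS f T) : S = T :=
  LinearMap.ext fun w => (hS.2 w).symm.trans (hT.2 w)

theorem HasLS.locSum_eq {f : ℤ → Module.End ℂ W} {S : Module.End ℂ W} (hS : HasLS f S) :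
    locSum f = S := (LocFin.hasLS hS.1).unique hS

theorem HasLS.congr {f g : ι → Module.End ℂ W} {S : Module.End ℂ W} (hS : HasLS f S)
    (h : ∀ b, f b = g b) : HasLS g S := by
  rwa [← funext h]

theorem HasLS.add {f g : ι → Module.End ℂ W} {S T : Module.End ℂ W} (hS : HasLS f S)
    (hT : HasLS g T) : HasLS (fun b => f b + g b) (S + T) := by
  refine ⟨fun w => ((hS.1 w).union (hT.1 w)).subset (Function.support_add _ _), fun w => ?_⟩
  simp only [LinearMap.add_apply]
  rw [finsum_add_distrib (hS.1 w) (hT.1 w), hS.2, hT.2]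

theorem HasLS.map {f : ι → Module.End ℂ W} {S : Module.End ℂ W} (hS : HasLS f S)
    (X : Module.End ℂ W) : HasLS (fun b => X * f b) (X * S) := by
  refine ⟨fun w => (hS.1 w).subset fun b hb => ?_, fun w => ?_⟩
  · intro h
    exact hb ((congrArg X h).trans (map_zero X))
  · simp only [Module.End.mul_apply]
    rw [← hS.2 w]
    exact (AddMonoidHom.map_finsum X.toAddMonoidHom (hS.1 w)).symm

theorem HasLS.comp {f : ι → Module.End ℂ W} {S : Module.End ℂ W} (hS : HasLS f S)
    (X : Module.End ℂ W) : HasLS (fun b => f b * X) (S * X) :=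
  ⟨fun w => hS.1 (X w), fun w => hS.2 (X w)⟩

theorem HasLS.smul {f : ι → Module.End ℂ W} {S : Module.End ℂ W} (hS : HasLS f S)
    (a : ℂ) : HasLS (fun b => a • f b) (a • S) := by
  simpa using hS.map (a • 1)

theorem HasLS.neg {f : ι → Module.End ℂ W} {S : Module.End ℂ W} (hS : HasLS f S) :
    HasLS (fun b => -f b) (-S) := by
  simpa using hS.smul (-1)

theorem HasLS.sub {f g : ι → Module.End ℂ W} {S T : Module.End ℂ W} (hS : HasLS f S)
    (hT : HasLS g T) : HasLS (fun b => f b - g b) (S - T) := by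
  simpa [sub_eq_add_neg] using hS.add hT.neg

theorem HasLS.zero : HasLS (fun _ : ι => (0 : Module.End ℂ W)) 0 :=
  ⟨fun w => by simp, fun w => by simp⟩

theorem HasLS.sbr_right {f : ι → Module.End ℂ W} {S : Module.End ℂ W} (hS : HasLS f S)
    (s : ZMod 2) (X : Module.End ℂ W) : HasLS (fun b => sbr s X (f b)) (sbr s X S) :=
  (hS.map X).sub ((hS.comp X).smul _)

theorem HasLS.sbr_left {f : ι → Module.End ℂ W} {S : Module.End ℂ W} (hS : HasLS f S)
    (s : ZMod 2) (X : Module.End ℂ W) : HasLS (fun b => sbr s (f b) X) (sbr s S X) :=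
  (hS.comp X).sub ((hS.map X).smul _)

theorem HasLS.single (b₀ : ι) {f : ι → Module.End ℂ W} (h : ∀ b, b ≠ b₀ → f b = 0) :
    HasLS f (f b₀) := by
  refine ⟨fun w => (Set.finite_singleton b₀).subset fun b hb => ?_, fun w => ?_⟩
  · by_contra hne
    exact hb (by simp only; rw [h b hne]; rfl)
  · exact finsum_eq_single _ b₀ fun b hb => by rw [h b hb]; rfl

theorem HasLS.equiv {f : ι → Module.End ℂ W} {S : Module.End ℂ W} (hS : HasLS f S)
    (e : κ ≃ ι) : HasLS (fun b => f (e b)) S := by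
  refine ⟨fun w => ?_, fun w => ?_⟩
  · have := (hS.1 w).preimage (e.injective.injOn (s := e ⁻¹' Function.support fun b => f b w))
    exact this
  · rw [← hS.2 w]
    exact finsum_comp_equiv e (f := fun b => f b w)

/-- Local finiteness of the whole double family has to be assumed. Existence of the iterated sum
would not imply it, since infinitely many nonzero terms may cancel inside the inner sums. -/
theorem LF.hasLS_of_inner {f : ι × κ → Module.End ℂ W} (hf : LF f) {g : ι → Module.End ℂ W}
    {S : Module.End ℂ W} (hg : ∀ i, HasLS (fun j => f (i, j)) (g i)) (hS : HasLS g S) :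
    HasLS f S := by
  refine ⟨hf, fun w => ?_⟩
  rw [finsum_curry _ (hf w), ← hS.2 w]
  exact finsum_congr fun i => (hg i).2 w

theorem LF.hasLS_of_inner_right {f : ι × κ → Module.End ℂ W} (hf : LF f)
    {g : κ → Module.End ℂ W} {S : Module.End ℂ W}
    (hg : ∀ j, HasLS (fun i => f (i, j)) (g j)) (hS : HasLS g S) : HasLS f S := by
  have h1 : LF fun x : κ × ι => f (x.2, x.1) := fun w =>
    (hf w).preimage ((Equiv.prodComm κ ι).injective.injOn)
  exact (h1.hasLS_of_inner hg hS).equiv (Equiv.prodComm ι κ)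

/-- A locally finite family that can be summed in one order has a sum. -/
theorem HasLS.fubini {f : ι × κ → Module.End ℂ W} {g : ι → Module.End ℂ W}
    {S : Module.End ℂ W} (hf : HasLS f S) (hg : ∀ i, HasLS (fun j => f (i, j)) (g i)) :
    HasLS g S := by
  have key : ∀ w, (fun i => ∑ᶠ j, f (i, j) w) = fun i => g i w := fun w =>
    funext fun i => (hg i).2 w
  refine ⟨fun w => ((hf.1 w).image Prod.fst).subset fun i hi => ?_, fun w => ?_⟩
  · by_contra hne
    refine hi ?_
    simp only
    rw [← (hg i).2 w]
    refine (finsum_congr fun j => ?_).trans finsum_zero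
    by_contra hj
    exact hne ⟨(i, j), hj, rfl⟩
  · rw [← hf.2 w, finsum_curry _ (hf.1 w)]
    exact (finsum_congr fun i => (hg i).2 w).symm

/-- The right factor acts first: on a given vector only finitely many of its terms survive, and on
each of the resulting vectors only finitely many terms of the left factor do. -/
theorem HasLS.mul {f : ι → Module.End ℂ W} {g : κ → Module.End ℂ W} {S T : Module.End ℂ W}
    (hS : HasLS f S) (hT : HasLS g T) :
    HasLS (fun x : ι × κ => f x.1 * g x.2) (S * T) := by
  have hf : LF fun x : ι × κ => f x.1 * g x.2 := fun w => by
    have : (⋃ b ∈ Function.support fun b => g b w,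
        (Function.support fun a => f a (g b w)) ×ˢ ({b} : Set κ)).Finite :=
      (hT.1 w).biUnion fun b _ => (hS.1 _).prod (Set.finite_singleton b)
    refine this.subset fun x hx => ?_
    simp only [Set.mem_iUnion]
    refine ⟨x.2, fun h => hx ?_, hx, rfl⟩
    exact (congrArg (f x.1) h).trans (map_zero _)
  exact hf.hasLS_of_inner_right (fun j => hS.comp (g j)) (hT.map S)

theorem HasLS.sbr {f : ι → Module.End ℂ W} {g : κ → Module.End ℂ W} {S T : Module.End ℂ W}
    (hS : HasLS f S) (hT : HasLS g T) (s : ZMod 2) :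
    HasLS (fun x : ι × κ => sbr s (f x.1) (g x.2)) (sbr s S T) :=
  (hS.mul hT).sub (((hT.mul hS).equiv (Equiv.prodComm ι κ)).smul _)

/-- Families over `ℤ` bounded on both sides on each vector are locally finite. -/
theorem LF.of_bounds {f : ℤ → Module.End ℂ W}
    (h : ∀ w, ∃ K L : ℤ, ∀ b, b < K ∨ L < b → f b w = 0) : LF f := fun w => by
  obtain ⟨K, L, hKL⟩ := h w
  refine (Set.finite_Icc K L).subset fun b hb => ?_
  by_contra hne
  refine hb (hKL b ?_)
  rw [Set.mem_Icc, not_and_or, not_le, not_le] at hne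
  exact hne

theorem LF.of_bounds₂ {f : ℤ × ℤ → Module.End ℂ W}
    (h : ∀ w, ∃ K L : ℤ, ∀ a b, a < K ∨ L < a ∨ b < K ∨ L < b → f (a, b) w = 0) : LF f :=
  fun w => by
  obtain ⟨K, L, hKL⟩ := h w
  refine ((Set.finite_Icc K L).prod (Set.finite_Icc K L)).subset fun x hx => ?_
  by_contra hne
  refine hx (hKL x.1 x.2 ?_)
  simp only [Set.mem_prod, Set.mem_Icc] at hne
  omega

end HasLS

/-! ### Products of fields -/

section Fields

variable {W : Type*} [AddCommGroup W] [Module ℂ W]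

theorem MulOK.hasLS {A B : Fld W} (h : MulOK A B) (n : ℤ) :
    HasLS (fun b => A (n - b) * B b) (fmul A B n) := LocFin.hasLS (h n)

theorem fmul_eq_of_hasLS {A B : Fld W} {n : ℤ} {S : Module.End ℂ W}
    (h : HasLS (fun b => A (n - b) * B b) S) : fmul A B n = S := h.locSum_eq

/-- `QFun` admits products without asking that they converge, so inductions over it that precede the
proof of convergence must also treat the default value 0. -/
theorem fmul_of_not {A B : Fld W} {n : ℤ} (h : ¬ LocFin fun b => A (n - b) * B b) :
    fmul A B n = 0 := by rw [fmul, locSum, dif_neg h]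

theorem fexp_hasLS (m : ℤ) (A : Fld W) (n : ℤ) :
    HasLS (fun b => fexp m (n - b) * A b) (A (n + m)) := by
  have h := HasLS.single (f := fun b => fexp m (n - b) * A b) (n + m) ?_
  · simpa [fexp] using h
  · intro b hb
    have : n - b ≠ -m := fun h => hb (by omega)
    simp [fexp, this]

theorem fmul_fexp (m : ℤ) (A : Fld W) : fmul (fexp m) A = fun n => A (n + m) :=
  funext fun n => fmul_eq_of_hasLS (fexp_hasLS m A n)

end Fields

end SuperTraj

namespace SuperTraj

/-! ### Functionals of the trajectory -/

namespace TrajOps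

variable {N M : ℕ} {W : Type*} [AddCommGroup W] [Module ℂ W] {R : TrajOps N M W}
  {p r s : ZMod 2} {A B C : Fld W}

/-- A graded derivation that vanishes on the generators q^i vanishes on everything built from them.
Applied first to modes of q and then to modes of a functional, this gives supercommutativity of all
functionals. -/
theorem QFun.sbr_eq_zero {X : Module.End ℂ W}
    (hX : ∀ i n, sbr (s * sdeg i) X (R.q i n) = 0) (hA : R.QFun p A) :
    ∀ n, sbr (s * p) X (A n) = 0 := by
  induction hA with
  | zero p => intro n; simp
  | exp m =>
    intro n
    unfold fexp
    split_ifs <;> simp [sbr_def]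
  | traj i => exact hX i
  | dt _ ih => intro n; rw [fdt, sbr_smul_right, ih, smul_zero]
  | add _ _ ih1 ih2 => intro n; rw [Pi.add_apply, sbr_add_right, ih1, ih2, add_zero]
  | smul a _ ih => intro n; rw [Pi.smul_apply, sbr_smul_right, ih, smul_zero]
  | @mul p r A B _ _ ih1 ih2 =>
    intro n
    by_cases h : LocFin fun b => A (n - b) * B b
    · refine ((LocFin.hasLS h).sbr_right _ X).unique (HasLS.zero.congr fun b => ?_)
      rw [mul_add, sbr_mul_right, ih1, ih2]; simp
    · rw [fmul_of_not h, sbr_zero_right]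

variable {c k₁ k₂ : ℂ}

theorem QFun.comm (hR : R.IsRep c k₁ k₂) (hA : R.QFun p A) (hB : R.QFun r B) (m n : ℤ) :
    sbr (p * r) (A m) (B n) = 0 := by
  refine hB.sbr_eq_zero (fun i k => ?_) n
  refine sbr_swap_zero ?_
  rw [mul_comm]
  exact hA.sbr_eq_zero (fun j l => hR.qq i j k l) m

theorem QFun.comm_apply (hR : R.IsRep c k₁ k₂) (hA : R.QFun p A) (hB : R.QFun r B) (m n : ℤ)
    (w : W) : A m (B n w) = sgn (p * r) • B n (A m w) :=
  LinearMap.congr_fun (sbr_eq_zero_iff.1 (hA.comm hR hB m n)) w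

/-- For a product and n < K + L, each term A_{n-b} B_b has b < L or n - b < K. In the first case B_b
kills the vector; in the second the modes are exchanged up to a sign and A_{n-b} does. -/
theorem QFun.truncated (hR : R.IsRep c k₁ k₂) (hA : R.QFun p A) : Truncated A := by
  induction hA with
  | zero p => exact fun v => ⟨0, fun n _ => rfl⟩
  | exp m =>
    refine fun v => ⟨-m, fun n hn => ?_⟩
    rw [fexp, if_neg hn.ne]; rfl
  | traj i => exact hR.trunc_q i
  | dt _ ih =>
    intro v
    obtain ⟨K, hK⟩ := ih v
    exact ⟨K, fun n hn => by rw [fdt, LinearMap.smul_apply, hK n hn, smul_zero]⟩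
  | add _ _ ih1 ih2 =>
    intro v
    obtain ⟨K, hK⟩ := ih1 v
    obtain ⟨L, hL⟩ := ih2 v
    exact ⟨min K L, fun n hn => by
      rw [Pi.add_apply, LinearMap.add_apply, hK n (by omega), hL n (by omega), add_zero]⟩
  | smul a _ ih =>
    intro v
    obtain ⟨K, hK⟩ := ih v
    exact ⟨K, fun n hn => by rw [Pi.smul_apply, LinearMap.smul_apply, hK n hn, smul_zero]⟩
  | @mul p r A B hA hB ih1 ih2 =>
    intro v
    obtain ⟨K, hK⟩ := ih1 v
    obtain ⟨L, hL⟩ := ih2 v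
    refine ⟨K + L, fun n hn => ?_⟩
    by_cases h : LocFin fun b => A (n - b) * B b
    · rw [fmul, locSum_apply h]
      refine (finsum_congr fun b => ?_).trans finsum_zero
      rw [Module.End.mul_apply]
      by_cases hb : b < L
      · rw [hL b hb, map_zero]
      · rw [hA.comm_apply hR hB, hK _ (by omega), map_zero, smul_zero]
    · rw [fmul_of_not h]; rfl

/-- The product of three modes kills a vector if one of the frequencies is negative enough. -/
def Trunc₃ (A B C : Fld W) : Prop :=
  ∀ w, ∃ K : ℤ, ∀ a b c, a < K ∨ b < K ∨ c < K → A a (B b (C c w)) = 0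

/-- Any of the three factors can be brought to the right at the cost of a sign, so one bound serves
all frequencies at once. This uniformity makes the double sum behind associativity locally finite.
-/
theorem QFun.trunc₃ (hR : R.IsRep c k₁ k₂) (hA : R.QFun p A) (hB : R.QFun r B)
    (hC : R.QFun s C) : Trunc₃ A B C := by
  intro w
  obtain ⟨K, hK⟩ := hA.truncated hR w
  obtain ⟨L, hL⟩ := hB.truncated hR w
  obtain ⟨J, hJ⟩ := hC.truncated hR w
  refine ⟨min K (min L J), fun a b c h => ?_⟩
  rcases h with h | h | h
  · rw [hB.comm_apply hR hC, map_smul, hA.comm_apply hR hC, hA.comm_apply hR hB,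
      hK a (by omega)]; simp
  · rw [hB.comm_apply hR hC, hL b (by omega)]; simp
  · rw [hJ c (by omega)]; simp

variable (R) in
/-- The space spanned by the homogeneous functionals of the trajectory. -/
def qspan : Submodule ℂ (Fld W) := Submodule.span ℂ {A | ∃ p, R.QFun p A}

theorem QFun.mem_qspan (hA : R.QFun p A) : A ∈ R.qspan := Submodule.subset_span ⟨p, hA⟩

theorem Trunc₃.add₁ {A' : Fld W} (h : Trunc₃ A B C) (h' : Trunc₃ A' B C) :
    Trunc₃ (A + A') B C := fun w => by
  obtain ⟨K, hK⟩ := h w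
  obtain ⟨L, hL⟩ := h' w
  exact ⟨min K L, fun a b c h => by
    rw [Pi.add_apply, LinearMap.add_apply, hK a b c (by omega), hL a b c (by omega), add_zero]⟩

theorem Trunc₃.add₂ {B' : Fld W} (h : Trunc₃ A B C) (h' : Trunc₃ A B' C) :
    Trunc₃ A (B + B') C := fun w => by
  obtain ⟨K, hK⟩ := h w
  obtain ⟨L, hL⟩ := h' w
  exact ⟨min K L, fun a b c h => by
    rw [Pi.add_apply, LinearMap.add_apply, map_add, hK a b c (by omega), hL a b c (by omega),
      add_zero]⟩

theorem Trunc₃.add₃ {C' : Fld W} (h : Trunc₃ A B C) (h' : Trunc₃ A B C') :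
    Trunc₃ A B (C + C') := fun w => by
  obtain ⟨K, hK⟩ := h w
  obtain ⟨L, hL⟩ := h' w
  exact ⟨min K L, fun a b c h => by
    rw [Pi.add_apply, LinearMap.add_apply, map_add, map_add, hK a b c (by omega),
      hL a b c (by omega), add_zero]⟩

/-- Commuting factors up to one sign makes sense for homogeneous functionals only, whereas the
vanishing of low frequencies is stable under sums. The bound therefore passes to the linear span,
one slot at a time. -/
theorem trunc₃_of_mem (hR : R.IsRep c k₁ k₂) (hA : A ∈ R.qspan) (hB : B ∈ R.qspan)
    (hC : C ∈ R.qspan) : Trunc₃ A B C := by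
  unfold qspan at hA hB hC
  induction hA using Submodule.span_induction with
  | mem A hA =>
    obtain ⟨p, hA⟩ := hA
    induction hB using Submodule.span_induction with
    | mem B hB =>
      obtain ⟨r, hB⟩ := hB
      induction hC using Submodule.span_induction with
      | mem C hC =>
        obtain ⟨s, hC⟩ := hC
        exact hA.trunc₃ hR hB hC
      | zero => exact fun w => ⟨0, fun a b c _ => by simp⟩
      | add _ _ _ _ h1 h2 => exact h1.add₃ h2
      | smul x _ _ h =>
        intro w
        obtain ⟨K, hK⟩ := h w
        exact ⟨K, fun a b c h => by simp [hK a b c h]⟩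
    | zero => exact fun w => ⟨0, fun a b c _ => by simp⟩
    | add _ _ _ _ h1 h2 => exact h1.add₂ h2
    | smul x _ _ h =>
      intro w
      obtain ⟨K, hK⟩ := h w
      exact ⟨K, fun a b c h => by simp [hK a b c h]⟩
  | zero => exact fun w => ⟨0, fun a b c _ => by simp⟩
  | add _ _ _ _ h1 h2 => exact h1.add₁ h2
  | smul x _ _ h =>
    intro w
    obtain ⟨K, hK⟩ := h w
    exact ⟨K, fun a b c h => by simp [hK a b c h]⟩

theorem trunc₂_of_mem (hR : R.IsRep c k₁ k₂) (hA : A ∈ R.qspan) (hB : B ∈ R.qspan) (w : W) :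
    ∃ K : ℤ, ∀ a b, a < K ∨ b < K → A a (B b w) = 0 := by
  obtain ⟨K, hK⟩ := trunc₃_of_mem hR (QFun.exp (R := R) 0).mem_qspan hA hB w
  refine ⟨K, fun a b h => ?_⟩
  simpa [fexp] using hK 0 a b (Or.inr h)

theorem mulOK_of_mem (hR : R.IsRep c k₁ k₂) (hA : A ∈ R.qspan) (hB : B ∈ R.qspan) :
    MulOK A B := fun n => LF.of_bounds fun w => by
  obtain ⟨K, hK⟩ := trunc₂_of_mem hR hA hB w
  exact ⟨K, n - K, fun b h => hK _ _ (by omega)⟩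

theorem fmul_add_right {A B C : Fld W} (hB : MulOK A B) (hC : MulOK A C) :
    fmul A (B + C) = fmul A B + fmul A C := funext fun n =>
  fmul_eq_of_hasLS (((hB.hasLS n).add (hC.hasLS n)).congr fun b => by
    rw [Pi.add_apply, mul_add])

theorem fmul_add_left {A B C : Fld W} (hA : MulOK A C) (hB : MulOK B C) :
    fmul (A + B) C = fmul A C + fmul B C := funext fun n =>
  fmul_eq_of_hasLS (((hA.hasLS n).add (hB.hasLS n)).congr fun b => by
    rw [Pi.add_apply, add_mul])

theorem fmul_smul_right {A B : Fld W} (a : ℂ) (hB : MulOK A B) :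
    fmul A (a • B) = a • fmul A B := funext fun n =>
  fmul_eq_of_hasLS (((hB.hasLS n).smul a).congr fun b => by
    rw [Pi.smul_apply, mul_smul_comm])

theorem fmul_smul_left {A B : Fld W} (a : ℂ) (hB : MulOK A B) :
    fmul (a • A) B = a • fmul A B := funext fun n =>
  fmul_eq_of_hasLS (((hB.hasLS n).smul a).congr fun b => by
    rw [Pi.smul_apply, smul_mul_assoc])

theorem fmul_zero_right (A : Fld W) : fmul A 0 = 0 := funext fun _ =>
  fmul_eq_of_hasLS (HasLS.zero.congr fun b => by simp)

theorem fmul_zero_left (A : Fld W) : fmul 0 A = 0 := funext fun _ =>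
  fmul_eq_of_hasLS (HasLS.zero.congr fun b => by simp)

theorem fmul_mem (hR : R.IsRep c k₁ k₂) (hA : A ∈ R.qspan) (hB : B ∈ R.qspan) :
    fmul A B ∈ R.qspan := by
  have hA' := hA
  unfold qspan at hA'
  induction hA' using Submodule.span_induction with
  | mem A hA0 =>
    obtain ⟨p, hA0⟩ := hA0
    have hB' := hB
    unfold qspan at hB'
    induction hB' using Submodule.span_induction with
    | mem B hB0 =>
      obtain ⟨r, hB0⟩ := hB0
      exact (hA0.mul hB0).mem_qspan
    | zero => rw [fmul_zero_right]; exact zero_mem _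
    | add B C hB1 hC1 h1 h2 =>
      rw [fmul_add_right (mulOK_of_mem hR hA hB1) (mulOK_of_mem hR hA hC1)]
      exact add_mem (h1 hB1) (h2 hC1)
    | smul x B hB1 h =>
      rw [fmul_smul_right x (mulOK_of_mem hR hA hB1)]
      exact Submodule.smul_mem _ _ (h hB1)
  | zero => rw [fmul_zero_left]; exact zero_mem _
  | add A C hA1 hC1 h1 h2 =>
    rw [fmul_add_left (mulOK_of_mem hR hA1 hB) (mulOK_of_mem hR hC1 hB)]
    exact add_mem (h1 hA1) (h2 hC1)
  | smul x A hA1 h =>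
    rw [fmul_smul_left x (mulOK_of_mem hR hA1 hB)]
    exact Submodule.smul_mem _ _ (h hA1)

theorem fmul_assoc (hR : R.IsRep c k₁ k₂) (hA : A ∈ R.qspan) (hB : B ∈ R.qspan)
    (hC : C ∈ R.qspan) : fmul (fmul A B) C = fmul A (fmul B C) := funext fun n => by
  have hf : LF fun x : ℤ × ℤ => A (n - x.1 - x.2) * B x.2 * C x.1 := LF.of_bounds₂ fun w => by
    obtain ⟨K, hK⟩ := trunc₃_of_mem hR hA hB hC w
    refine ⟨K, n - K - K, fun a b h => hK _ _ _ ?_⟩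
    dsimp only
    omega
  have h1 : HasLS (fun x : ℤ × ℤ => A (n - x.1 - x.2) * B x.2 * C x.1)
      (fmul (fmul A B) C n) :=
    hf.hasLS_of_inner (fun b => ((mulOK_of_mem hR hA hB).hasLS (n - b)).comp (C b))
      ((mulOK_of_mem hR (fmul_mem hR hA hB) hC).hasLS n)
  -- The original coordinates are the frequencies of C and of B. The new ones are d, the total
  -- frequency of B C, and the frequency of C, so that the inner sum is (B C)_d.
  let e : ℤ × ℤ ≃ ℤ × ℤ :=
    { toFun := fun x => (x.2, x.1 - x.2)
      invFun := fun x => (x.1 + x.2, x.1)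
      left_inv := fun x => by ext <;> simp
      right_inv := fun x => by ext <;> simp }
  have h2 := (h1.equiv e).fubini (g := fun d => A (n - d) * fmul B C d) fun d =>
    (((mulOK_of_mem hR hB hC).hasLS d).map (A (n - d))).congr fun b => by
      simp [e, mul_assoc]
  exact h2.unique ((mulOK_of_mem hR hA (fmul_mem hR hB hC)).hasLS n)

theorem fdt_fmul (hR : R.IsRep c k₁ k₂) (hA : A ∈ R.qspan) (hB : B ∈ R.qspan)
    (hA' : fdt A ∈ R.qspan) (hB' : fdt B ∈ R.qspan) :
    fdt (fmul A B) = fmul (fdt A) B + fmul A (fdt B) := funext fun n => by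
  refine (((mulOK_of_mem hR hA hB).hasLS n).smul (-Complex.I * n)).unique
    ((((mulOK_of_mem hR hA' hB).hasLS n).add ((mulOK_of_mem hR hA hB').hasLS n)).congr
      fun b => ?_)
  simp only [fdt, smul_mul_assoc, mul_smul_comm, ← add_smul]
  congr 1
  push_cast
  ring

/-- The derivative, as a linear map. -/
def fdtL : Fld W →ₗ[ℂ] Fld W where
  toFun := fdt
  map_add' := fun A B => funext fun n => by simp [fdt]
  map_smul' := fun a A => funext fun n => by simp [fdt, smul_smul, mul_comm]

theorem fdt_mem (hA : A ∈ R.qspan) : fdt A ∈ R.qspan := by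
  have : R.qspan ≤ R.qspan.comap fdtL := by
    refine Submodule.span_le.2 ?_
    rintro A ⟨p, hA⟩
    exact hA.dt.mem_qspan
  exact this hA

theorem fmul_comm (hR : R.IsRep c k₁ k₂) (hA : R.QFun p A) (hB : R.QFun r B) :
    fmul A B = sgn (p * r) • fmul B A := funext fun n => by
  refine fmul_eq_of_hasLS (((((mulOK_of_mem hR hB.mem_qspan hA.mem_qspan).hasLS n).equiv
    (Equiv.subLeft n)).smul (sgn (p * r))).congr fun b => ?_)
  rw [Equiv.subLeft_apply, sub_sub_cancel]
  exact (sbr_eq_zero_iff.1 (hA.comm hR hB _ _)).symm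

/-! ### The ring of functionals of the trajectory -/

/-- The supercommutative ring spanned by the functionals of the trajectory. -/
def QRing (_ : R.IsRep c k₁ k₂) : Type _ := R.qspan

namespace QRing

variable {hR : R.IsRep c k₁ k₂}

instance : AddCommGroup (QRing hR) := inferInstanceAs (AddCommGroup R.qspan)

instance : Module ℂ (QRing hR) := inferInstanceAs (Module ℂ R.qspan)

/-- The field underlying an element of the ring. -/
def fld (A : QRing hR) : Fld W := A.1

/-- The `n`-th mode. -/
def mode (n : ℤ) : QRing hR →ₗ[ℂ] Module.End ℂ W where
  toFun A := A.fld n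
  map_add' _ _ := rfl
  map_smul' _ _ := rfl

@[ext] theorem ext {A B : QRing hR} (h : A.fld = B.fld) : A = B := Subtype.ext h

instance : Mul (QRing hR) := ⟨fun A B => ⟨fmul A.fld B.fld, fmul_mem hR A.2 B.2⟩⟩

instance : One (QRing hR) := ⟨⟨fexp 0, (QFun.exp 0).mem_qspan⟩⟩

@[simp] theorem fld_add (A B : QRing hR) : (A + B).fld = A.fld + B.fld := rfl
@[simp] theorem fld_sub (A B : QRing hR) : (A - B).fld = A.fld - B.fld := rfl
@[simp] theorem fld_neg (A : QRing hR) : (-A).fld = -A.fld := rfl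
@[simp] theorem fld_zero : (0 : QRing hR).fld = 0 := rfl
@[simp] theorem fld_one : (1 : QRing hR).fld = fexp 0 := rfl
@[simp] theorem fld_smul (a : ℂ) (A : QRing hR) : (a • A).fld = a • A.fld := rfl
@[simp] theorem fld_mul (A B : QRing hR) : (A * B).fld = fmul A.fld B.fld := rfl

/-- Taking the underlying field, as a linear map. -/
def fldL (hR : R.IsRep c k₁ k₂) : QRing hR →ₗ[ℂ] Fld W where
  toFun := fld
  map_add' _ _ := rfl
  map_smul' _ _ := rfl

@[simp] theorem fld_sum {ι : Type*} (t : Finset ι) (A : ι → QRing hR) :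
    (∑ i ∈ t, A i).fld = ∑ i ∈ t, (A i).fld := map_sum (fldL hR) A t

theorem ok (A B : QRing hR) : MulOK A.fld B.fld := mulOK_of_mem hR A.2 B.2

instance : Ring (QRing hR) :=
  { (inferInstance : AddCommGroup (QRing hR)) with
    mul := (· * ·)
    one := 1
    left_distrib := fun A B C => ext (fmul_add_right (ok A B) (ok A C))
    right_distrib := fun A B C => ext (fmul_add_left (ok A C) (ok B C))
    zero_mul := fun A => ext (fmul_zero_left _)
    mul_zero := fun A => ext (fmul_zero_right _)
    mul_assoc := fun A B C => ext (fmul_assoc hR A.2 B.2 C.2)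
    one_mul := fun A => ext ((fmul_fexp 0 A.fld).trans (by simp))
    mul_one := fun A => ext <| funext fun n => by
      refine fmul_eq_of_hasLS ?_
      have h := HasLS.single (f := fun b => A.fld (n - b) * (fexp 0 : Fld W) b) 0 ?_
      · simpa [fexp] using h
      · intro b hb
        simp [fexp, hb] }

instance : Algebra ℂ (QRing hR) :=
  Algebra.ofModule (fun a A B => ext (fmul_smul_left a (ok A B)))
    (fun a A B => ext (fmul_smul_right a (ok A B)))

theorem mode_apply (n : ℤ) (A : QRing hR) : mode n A = A.fld n := rfl

/-- The time derivative on the ring. -/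
def d (hR : R.IsRep c k₁ k₂) : QRing hR →ₗ[ℂ] QRing hR where
  toFun A := ⟨fdt A.fld, fdt_mem A.2⟩
  map_add' _ _ := ext (fdtL.map_add _ _)
  map_smul' _ _ := ext (fdtL.map_smul _ _)

@[simp] theorem fld_d (A : QRing hR) : (d hR A).fld = fdt A.fld := rfl

theorem d_mul (A B : QRing hR) : d hR (A * B) = d hR A * B + A * d hR B :=
  ext (fdt_fmul hR A.2 B.2 (d hR A).2 (d hR B).2)

theorem fld_d_zero (A : QRing hR) : (d hR A).fld 0 = 0 := by simp [fdt]

/-- Homogeneous elements. -/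
def Hom (p : ZMod 2) (A : QRing hR) : Prop := R.QFun p A.fld

theorem Hom.zero : Hom p (0 : QRing hR) := QFun.zero p

theorem Hom.one : Hom 0 (1 : QRing hR) := QFun.exp 0

theorem Hom.add {A B : QRing hR} (hA : Hom p A) (hB : Hom p B) : Hom p (A + B) := QFun.add hA hB

theorem Hom.smul {A : QRing hR} (a : ℂ) (hA : Hom p A) : Hom p (a • A) := QFun.smul a hA

theorem Hom.neg {A : QRing hR} (hA : Hom p A) : Hom p (-A) := by simpa using hA.smul (-1)

theorem Hom.sub {A B : QRing hR} (hA : Hom p A) (hB : Hom p B) : Hom p (A - B) := by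
  simpa [sub_eq_add_neg] using hA.add hB.neg

theorem Hom.mul {A B : QRing hR} (hA : Hom p A) (hB : Hom r B) : Hom (p + r) (A * B) :=
  QFun.mul hA hB

theorem Hom.d {A : QRing hR} (hA : Hom p A) : Hom p (QRing.d hR A) := QFun.dt hA

theorem Hom.sum {ι : Type*} (t : Finset ι) {A : ι → QRing hR} (h : ∀ i ∈ t, Hom p (A i)) :
    Hom p (∑ i ∈ t, A i) := by
  classical
  induction t using Finset.induction_on with
  | empty => simpa using Hom.zero
  | insert a t ha ih =>
    rw [Finset.sum_insert ha]
    exact (h a (Finset.mem_insert_self a t)).add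
      (ih fun i hi => h i (Finset.mem_insert_of_mem hi))

theorem Hom.cast {A : QRing hR} (hA : Hom p A) (h : p = r) : Hom r A := h ▸ hA

theorem Hom.comm {A B : QRing hR} (hA : Hom p A) (hB : Hom r B) :
    A * B = sgn (p * r) • (B * A) := ext (fmul_comm hR hA hB)

theorem hasLS_mul (A B : QRing hR) (n : ℤ) :
    HasLS (fun b => A.fld (n - b) * B.fld b) ((A * B).fld n) := (ok A B).hasLS n

end QRing

end TrajOps

end SuperTraj

namespace SuperTraj

set_option linter.unusedSectionVars false

/-! ### Multiplication and differentiation of superpolynomials -/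

section SuperPoly

variable {A O : Type*} [LinearOrder O]

theorem oddSign_mul_self (o : O) (S : Finset O) : oddSign o S * oddSign o S = 1 := by
  rw [oddSign, ← pow_add, ← two_mul, pow_mul]; simp

theorem oddSign_insert (o : O) {o' : O} {S : Finset O} (h : o' ∉ S) :
    oddSign o (insert o' S) = (if o' < o then -1 else 1) * oddSign o S := by
  unfold oddSign
  rw [Finset.filter_insert]
  split_ifs with h1
  · rw [Finset.card_insert_of_notMem (by simp [h]), pow_succ]; ring
  · rw [one_mul]

theorem oddSign_erase (o : O) {o' : O} {S : Finset O} (h : o' ∈ S) :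
    oddSign o (S.erase o') = (if o' < o then -1 else 1) * oddSign o S := by
  conv_rhs => rw [← Finset.insert_erase h, oddSign_insert o (Finset.notMem_erase o' S)]
  split_ifs <;> ring

theorem mulOdd_single (o : O) (m : A × Finset O) (a : ℂ) :
    mulOdd o (Finsupp.single m a : SuperPoly A O) =
      if o ∈ m.2 then 0 else Finsupp.single (m.1, insert o m.2) (a * oddSign o m.2) := by
  rw [mulOdd, Finsupp.linearCombination_single]
  split_ifs <;> simp

theorem derOdd_single (o : O) (m : A × Finset O) (a : ℂ) :
    derOdd o (Finsupp.single m a : SuperPoly A O) =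
      if o ∈ m.2 then Finsupp.single (m.1, m.2.erase o) (a * oddSign o m.2) else 0 := by
  rw [derOdd, Finsupp.linearCombination_single]
  split_ifs <;> simp

theorem superPoly_ext {V : Type*} [AddCommGroup V] [Module ℂ V]
    {f g : SuperPoly A O →ₗ[ℂ] V}
    (h : ∀ m, f (Finsupp.single m 1) = g (Finsupp.single m 1)) : f = g :=
  Finsupp.lhom_ext fun m a => by
    have : (Finsupp.single m a : SuperPoly A O) = a • Finsupp.single m 1 := by simp
    rw [this, map_smul, map_smul, h]

theorem mulOdd_mulOdd (o o' : O) (f : SuperPoly A O) :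
    mulOdd o (mulOdd o' f) = -mulOdd o' (mulOdd o f) := by
  have : (mulOdd o : SuperPoly A O →ₗ[ℂ] _) ∘ₗ mulOdd o' = -(mulOdd o' ∘ₗ mulOdd o) := by
    refine superPoly_ext fun m => ?_
    simp only [LinearMap.comp_apply, LinearMap.neg_apply, mulOdd_single]
    by_cases h1 : o ∈ m.2
    · by_cases h2 : o' ∈ m.2 <;> simp [h1, h2, mulOdd_single]
    · by_cases h2 : o' ∈ m.2
      · simp [h1, h2, mulOdd_single]
      · rcases lt_trichotomy o o' with h | h | h
        · simp [h1, h2, mulOdd_single, h.ne, h.ne', oddSign_insert, h, h.le, not_lt.2,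
            Finset.insert_comm o o', mul_comm]
        · subst h; simp [h1, mulOdd_single]
        · simp [h1, h2, mulOdd_single, h.ne, h.ne', oddSign_insert, h, h.le, not_lt.2,
            Finset.insert_comm o o', mul_comm]
  exact LinearMap.congr_fun this f

theorem derOdd_mulOdd (o o' : O) (f : SuperPoly A O) :
    derOdd o (mulOdd o' f) = (if o' = o then f else 0) - mulOdd o' (derOdd o f) := by
  have : (derOdd o : SuperPoly A O →ₗ[ℂ] _) ∘ₗ mulOdd o' =
      (if o' = o then LinearMap.id else 0) - mulOdd o' ∘ₗ derOdd o := by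
    refine superPoly_ext fun m => ?_
    simp only [LinearMap.comp_apply, LinearMap.sub_apply, mulOdd_single, derOdd_single]
    by_cases h : o' = o
    · subst h
      by_cases h1 : o' ∈ m.2
      · simp [h1, mulOdd_single, oddSign_erase, oddSign_mul_self]
      · simp [h1, derOdd_single, oddSign_insert, oddSign_mul_self]
    · by_cases h1 : o ∈ m.2
      · by_cases h2 : o' ∈ m.2
        · simp [h1, h2, h, mulOdd_single]
        · rcases lt_or_gt_of_ne h with h' | h'
          · simp [h1, h2, h, h', mulOdd_single, derOdd_single, oddSign_insert, oddSign_erase,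
              h'.le, not_lt.2, mul_comm, Finset.erase_insert_of_ne h]
          · simp [h1, h2, h, h', mulOdd_single, derOdd_single, oddSign_insert, oddSign_erase,
              h'.le, not_lt.2, mul_comm, Finset.erase_insert_of_ne h]
      · by_cases h2 : o' ∈ m.2
        · simp [h1, h2, h]
        · simp [h1, h2, h, derOdd_single, Ne.symm h]
  have h2 := LinearMap.congr_fun this f
  simp only [LinearMap.comp_apply, LinearMap.sub_apply] at h2
  rw [h2]
  split_ifs <;> rfl

theorem derOdd_derOdd (o o' : O) (f : SuperPoly A O) :
    derOdd o (derOdd o' f) = -derOdd o' (derOdd o f) := by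
  have : (derOdd o : SuperPoly A O →ₗ[ℂ] _) ∘ₗ derOdd o' = -(derOdd o' ∘ₗ derOdd o) := by
    refine superPoly_ext fun m => ?_
    simp only [LinearMap.comp_apply, LinearMap.neg_apply, derOdd_single]
    by_cases h1 : o ∈ m.2
    · by_cases h2 : o' ∈ m.2
      · rcases lt_trichotomy o o' with h | h | h
        · simp [h1, h2, derOdd_single, h.ne, h.ne', oddSign_erase, h, h.le, not_lt.2,
            Finset.erase_right_comm (a := o) (b := o'), mul_comm]
        · subst h; simp [h1, derOdd_single]
        · simp [h1, h2, derOdd_single, h.ne, h.ne', oddSign_erase, h, h.le, not_lt.2,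
            Finset.erase_right_comm (a := o) (b := o'), mul_comm]
      · simp [h1, h2, derOdd_single]
    · by_cases h2 : o' ∈ m.2 <;> simp [h1, h2, derOdd_single]
  exact LinearMap.congr_fun this f

/-- The operator that maps `z^a θ_S` to `c(a) z^(φ a) θ_S`. -/
def evenOp (φ : A → A) (c : A → ℂ) : SuperPoly A O →ₗ[ℂ] SuperPoly A O :=
  Finsupp.linearCombination ℂ fun m : A × Finset O =>
    (Finsupp.single (φ m.1, m.2) (c m.1) : SuperPoly A O)

theorem evenOp_single (φ : A → A) (c : A → ℂ) (m : A × Finset O) (a : ℂ) :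
    evenOp φ c (Finsupp.single m a : SuperPoly A O) =
      Finsupp.single (φ m.1, m.2) (a * c m.1) := by
  rw [evenOp, Finsupp.linearCombination_single, Finsupp.smul_single, smul_eq_mul]

theorem evenOp_mulOdd (φ : A → A) (c : A → ℂ) (o : O) (f : SuperPoly A O) :
    evenOp φ c (mulOdd o f) = mulOdd o (evenOp φ c f) := by
  have : (evenOp φ c : SuperPoly A O →ₗ[ℂ] _) ∘ₗ mulOdd o = mulOdd o ∘ₗ evenOp φ c := by
    refine superPoly_ext fun m => ?_
    by_cases h : o ∈ m.2 <;> simp [mulOdd_single, evenOp_single, h, mul_comm]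
  exact LinearMap.congr_fun this f

theorem evenOp_derOdd (φ : A → A) (c : A → ℂ) (o : O) (f : SuperPoly A O) :
    evenOp φ c (derOdd o f) = derOdd o (evenOp φ c f) := by
  have : (evenOp φ c : SuperPoly A O →ₗ[ℂ] _) ∘ₗ derOdd o = derOdd o ∘ₗ evenOp φ c := by
    refine superPoly_ext fun m => ?_
    by_cases h : o ∈ m.2 <;> simp [derOdd_single, evenOp_single, h, mul_comm]
  exact LinearMap.congr_fun this f

theorem evenOp_comm {φ ψ : A → A} {c e : A → ℂ} (h : ∀ a, c (ψ a) * e a = e (φ a) * c a)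
    (h' : ∀ a, c (ψ a) * e a ≠ 0 → φ (ψ a) = ψ (φ a)) (f : SuperPoly A O) :
    evenOp φ c (evenOp ψ e f) = evenOp ψ e (evenOp φ c f) := by
  have : (evenOp φ c : SuperPoly A O →ₗ[ℂ] _) ∘ₗ evenOp ψ e = evenOp ψ e ∘ₗ evenOp φ c := by
    refine superPoly_ext fun m => ?_
    simp only [LinearMap.comp_apply, evenOp_single, one_mul]
    rw [mul_comm, h, mul_comm (c m.1)]
    by_cases h0 : c (ψ m.1) * e m.1 = 0
    · rw [← h, h0]; simp
    · rw [h' _ h0]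
  exact LinearMap.congr_fun this f

/-! ### Parity -/

variable {p r : ZMod 2} {f g : SuperPoly A O}

theorem HasParity.zero : HasParity p (0 : SuperPoly A O) := fun m hm => by simp at hm

theorem HasParity.add (hf : HasParity p f) (hg : HasParity p g) : HasParity p (f + g) :=
  fun m hm => by
    classical
    rcases Finset.mem_union.1 (Finsupp.support_add hm) with h | h
    · exact hf m h
    · exact hg m h

theorem HasParity.smul (a : ℂ) (hf : HasParity p f) : HasParity p (a • f) :=
  fun m hm => hf m (Finsupp.support_smul hm)

theorem HasParity.single (m : A × Finset O) (a : ℂ) :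
    HasParity (m.2.card : ZMod 2) (Finsupp.single m a : SuperPoly A O) := fun n hn => by
  classical
  have := Finsupp.support_single_subset hn
  rw [Finset.mem_singleton] at this
  rw [this]

theorem HasParity.cast (hf : HasParity p f) (h : p = r) : HasParity r f := h ▸ hf

theorem HasParity.induction {P : SuperPoly A O → Prop} (h0 : P 0)
    (hadd : ∀ f g, P f → P g → P (f + g))
    (hs : ∀ m a, (m.2.card : ZMod 2) = p → P (Finsupp.single m a))
    (hf : HasParity p f) : P f := by
  classical
  rw [← Finsupp.sum_single f]
  unfold Finsupp.sum
  refine Finset.sum_induction _ P (fun a b => hadd a b) h0 fun m hm => hs m _ (hf m hm)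

theorem HasParity.map {T : SuperPoly A O →ₗ[ℂ] SuperPoly A O} (s : ZMod 2)
    (hT : ∀ m, HasParity ((m.2.card : ZMod 2) + s) (T (Finsupp.single m 1)))
    (hf : HasParity p f) : HasParity (p + s) (T f) := by
  refine hf.induction (P := fun f => HasParity (p + s) (T f)) ?_ ?_ ?_
  · rw [map_zero]; exact HasParity.zero
  · intro f g h1 h2
    rw [map_add]; exact h1.add h2
  · rintro m a rfl
    have : (Finsupp.single m a : SuperPoly A O) = a • Finsupp.single m 1 := by simp
    rw [this, map_smul]
    exact (hT m).smul a

theorem HasParity.evenOp (φ : A → A) (c : A → ℂ) (hf : HasParity p f) :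
    HasParity p (evenOp φ c f) := by
  refine (hf.map (T := SuperTraj.evenOp φ c) 0 fun m => ?_).cast (add_zero p)
  rw [evenOp_single, add_zero]
  exact HasParity.single (φ m.1, m.2) _

theorem zmod_two_add_self (a : ZMod 2) : a + a = 0 := by revert a; decide

theorem HasParity.mulOdd (o : O) (hf : HasParity p f) : HasParity (p + 1) (mulOdd o f) := by
  refine hf.map (T := SuperTraj.mulOdd o) 1 fun m => ?_
  rw [mulOdd_single]
  split_ifs with h
  · exact HasParity.zero
  · refine (HasParity.single _ _).cast ?_
    simp [Finset.card_insert_of_notMem h]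

theorem HasParity.derOdd (o : O) (hf : HasParity p f) : HasParity (p + 1) (derOdd o f) := by
  refine hf.map (T := SuperTraj.derOdd o) 1 fun m => ?_
  rw [derOdd_single]
  split_ifs with h
  · refine (HasParity.single _ _).cast ?_
    rw [← Finset.card_erase_add_one h, Nat.cast_add, Nat.cast_one, add_assoc,
      zmod_two_add_self, add_zero]
  · exact HasParity.zero

/-! ### The product -/

variable [Add A]

theorem SuperPoly.mul_add_left (f f' g : SuperPoly A O) :
    (f + f').mul g = f.mul g + f'.mul g := by
  unfold SuperPoly.mul
  refine Finsupp.sum_add_index' (fun m => ?_) fun m a b => ?_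
  · simp
  · rw [← Finsupp.sum_add]
    refine Finsupp.sum_congr fun n _ => ?_
    split_ifs
    · rw [← Finsupp.single_add]; congr 1; ring
    · simp

theorem SuperPoly.mul_add_right (f g g' : SuperPoly A O) :
    f.mul (g + g') = f.mul g + f.mul g' := by
  unfold SuperPoly.mul
  rw [← Finsupp.sum_add]
  refine Finsupp.sum_congr fun n _ => ?_
  refine Finsupp.sum_add_index' (fun m => ?_) fun m a b => ?_
  · simp
  · split_ifs
    · rw [← Finsupp.single_add]; congr 1; ring
    · simp

theorem SuperPoly.zero_mul (g : SuperPoly A O) : SuperPoly.mul 0 g = 0 := by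
  simp [SuperPoly.mul]

theorem SuperPoly.mul_zero (f : SuperPoly A O) : f.mul 0 = 0 := by
  simp [SuperPoly.mul]

theorem SuperPoly.single_mul_single (m n : A × Finset O) (a b : ℂ) :
    SuperPoly.mul (Finsupp.single m a : SuperPoly A O) (Finsupp.single n b) =
      if Disjoint m.2 n.2 then
        Finsupp.single (m.1 + n.1, m.2 ∪ n.2)
          ((-1) ^ ((m.2 ×ˢ n.2).filter fun x => x.2 < x.1).card * (a * b))
      else 0 := by
  unfold SuperPoly.mul
  rw [Finsupp.sum_single_index, Finsupp.sum_single_index]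
  · simp
  · simp

theorem SuperPoly.mul_smul_left (a : ℂ) (f g : SuperPoly A O) :
    SuperPoly.mul (a • f) g = a • f.mul g := by
  induction f using Finsupp.induction_linear with
  | zero => simp [zero_mul]
  | add f f' h1 h2 => rw [smul_add, mul_add_left, mul_add_left, h1, h2, smul_add]
  | single m x =>
    induction g using Finsupp.induction_linear with
    | zero => simp [mul_zero]
    | add g g' h1 h2 => rw [mul_add_right, mul_add_right, h1, h2, smul_add]
    | single n y =>
      rw [Finsupp.smul_single, single_mul_single, single_mul_single]
      split_ifs
      · rw [Finsupp.smul_single, smul_eq_mul, smul_eq_mul]; congr 1; ring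
      · simp

/-- The inversions of {o} ∪ S against T are those of S against T together with the elements of T
below o. The latter are exactly what distinguishes the insertion sign of o in S ∪ T from that in S.
-/
theorem SuperPoly.mulOdd_mul (o : O) (f g : SuperPoly A O) :
    SuperPoly.mul (mulOdd o f) g = mulOdd o (f.mul g) := by
  induction f using Finsupp.induction_linear with
  | zero => simp [zero_mul]
  | add f f' h1 h2 => rw [map_add, mul_add_left, mul_add_left, h1, h2, map_add]
  | single m x =>
    induction g using Finsupp.induction_linear with
    | zero => simp [mul_zero]
    | add g g' h1 h2 => rw [mul_add_right, mul_add_right, h1, h2, map_add]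
    | single n y =>
      rw [mulOdd_single, single_mul_single]
      by_cases h1 : o ∈ m.2
      · rw [if_pos h1, zero_mul]
        split_ifs
        · rw [mulOdd_single, if_pos (Finset.mem_union_left _ h1)]
        · simp
      · rw [if_neg h1, single_mul_single]
        by_cases h2 : Disjoint m.2 n.2
        · by_cases h3 : o ∈ n.2
          · rw [if_neg, if_pos h2, mulOdd_single, if_pos (by simp [h3])]
            simp [h3]
          · rw [if_pos (by simp [h2, h3]), if_pos h2, mulOdd_single, if_neg (by simp [h1, h3])]
            dsimp only
            rw [Finset.insert_union]
            congr 1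
            have e1 : oddSign o (m.2 ∪ n.2) = oddSign o m.2 * oddSign o n.2 := by
              unfold oddSign
              rw [Finset.filter_union, Finset.card_union_of_disjoint
                (Finset.disjoint_filter_filter h2), pow_add]
            have e2 : ((insert o m.2 ×ˢ n.2).filter fun x => x.2 < x.1).card =
                (n.2.filter fun x => x < o).card
                  + ((m.2 ×ˢ n.2).filter fun x => x.2 < x.1).card := by
              have : insert o m.2 ×ˢ n.2 = ({o} ×ˢ n.2) ∪ (m.2 ×ˢ n.2) := by
                rw [← Finset.union_product, Finset.insert_eq]
              rw [this, Finset.filter_union, Finset.card_union_of_disjoint]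
              · congr 1
                rw [Finset.singleton_product, Finset.filter_map, Finset.card_map]
                rfl
              · refine Finset.disjoint_filter_filter ?_
                rw [Finset.disjoint_product]
                exact Or.inl (by simp [h1])
            rw [e1, e2, pow_add]
            unfold oddSign
            ring
        · rw [if_neg h2, map_zero, if_neg]
          simp [h2]

theorem SuperPoly.evenOp_mul {φ : A → A} (hφ : ∀ a b, φ (a + b) = φ a + b)
    (f g : SuperPoly A O) :
    SuperPoly.mul (evenOp φ (fun _ => 1) f) g = evenOp φ (fun _ => 1) (f.mul g) := by
  induction f using Finsupp.induction_linear with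
  | zero => simp [zero_mul]
  | add f f' h1 h2 => rw [map_add, mul_add_left, mul_add_left, h1, h2, map_add]
  | single m x =>
    induction g using Finsupp.induction_linear with
    | zero => simp [mul_zero]
    | add g g' h1 h2 => rw [mul_add_right, mul_add_right, h1, h2, map_add]
    | single n y =>
      rw [evenOp_single, single_mul_single, single_mul_single]
      split_ifs
      · rw [evenOp_single, hφ, mul_one, mul_one]
      · simp

end SuperPoly

end SuperTraj

namespace SuperTraj

/-! ### Functions on super space-time -/

namespace STFun

variable {N M : ℕ}

/-- Left multiplication by the coordinate `x^i`. -/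
def mulX : SIdx N M → (STFun N M →ₗ[ℂ] STFun N M)
  | Sum.inl i => evenOp (fun a => (a.1, a.2 + Finsupp.single i 1)) fun _ => 1
  | Sum.inr j => mulOdd j

/-- Multiplication by `e^{ikt}`. -/
def shift (k : ℤ) : STFun N M →ₗ[ℂ] STFun N M :=
  evenOp (fun a => (a.1 + k, a.2)) fun _ => 1

/-- The function `e^{ikt}`. -/
def expo (k : ℤ) : STFun N M := Finsupp.single ((k, 0), ∅) 1

theorem pd_none_eq : (pd none : STFun N M →ₗ[ℂ] _) =
    evenOp id fun a => Complex.I * (a.1 : ℂ) := rfl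

theorem pd_inl_eq (i : Fin N) : (pd (some (Sum.inl i)) : STFun N M →ₗ[ℂ] _) =
    evenOp (fun a : ℤ × (Fin N →₀ ℕ) => (a.1, a.2 - Finsupp.single i 1))
      fun a => ((a.2 i : ℕ) : ℂ) := rfl

theorem mulX_inl (i : Fin N) : (mulX (Sum.inl i) : STFun N M →ₗ[ℂ] _) =
    evenOp (fun a => (a.1, a.2 + Finsupp.single i 1)) fun _ => 1 := rfl

theorem mulX_inr (j : Fin M) : (mulX (Sum.inr j) : STFun N M →ₗ[ℂ] _) = mulOdd j := rfl

theorem pd_inr_eq (j : Fin M) : (pd (some (Sum.inr j)) : STFun N M →ₗ[ℂ] _) = derOdd j := rfl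

theorem pd_none_mulX (i : SIdx N M) (f : STFun N M) :
    pd none (mulX i f) = mulX i (pd none f) := by
  rcases i with i | j
  · rw [pd_none_eq, mulX_inl]
    rw [evenOp_comm]
    · intro a; simp
    · intro a _; rfl
  · rw [pd_none_eq, mulX_inr]
    exact evenOp_mulOdd _ _ _ f

/-- Subtraction of exponents is truncated at 0, so for i = j the exchange needs a positive exponent.
In the applications an exponent 0 comes with the coefficient 0 of a derivative. -/
theorem sub_single_add {σ : Type*} [DecidableEq σ] (a : σ →₀ ℕ) (i j : σ)
    (h : i ≠ j ∨ a i ≠ 0) :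
    a - Finsupp.single i 1 + Finsupp.single j 1 = a + Finsupp.single j 1 - Finsupp.single i 1 := by
  ext k
  simp only [Finsupp.coe_add, Finsupp.coe_tsub, Pi.add_apply, Pi.sub_apply,
    Finsupp.single_apply]
  split_ifs with h1 h2 h2
  · subst h1; subst h2
    rcases h with h | h
    · exact absurd rfl h
    · omega
  · omega
  · omega
  · omega

/-- The Heisenberg relations between coordinates and derivatives. With the action on exponentials
they determine the derivatives, so the later inductions use these relations instead of the formulas
on ordered monomials. -/
theorem pd_some_mulX (j i : SIdx N M) (f : STFun N M) :
    pd (some j) (mulX i f) =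
      (if i = j then f else 0) + sgn (sdeg j * sdeg i) • mulX i (pd (some j) f) := by
  rcases j with j | j <;> rcases i with i | i
  · have : (pd (some (Sum.inl j)) : STFun N M →ₗ[ℂ] _) ∘ₗ mulX (Sum.inl i) =
        (if i = j then LinearMap.id else 0) + mulX (Sum.inl i) ∘ₗ pd (some (Sum.inl j)) := by
      refine superPoly_ext fun m => ?_
      simp only [LinearMap.comp_apply, LinearMap.add_apply, pd_inl_eq, mulX, evenOp_single,
        Finsupp.coe_add, Pi.add_apply, one_mul, mul_one]
      by_cases h : i = j
      · subst h
        simp only [add_tsub_cancel_right, Finsupp.single_eq_same, if_true, LinearMap.id_apply]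
        by_cases h0 : m.1.2 i = 0
        · simp [h0]
        · rw [sub_single_add _ _ _ (Or.inr h0), add_tsub_cancel_right, ← Finsupp.single_add]
          push_cast
          rw [add_comm]
      · rw [if_neg h, sub_single_add _ _ _ (Or.inl (Ne.symm h)),
          Finsupp.single_eq_of_ne (Ne.symm h)]
        simp
    have h2 := LinearMap.congr_fun this f
    simp only [LinearMap.comp_apply, LinearMap.add_apply] at h2
    rw [h2]
    simp only [sdeg, mul_zero, sgn_zero, one_smul, Sum.inl.injEq]
    split_ifs <;> rfl
  · simp only [sdeg, zero_mul, sgn_zero, one_smul, reduceCtorEq, if_false, zero_add, pd_inl_eq, mulX_inr]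
    exact evenOp_mulOdd _ _ _ f
  · simp only [sdeg, mul_zero, sgn_zero, one_smul, reduceCtorEq, if_false, zero_add, pd_inr_eq, mulX_inl]
    exact (evenOp_derOdd _ _ _ f).symm
  · simp only [mulX, pd_inr_eq, derOdd_mulOdd, sdeg, Sum.inr.injEq]
    simp [sgn, sub_eq_add_neg]

@[simp] theorem pd_some_expo (j : SIdx N M) (k : ℤ) : pd (some j) (expo k : STFun N M) = 0 := by
  rcases j with j | j
  · simp [pd_inl_eq, expo, evenOp_single]
  · simp [pd_inr_eq, expo, derOdd_single]

@[simp] theorem pd_none_expo (k : ℤ) :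
    pd none (expo k : STFun N M) = (Complex.I * k) • expo k := by
  simp [pd_none_eq, expo, evenOp_single]

theorem _root_.SuperTraj.HasParity.mulX {p : ZMod 2} {f : STFun N M} (i : SIdx N M) (hf : HasParity p f) :
    HasParity (p + sdeg i) (mulX i f) := by
  rcases i with i | j
  · rw [mulX_inl]
    exact (hf.evenOp _ _).cast (by simp [sdeg])
  · rw [mulX_inr]
    exact hf.mulOdd j

theorem hasParity_expo (k : ℤ) : HasParity 0 (expo k : STFun N M) :=
  (HasParity.single _ _).cast (by simp)

theorem _root_.SuperTraj.HasParity.pd {p : ZMod 2} {f : STFun N M} (μ : Idx N M) (hf : HasParity p f) :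
    HasParity (p + deg μ) (pd μ f) := by
  rcases μ with _ | i | j
  · rw [pd_none_eq]
    exact (hf.evenOp _ _).cast (by simp [deg])
  · rw [pd_inl_eq]
    exact (hf.evenOp _ _).cast (by simp [deg, sdeg])
  · rw [pd_inr_eq]
    exact hf.derOdd j

/-- Homogeneous functions are built from exponentials by multiplication by coordinates. -/
theorem hom_induction {P : ZMod 2 → STFun N M → Prop} (h0 : ∀ p, P p 0)
    (hadd : ∀ p f g, P p f → P p g → P p (f + g)) (hsmul : ∀ p (a : ℂ) f, P p f → P p (a • f))
    (hexp : ∀ k, P 0 (expo k))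
    (hX : ∀ i p f, HasParity p f → P p f → P (p + sdeg i) (mulX i f))
    {p : ZMod 2} {f : STFun N M} (hf : HasParity p f) : P p f := by
  have key : ∀ (k : ℤ) (S : Finset (Fin M)) (a : Fin N →₀ ℕ),
      P (S.card : ZMod 2) (Finsupp.single ((k, a), S) 1) := by
    intro k S a
    induction a using Finsupp.induction with
    | zero =>
      -- Each new odd variable is smaller than the previous ones, so left multiplication by it
      -- yields the ordered monomial without a sign.
      induction S using Finset.induction_on_min with
      | empty => simpa [expo] using hexp k
      | insert j S hj ih =>
        have hjS : j ∉ S := fun h => lt_irrefl j (hj j h)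
        have h1 := hX (Sum.inr j) _ _ (HasParity.single ((k, 0), S) (1 : ℂ)) ih
        have h2 : mulX (Sum.inr j) (Finsupp.single ((k, 0), S) 1 : STFun N M) =
            Finsupp.single ((k, 0), insert j S) 1 := by
          simp only [mulX, mulOdd_single]
          rw [if_neg hjS]
          have : S.filter (fun x => x < j) = ∅ :=
            Finset.filter_eq_empty_iff.2 fun x hx => not_lt.2 (hj x hx).le
          simp [oddSign, this]
        rw [h2] at h1
        rw [Finset.card_insert_of_notMem hjS]
        simpa [sdeg] using h1
    | single_add i n a _ _ ih =>
      clear * - ih hX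
      induction n with
      | zero => simpa using ih
      | succ n ih2 =>
        have h1 := hX (Sum.inl i) _ _
          (HasParity.single ((k, Finsupp.single i n + a), S) (1 : ℂ)) ih2
        simp only [mulX, evenOp_single, sdeg, add_zero, mul_one] at h1
        convert h1 using 4
        rw [add_right_comm, ← Finsupp.single_add]
  refine hf.induction (P := P p) (h0 p) (hadd p) ?_
  rintro ⟨⟨k, a⟩, S⟩ x rfl
  have : (Finsupp.single ((k, a), S) x : STFun N M) = x • Finsupp.single ((k, a), S) 1 := by simp
  rw [this]
  exact hsmul _ _ _ (key k S a)

/-- Functions are built from exponentials by multiplication by coordinates. -/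
theorem induction {P : STFun N M → Prop} (h0 : P 0)
    (hadd : ∀ f g, P f → P g → P (f + g)) (hsmul : ∀ (a : ℂ) f, P f → P (a • f))
    (hexp : ∀ k, P (expo k)) (hX : ∀ i f, P f → P (mulX i f)) (f : STFun N M) : P f := by
  induction f using Finsupp.induction_linear with
  | zero => exact h0
  | add f g h1 h2 => exact hadd f g h1 h2
  | single m a =>
    exact hom_induction (P := fun _ f => P f) (fun _ => h0) (fun _ => hadd) (fun _ => hsmul)
      hexp (fun i _ f _ => hX i f) (HasParity.single m a)

theorem shift_mulX (k : ℤ) (i : SIdx N M) (f : STFun N M) :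
    shift k (mulX i f) = mulX i (shift k f) := by
  rcases i with i | j
  · rw [shift, mulX_inl]
    rw [evenOp_comm]
    · intro a; rfl
    · intro a _; rfl
  · rw [shift, mulX_inr]
    exact evenOp_mulOdd _ _ _ f

theorem pd_pd (μ ν : Idx N M) (f : STFun N M) :
    pd μ (pd ν f) = sgn (deg μ * deg ν) • pd ν (pd μ f) := by
  have aux : ∀ (μ : Idx N M) (i : SIdx N M) (f : STFun N M), pd μ (mulX i f) =
      (if some i = μ then f else 0) + sgn (deg μ * sdeg i) • mulX i (pd μ f) := by
    intro μ i f
    rcases μ with _ | j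
    · simp [pd_none_mulX, deg]
    · simp [pd_some_mulX, deg]
  induction f using STFun.induction with
  | h0 => simp
  | hadd f g h1 h2 => simp [h1, h2]
  | hsmul a f h => simp only [map_smul, h]; rw [smul_comm]
  | hexp k =>
    rcases μ with _ | i <;> rcases ν with _ | j <;> simp [deg]
  | hX i f ih =>
    simp only [aux, map_add, map_smul, ih, smul_add, smul_smul]
    have e : ∀ a b c : ℂ, c * (b * a) = a * (b * c) := fun a b c => by ring
    rw [e (sgn (deg μ * deg ν)), apply_ite (pd μ), apply_ite (pd ν), map_zero, map_zero]
    rw [add_left_comm]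
    have e2 : sgn (deg ν * sdeg i) • (if some i = μ then pd ν f else 0) =
        sgn (deg μ * deg ν) • (if some i = μ then pd ν f else 0) := by
      split_ifs with h
      · subst h; rw [mul_comm]; rfl
      · simp
    have e3 : (if some i = ν then pd μ f else 0) =
        (sgn (deg μ * deg ν) * sgn (deg μ * sdeg i)) • (if some i = ν then pd μ f else 0) := by
      split_ifs with h
      · subst h; simp [deg]
      · simp
    rw [e2]
    nth_rewrite 1 [e3]
    rfl

theorem mulX_mul (i : SIdx N M) (f g : STFun N M) :
    SuperPoly.mul (mulX i f) g = mulX i (f.mul g) := by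
  rcases i with i | j
  · rw [mulX_inl]
    exact SuperPoly.evenOp_mul (fun a b => by ext <;> simp [add_right_comm]) f g
  · rw [mulX_inr]
    exact SuperPoly.mulOdd_mul j f g

theorem expo_mul (k : ℤ) (g : STFun N M) : SuperPoly.mul (expo k) g = shift k g := by
  induction g using Finsupp.induction_linear with
  | zero => simp [SuperPoly.mul_zero]
  | add f g h1 h2 => rw [SuperPoly.mul_add_right, h1, h2, map_add]
  | single m a =>
    rw [expo, SuperPoly.single_mul_single, if_pos (Finset.disjoint_empty_left _), shift,
      evenOp_single]
    have : ((k, 0) + m.1 : ℤ × (Fin N →₀ ℕ)) = (m.1.1 + k, m.1.2) := by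
      ext <;> simp [add_comm]
    simp [this]

theorem shift_expo (k l : ℤ) : shift k (expo l : STFun N M) = expo (l + k) := by
  simp [shift, expo, evenOp_single]

theorem pd_some_shift (j : SIdx N M) (k : ℤ) (f : STFun N M) :
    pd (some j) (shift k f) = shift k (pd (some j) f) := by
  rcases j with i | j
  · rw [pd_inl_eq, shift]
    rw [evenOp_comm]
    · intro a; simp
    · intro a _; rfl
  · rw [pd_inr_eq, shift]
    exact (evenOp_derOdd _ _ _ f).symm

theorem pd_none_shift (k : ℤ) (f : STFun N M) :
    pd none (shift k f) = (Complex.I * k) • shift k f + shift k (pd none f) := by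
  induction f using Finsupp.induction_linear with
  | zero => simp
  | add f g h1 h2 => simp only [map_add, smul_add, h1, h2]; abel
  | single m a =>
    simp only [shift, pd_none_eq, evenOp_single, Finsupp.smul_single, ← Finsupp.single_add, id]
    congr 1
    push_cast
    simp only [smul_eq_mul]
    ring

/-- The Leibniz rule. -/
theorem pd_mul {p : ZMod 2} {f : STFun N M} (hf : HasParity p f) (ν : Idx N M)
    (g : STFun N M) :
    pd ν (f.mul g) = (pd ν f).mul g + sgn (deg ν * p) • f.mul (pd ν g) := by
  refine hom_induction (P := fun p f => pd ν (SuperPoly.mul f g) =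
    SuperPoly.mul (pd ν f) g + sgn (deg ν * p) • SuperPoly.mul f (pd ν g)) ?_ ?_ ?_ ?_ ?_ hf
  · intro p; simp [SuperPoly.zero_mul]
  · intro p f f' h1 h2
    simp only [map_add, SuperPoly.mul_add_left, h1, h2, smul_add]; abel
  · intro p a f h
    simp only [map_smul, SuperPoly.mul_smul_left, h, smul_add]
    rw [smul_comm]
  · intro k
    rcases ν with _ | j
    · simp only [expo_mul, pd_none_shift, pd_none_expo, SuperPoly.mul_smul_left, mul_zero,
        sgn_zero, one_smul]
    · simp only [expo_mul, pd_some_shift, pd_some_expo, SuperPoly.zero_mul, mul_zero,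
        sgn_zero, one_smul, zero_add]
  · intro i p f _ h
    rcases ν with _ | j
    · simp only [deg, zero_mul, sgn_zero, one_smul] at h ⊢
      simp only [mulX_mul, pd_none_mulX, h, map_add]
    · simp only [mulX_mul, pd_some_mulX, h, map_add, map_smul, SuperPoly.mul_add_left,
        SuperPoly.mul_smul_left, smul_add, smul_smul, deg, mul_add, sgn_add]
      rw [mul_comm (sgn (sdeg j * sdeg i)) (sgn (sdeg j * p)), ← add_assoc]
      split_ifs
      · rfl
      · rw [SuperPoly.zero_mul]

end STFun

end SuperTraj

namespace SuperTraj

namespace TrajOps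

variable {N M : ℕ} {W : Type*} [AddCommGroup W] [Module ℂ W] {R : TrajOps N M W}
  {p r s : ZMod 2} {c k₁ k₂ : ℂ}

namespace QRing

/-! ### Evaluation of functions on the trajectory -/

/-- The trajectory `q^i`, as an element of the ring. -/
def qv (hR : R.IsRep c k₁ k₂) (i : SIdx N M) : QRing hR := ⟨R.q i, (QFun.traj i).mem_qspan⟩

/-- The function `e^{ikt}`, as an element of the ring. -/
def E (hR : R.IsRep c k₁ k₂) (k : ℤ) : QRing hR := ⟨fexp k, (QFun.exp k).mem_qspan⟩

variable {hR : R.IsRep c k₁ k₂}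

@[simp] theorem fld_qv (i : SIdx N M) : (qv hR i).fld = R.q i := rfl
@[simp] theorem fld_E (k : ℤ) : (E hR k).fld = fexp k := rfl

theorem E_zero : E hR 0 = 1 := rfl

theorem hom_qv (i : SIdx N M) : Hom (sdeg i) (qv hR i) := QFun.traj i
theorem hom_E (k : ℤ) : Hom 0 (E hR k) := QFun.exp k

theorem Hom.comm_of_even {A B : QRing hR} (hA : Hom 0 A) (hB : Hom r B) : A * B = B * A := by
  simpa using hA.comm hB

theorem fld_E_mul (k : ℤ) (A : QRing hR) (n : ℤ) : (E hR k * A).fld n = A.fld (n + k) := by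
  rw [fld_mul, fld_E, fmul_fexp]

theorem d_E (k : ℤ) : d hR (E hR k) = (Complex.I * k) • E hR k := ext <| funext fun n => by
  simp only [fld_d, fdt, fld_smul, Pi.smul_apply, fld_E, fexp]
  split_ifs with h
  · subst h; push_cast; congr 1; ring
  · simp

theorem qv_comm (i j : SIdx N M) :
    qv hR i * qv hR j = sgn (sdeg i * sdeg j) • (qv hR j * qv hR i) := (hom_qv i).comm (hom_qv j)

/-- The product of the fields of a word. -/
def wordProd (hR : R.IsRep c k₁ k₂) (l : List (SIdx N M)) : QRing hR := (l.map (qv hR)).prod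

theorem hom_wordProd (l : List (SIdx N M)) : ∃ p, Hom p (wordProd hR l) := by
  induction l with
  | nil => exact ⟨0, Hom.one⟩
  | cons i l ih =>
    obtain ⟨p, hp⟩ := ih
    exact ⟨sdeg i + p, by simpa [wordProd] using (hom_qv i).mul hp⟩

theorem fld_wordProd (l : List (SIdx N M)) : (wordProd hR l).fld = R.evWord l := by
  induction l with
  | nil => rfl
  | cons i l ih =>
    have : R.evWord (i :: l) = fmul (R.q i) (R.evWord l) := rfl
    rw [this, ← ih]; simp [wordProd]

/-- The value `f(q(t))` of a function on the trajectory. -/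
def ev (hR : R.IsRep c k₁ k₂) : STFun N M →ₗ[ℂ] QRing hR :=
  Finsupp.linearCombination ℂ fun m : (ℤ × (Fin N →₀ ℕ)) × Finset (Fin M) =>
    E hR m.1.1 * wordProd hR (word m.1.2 m.2)

theorem ev_single (m : (ℤ × (Fin N →₀ ℕ)) × Finset (Fin M)) (a : ℂ) :
    ev hR (Finsupp.single m a) = a • (E hR m.1.1 * wordProd hR (word m.1.2 m.2)) :=
  Finsupp.linearCombination_single ℂ a m

theorem fld_ev (f : STFun N M) : (ev hR f).fld = R.ev f := by
  have : (ev hR f).fld = fldL hR (ev hR f) := rfl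
  rw [this, ev, Finsupp.linearCombination_apply, Finsupp.sum, map_sum]
  refine Finset.sum_congr rfl fun m _ => ?_
  rw [map_smul]
  congr 1
  exact funext fun n => (fld_E_mul _ _ _).trans (by rw [fld_wordProd])

/-- The product of the commuting factors of a word. -/
def evenProd (hR : R.IsRep c k₁ k₂) (a : Fin N →₀ ℕ) (l : List (Fin N)) : QRing hR :=
  (l.map fun i => qv hR (Sum.inl i) ^ a i).prod

/-- The product of the anticommuting factors of a word. -/
def oddProd (hR : R.IsRep c k₁ k₂) (S : Finset (Fin M)) : QRing hR :=
  ((S.sort (· ≤ ·)).map fun j => qv hR (Sum.inr j)).prod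

theorem wordProd_word (a : Fin N →₀ ℕ) (S : Finset (Fin M)) :
    wordProd hR (word a S) = evenProd hR a (List.finRange N) * oddProd hR S := by
  rw [wordProd, word, List.map_append, List.prod_append, evenProd, oddProd, List.map_map]
  congr 1
  generalize List.finRange N = l
  induction l with
  | nil => rfl
  | cons i l ih => simp [List.flatMap_cons, ih]

theorem qv_inl_comm (i : Fin N) {A : QRing hR} (hA : Hom p A) :
    qv hR (Sum.inl i) * A = A * qv hR (Sum.inl i) := (hom_qv (Sum.inl i)).comm_of_even hA

theorem hom_evenProd (a : Fin N →₀ ℕ) (l : List (Fin N)) : Hom 0 (evenProd hR a l) := by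
  induction l with
  | nil => exact Hom.one
  | cons i l ih =>
    have h : Hom 0 (qv hR (Sum.inl i) ^ a i) := by
      generalize a i = n
      induction n with
      | zero => simpa using Hom.one
      | succ n ih =>
        rw [pow_succ]
        exact (ih.mul (hom_qv (Sum.inl i))).cast (by simp [sdeg])
    have := h.mul ih
    rw [add_zero] at this
    simpa [evenProd] using this

theorem evenProd_add_single (a : Fin N →₀ ℕ) (i : Fin N) (l : List (Fin N)) (hl : l.Nodup) :
    evenProd hR (a + Finsupp.single i 1) l =
      if i ∈ l then qv hR (Sum.inl i) * evenProd hR a l else evenProd hR a l := by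
  induction l with
  | nil => simp [evenProd]
  | cons j l ih =>
    have hcons : ∀ b : Fin N →₀ ℕ,
        evenProd hR b (j :: l) = qv hR (Sum.inl j) ^ b j * evenProd hR b l := fun b => by
      simp [evenProd]
    rw [List.nodup_cons] at hl
    rw [hcons, hcons, ih hl.2]
    by_cases h : i = j
    · subst h
      rw [if_neg hl.1, if_pos (by simp), Finsupp.add_apply, Finsupp.single_eq_same, pow_succ',
        mul_assoc]
    · have hj : (a + Finsupp.single i 1 : Fin N →₀ ℕ) j = a j := by simp [h]
      rw [hj]
      by_cases h2 : i ∈ l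
      · rw [if_pos h2, if_pos (by simp [h2]), ← mul_assoc, ← mul_assoc]
        congr 1
        exact ((show Commute (qv hR (Sum.inl i)) (qv hR (Sum.inl j)) from
          qv_inl_comm i (hom_qv _)).pow_right _).eq.symm
      · rw [if_neg h2, if_neg (by simp [h2, h])]

theorem oddProd_insert_min {j : Fin M} {S : Finset (Fin M)} (h : ∀ x ∈ S, j < x) :
    oddProd hR (insert j S) = qv hR (Sum.inr j) * oddProd hR S := by
  unfold oddProd
  rw [Finset.sort_insert _ (fun b hb => (h b hb).le) (fun hj => lt_irrefl j (h j hj))]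
  simp

theorem qv_inr_mul_self (j : Fin M) : qv hR (Sum.inr j) * qv hR (Sum.inr j) = 0 := by
  have h := qv_comm (hR := hR) (Sum.inr j) (Sum.inr j)
  simp only [sdeg, mul_one, sgn, one_ne_zero, if_false, neg_smul, one_smul] at h
  have h2 : (2 : ℂ) • (qv hR (Sum.inr j) * qv hR (Sum.inr j)) = 0 := by
    rw [two_smul]; nth_rewrite 1 [h]; simp
  simpa using h2

/-- The fields q^j obey the same sorting rule as the symbols θ_j in `mulOdd`: moving q^j to its
place costs one sign per smaller factor, and a repeated factor gives 0 because odd fields square to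
zero. -/
theorem qv_inr_mul_oddProd (j : Fin M) (S : Finset (Fin M)) :
    qv hR (Sum.inr j) * oddProd hR S =
      if j ∈ S then 0 else oddSign j S • oddProd hR (insert j S) := by
  induction S using Finset.induction_on_min with
  | empty =>
    rw [oddProd_insert_min (by simp)]; simp [oddSign]
  | insert k S hk ih =>
    have hkS : k ∉ S := fun h => lt_irrefl k (hk k h)
    rcases lt_trichotomy j k with h | h | h
    · have hS : ∀ x ∈ insert k S, j < x := fun x hx => by
        rcases Finset.mem_insert.1 hx with rfl | hx
        · exact h
        · exact h.trans (hk x hx)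
      rw [if_neg (fun hj => lt_irrefl j (hS j hj)), oddProd_insert_min hS]
      have : (insert k S).filter (fun x => x < j) = ∅ :=
        Finset.filter_eq_empty_iff.2 fun x hx => not_lt.2 (hS x hx).le
      simp [oddSign, this]
    · subst h
      rw [if_pos (Finset.mem_insert_self _ _), oddProd_insert_min hk, ← mul_assoc,
        qv_inr_mul_self, zero_mul]
    · rw [oddProd_insert_min hk, ← mul_assoc, qv_comm, smul_mul_assoc, mul_assoc, ih]
      by_cases hj : j ∈ S
      · simp [hj]
      · have hS : ∀ x ∈ insert j S, k < x := fun x hx => by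
          rcases Finset.mem_insert.1 hx with rfl | hx
          · exact h
          · exact hk x hx
        rw [if_neg hj, if_neg (by simp [hj, h.ne']), Finset.insert_comm, oddProd_insert_min hS,
          oddSign_insert j hkS, if_pos h, mul_smul_comm, smul_smul]
        simp [sdeg, sgn]

/-- Evaluation turns multiplication by x^i into multiplication by q^i(t). Together with the value on
exponentials this characterizes `ev`, so that ordered words are no longer needed: homomorphism
property, parity and chain rule follow by induction on functions. -/
theorem ev_mulX (i : SIdx N M) (f : STFun N M) :
    ev hR (STFun.mulX i f) = qv hR i * ev hR f := by
  have : ev hR ∘ₗ STFun.mulX i = LinearMap.mulLeft ℂ (qv hR i) ∘ₗ ev hR := by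
    refine superPoly_ext fun m => ?_
    simp only [LinearMap.comp_apply, LinearMap.mulLeft_apply]
    rcases i with i | j
    · rw [STFun.mulX_inl, evenOp_single, ev_single, ev_single, wordProd_word, wordProd_word,
        evenProd_add_single _ _ _ (List.nodup_finRange N), if_pos (List.mem_finRange i), mul_one,
        one_smul, one_smul, ← mul_assoc, ← mul_assoc, ← mul_assoc, ← mul_assoc,
        (hom_E _).comm_of_even (hom_qv _)]
    · rw [STFun.mulX_inr, mulOdd_single, ev_single, wordProd_word, one_smul, ← mul_assoc,
        ← (hom_E _).comm_of_even (hom_qv _), mul_assoc, ← mul_assoc (qv hR _) (evenProd hR _ _),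
        ← (hom_evenProd _ _).comm_of_even (hom_qv _), mul_assoc, qv_inr_mul_oddProd]
      split_ifs with h
      · simp
      · simp only [ev_single, wordProd_word, one_mul, mul_smul_comm]
  exact LinearMap.congr_fun this f

theorem ev_expo (k : ℤ) : ev hR (STFun.expo k) = E hR k := by
  rw [STFun.expo, ev_single, wordProd_word, one_smul]
  have h1 : evenProd hR 0 (List.finRange N) = 1 := by simp [evenProd]
  have h2 : oddProd hR (∅ : Finset (Fin M)) = 1 := by simp [oddProd]
  simp [h1, h2]

theorem hom_ev {f : STFun N M} (hf : HasParity p f) : Hom p (ev hR f) := by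
  refine STFun.hom_induction (P := fun p f => Hom p (ev hR f)) ?_ ?_ ?_ ?_ ?_ hf
  · intro p; simpa using Hom.zero
  · intro p f g h1 h2; rw [map_add]; exact h1.add h2
  · intro p a f h; rw [map_smul]; exact h.smul a
  · intro k; rw [ev_expo]; exact hom_E k
  · intro i p f _ h; rw [ev_mulX, add_comm]; exact (hom_qv i).mul h

theorem ev_shift (k : ℤ) (f : STFun N M) : ev hR (STFun.shift k f) = E hR k * ev hR f := by
  have hE : ∀ l, E hR (l + k) = E hR k * E hR l := fun l => ext <| funext fun n => by
    rw [fld_E_mul]; simp only [fld_E, fexp]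
    congr 1
    exact propext ⟨fun h => by omega, fun h => by omega⟩
  induction f using STFun.induction with
  | h0 => simp
  | hadd f g h1 h2 => simp [h1, h2, mul_add]
  | hsmul a f h => simp [h]
  | hexp l => rw [STFun.shift_expo, ev_expo, ev_expo, hE]
  | hX i f ih =>
    rw [STFun.shift_mulX, ev_mulX, ev_mulX, ih, ← mul_assoc, ← mul_assoc,
      (hom_E k).comm_of_even (hom_qv i)]

theorem ev_mul (f g : STFun N M) : ev hR (f.mul g) = ev hR f * ev hR g := by
  induction f using STFun.induction with
  | h0 => simp [SuperPoly.zero_mul]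
  | hadd f f' h1 h2 => rw [SuperPoly.mul_add_left, map_add, h1, h2, map_add, add_mul]
  | hsmul a f h => rw [SuperPoly.mul_smul_left, map_smul, h, map_smul, smul_mul_assoc]
  | hexp k => rw [STFun.expo_mul, ev_shift, ev_expo]
  | hX i f ih => rw [STFun.mulX_mul, ev_mulX, ih, ev_mulX, mul_assoc]

/-- The velocity, as an element of the ring. -/
def qd (hR : R.IsRep c k₁ k₂) : Idx N M → QRing hR
  | none => 1
  | some i => d hR (qv hR i)

theorem fld_qd (ρ : Idx N M) : (qd hR ρ).fld = R.qdot ρ := by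
  cases ρ <;> rfl

theorem hom_qd (ρ : Idx N M) : Hom (deg ρ) (qd hR ρ) := by
  cases ρ with
  | none => exact Hom.one
  | some i => exact (hom_qv i).d

/-- The chain rule. -/
theorem d_ev (f : STFun N M) : d hR (ev hR f) = ∑ ρ, qd hR ρ * ev hR (pd ρ f) := by
  simp only [Fintype.sum_option, qd, one_mul]
  induction f using STFun.induction with
  | h0 => simp
  | hadd f g h1 h2 =>
    simp only [map_add, h1, h2, mul_add, Finset.sum_add_distrib]; abel
  | hsmul a f h =>
    simp only [map_smul, h, mul_smul_comm, ← Finset.smul_sum, smul_add]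
  | hexp k => simp [ev_expo, d_E]
  | hX i f ih =>
    simp only [ev_mulX, d_mul, ih, STFun.pd_none_mulX, STFun.pd_some_mulX, map_add, mul_add,
      Finset.sum_add_distrib, map_smul, mul_smul_comm]
    rw [add_left_comm]
    congr 1
    congr 1
    · rw [Finset.sum_eq_single i]
      · simp
      · intro j _ hj; simp [Ne.symm hj]
      · simp
    · rw [Finset.mul_sum]
      refine Finset.sum_congr rfl fun j _ => ?_
      rw [← mul_assoc, ← mul_assoc, (hom_qv i).comm (hom_qv j).d, smul_mul_assoc,
        mul_comm (sdeg i)]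

theorem evDot_eq (f : STFun N M) : R.evDot f = (d hR (ev hR f)).fld := by
  rw [d_ev, fld_sum, evDot]
  refine Finset.sum_congr rfl fun ρ _ => ?_
  rw [fld_mul, fld_qd, fld_ev]

/-- The functional `q̇^ρ ∂_ρ ḟ`. -/
def ev2 (hR : R.IsRep c k₁ k₂) (f : STFun N M) : QRing hR := ∑ ρ, qd hR ρ * d hR (ev hR (pd ρ f))

/-- The sign in `evDot2` converts ∂_ρ∂_σ f into ∂_σ∂_ρ f. The inner sum is then, by the chain rule,
the time derivative of (∂_ρ f)(q(t)). -/
theorem evDot2_eq (f : STFun N M) : R.evDot2 f = (ev2 hR f).fld := by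
  rw [ev2, fld_sum, evDot2]
  refine Finset.sum_congr rfl fun ρ _ => ?_
  rw [fld_mul, fld_qd, d_ev, fld_sum]
  congr 1
  refine Finset.sum_congr rfl fun σ _ => ?_
  rw [fld_mul, fld_qd, fld_ev, STFun.pd_pd ρ σ]
  have h : sgn (deg ρ * deg σ) • (R.ev (sgn (deg ρ * deg σ) • pd σ (pd ρ f)) : Fld W) =
      R.ev (pd σ (pd ρ f)) := by
    rw [← fld_ev (hR := hR), ← fld_ev (hR := hR), map_smul, fld_smul, smul_smul, sgn_mul_self,
      one_smul]
  rw [← fmul_smul_right, h]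
  rw [← fld_ev (hR := hR), ← fld_qd (hR := hR)]
  exact ok _ _

/-! ### Operators acting on functionals by derivations -/

section Deriv

variable {X : Module.End ℂ W}

theorem sbr_fld_mul {A B A' B' : QRing hR} (hA : ∀ n, sbr (s * p) X (A.fld n) = A'.fld n)
    (hB : ∀ n, sbr (s * r) X (B.fld n) = B'.fld n) (n : ℤ) :
    sbr (s * (p + r)) X ((A * B).fld n) = (A' * B + sgn (s * p) • (A * B')).fld n := by
  refine ((hasLS_mul A B n).sbr_right _ X).unique
    (((hasLS_mul A' B n).add ((hasLS_mul A B' n).smul (sgn (s * p)))).congr fun b => ?_)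
  rw [mul_add, sbr_mul_right, hA, hB]

theorem sbr_fld_d {A A' : QRing hR} (hA : ∀ n, sbr (s * p) X (A.fld n) = A'.fld n) (n : ℤ) :
    sbr (s * p) X ((d hR A).fld n) = (d hR A').fld n := by
  simp only [fld_d, fdt]
  rw [sbr_smul_right, hA]

/-- Bracketing with X is a graded derivation, so its effect on f(q) is determined by its effect on
the coordinates. This is applied both to the modes of the momentum and to the whole part of a
generator that is linear in p. -/
theorem sbr_fld_ev {Y : SIdx N M → QRing hR}
    (hX : ∀ i n, sbr (s * sdeg i) X (R.q i n) = (Y i).fld n)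
    (hY : ∀ i, Hom (s + sdeg i) (Y i)) {f : STFun N M} (hf : HasParity p f) (n : ℤ) :
    sbr (s * p) X ((ev hR f).fld n) = (∑ i, Y i * ev hR (pd (some i) f)).fld n := by
  revert n
  refine STFun.hom_induction (P := fun p f => ∀ n, sbr (s * p) X ((ev hR f).fld n) =
    (∑ i, Y i * ev hR (pd (some i) f)).fld n) ?_ ?_ ?_ ?_ ?_ hf
  · intro p n; simp
  · intro p f g h1 h2 n
    simp only [map_add, fld_add, Pi.add_apply, sbr_add_right, h1, h2, mul_add,
      Finset.sum_add_distrib]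
  · intro p a f h n
    simp only [map_smul, fld_smul, Pi.smul_apply, sbr_smul_right, h, mul_smul_comm,
      ← Finset.smul_sum]
  · intro k n
    rw [ev_expo, fld_E, fexp]
    split_ifs <;> simp [sbr_def]
  · intro i p f _ h n
    rw [ev_mulX, add_comm p, sbr_fld_mul (hX i) h]
    congr 1
    simp only [STFun.pd_some_mulX, map_add, mul_add, Finset.sum_add_distrib, map_smul,
      mul_smul_comm]
    congr 1
    · rw [Finset.sum_eq_single i]
      · simp
      · intro j _ hj; simp [Ne.symm hj]
      · simp
    · rw [Finset.mul_sum, Finset.smul_sum]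
      refine Finset.sum_congr rfl fun j _ => ?_
      rw [ev_mulX, ← mul_assoc, ← mul_assoc, (hom_qv i).comm (hY j), smul_mul_assoc, smul_smul]
      congr 1
      rw [← sgn_add, mul_comm (sdeg j)]
      congr 1
      rw [mul_add, mul_comm s, ← add_assoc, zmod_two_add_self, zero_add]

end Deriv

end QRing

end TrajOps

end SuperTraj

namespace SuperTraj

/-! ### Normal ordering -/

theorem zmod_two_cases (a : ZMod 2) : a = 0 ∨ a = 1 := by revert a; decide

theorem sgn_one : sgn 1 = -1 := by simp [sgn]

/-- The indicator of the positive frequencies. -/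
def theta (n : ℤ) : ℂ := if 0 < n then 1 else 0

section Nord

variable {W : Type*} [AddCommGroup W] [Module ℂ W]

/-- The normal-ordered product of `A` with the mode `P` of frequency `n` of a momentum. -/
def nord (t : ZMod 2) (n : ℤ) (A P : Module.End ℂ W) : Module.End ℂ W :=
  if n ≤ 0 then A * P else sgn t • (P * A)

/-- Normal ordering differs from the plain product by a single contraction, present for positive
frequencies only. This form is linear in the step function, so brackets of normal-ordered products
reduce to brackets of plain ones. -/
theorem nord_eq (t : ZMod 2) (n : ℤ) (A P : Module.End ℂ W) :
    nord t n A P = A * P + (theta n * sgn t) • sbr t P A := by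
  unfold nord theta
  split_ifs with h1 h2 h2
  · omega
  · simp
  · rw [sbr_def, one_mul, smul_sub, sgn_cancel]; abel
  · omega

theorem nord_add (t : ZMod 2) (n : ℤ) (A B P : Module.End ℂ W) :
    nord t n (A + B) P = nord t n A P + nord t n B P := by
  unfold nord; split_ifs
  · rw [add_mul]
  · rw [mul_add, smul_add]

theorem nord_smul (t : ZMod 2) (n : ℤ) (a : ℂ) (A P : Module.End ℂ W) :
    nord t n (a • A) P = a • nord t n A P := by
  unfold nord; split_ifs
  · rw [smul_mul_assoc]
  · rw [mul_smul_comm, smul_comm]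

theorem nord_sub (t : ZMod 2) (n : ℤ) (A B P : Module.End ℂ W) :
    nord t n (A - B) P = nord t n A P - nord t n B P := by
  unfold nord; split_ifs
  · rw [sub_mul]
  · rw [mul_sub, smul_sub]

theorem HasLS.nord {ι : Type*} {f : ι → Module.End ℂ W} {S : Module.End ℂ W} (h : HasLS f S)
    (t : ZMod 2) (n : ℤ) (P : Module.End ℂ W) :
    HasLS (fun b => nord t n (f b) P) (nord t n S P) := by
  unfold SuperTraj.nord; split_ifs
  · exact h.comp P
  · exact (h.map P).smul _

/-- Wick's theorem for two normal-ordered products. -/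
theorem sbr_nord_nord {a b i j : ZMod 2} {X Y P₁ P₂ U V : Module.End ℂ W} (m n : ℤ)
    (hP : sbr (j * i) P₁ P₂ = 0) (hXY : sbr (a * b) X Y = 0)
    (hU : sbr (j * b) P₁ Y = U) (hV : sbr (i * a) P₂ X = V)
    (hXU : sbr (a * (j + b)) X U = 0) (hYV : sbr (b * (i + a)) Y V = 0)
    (hUV : sbr ((j + b) * (i + a)) U V = 0)
    (hXK : sbr (a * (i + b)) X (sbr (i * b) P₂ Y) = 0)
    (hYK : sbr (b * (j + a)) Y (sbr (j * a) P₁ X) = 0)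
    (hKK : sbr ((j + a) * (i + b)) (sbr (j * a) P₁ X) (sbr (i * b) P₂ Y) = 0) :
    sbr ((a + j) * (b + i)) (nord (a * j) m X P₁) (nord (b * i) n Y P₂) =
      nord ((a + j + b) * i) n (X * U) P₂
        - sgn ((a + j) * (b + i)) • nord ((b + i + a) * j) m (Y * V) P₁
        + ((theta m - theta n) * sgn ((a + j + b) * i)) • (V * U) := by
  have e1 : sbr ((a + j) * (b + i)) (X * P₁) (Y * P₂) =
      X * U * P₂ - sgn ((a + j) * (b + i)) • (Y * V * P₁) := by
    have h1 : sbr ((a + j) * b) (X * P₁) Y = X * U := by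
      rw [show (a + j) * b = j * b + a * b by ring, sbr_mul_left, hXY, hU]; simp
    have h2 : sbr ((a + j) * i) (X * P₁) P₂ = -(sgn ((a + j) * i) • (V * P₁)) := by
      rw [show (a + j) * i = j * i + i * a by ring, sbr_mul_left, hP, sbr_swap (i * a) P₂ X, hV,
        sgn_add]
      simp [mul_smul]
    rw [mul_add, sbr_mul_right, h1, h2, sgn_add]
    simp only [mul_neg, smul_neg, mul_smul_comm, smul_smul, ← mul_assoc, sub_eq_add_neg]
  have e2 : sbr ((a + j) * (b + i)) (X * P₁) (sbr (i * b) P₂ Y) =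
      sgn (j * i) • (X * sbr (i * (j + b)) P₂ U) := by
    rw [show (a + j) * (b + i) = j * (i + b) + a * (i + b) by ring, sbr_mul_left, hXK, zero_mul,
      smul_zero, add_zero, show j * (i + b) = j * b + j * i by ring, sbr_sbr, hP, hU,
      sbr_zero_left, zero_add, mul_smul_comm, mul_add, mul_comm j i]
  have e3 : sbr ((a + j) * (b + i)) (sbr (j * a) P₁ X) (Y * P₂) =
      -((sgn ((a + j) * b) * sgn ((a + j) * i) * sgn (j * i)) •
        (Y * sbr (j * (i + a)) P₁ V)) := by
    have h1 : sbr (i * (j + a)) P₂ (sbr (j * a) P₁ X) =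
        sgn (j * i) • sbr (j * (i + a)) P₁ V := by
      rw [show i * (j + a) = i * a + j * i by ring, sbr_sbr, sbr_swap (j * i) P₁ P₂, hP, hV]
      rw [show j * (i + a) = j * i + j * a by ring]
      simp
    rw [mul_add, sbr_mul_right, sbr_swap_zero (s := (a + j) * b)
      (by rw [← hYK]; congr 1; ring), sbr_swap ((a + j) * i) P₂]
    rw [show (a + j) * i = i * (j + a) by ring, h1, zero_mul, zero_add]
    simp only [mul_neg, mul_smul_comm, smul_neg, smul_smul, mul_assoc]
  have e4 : sbr ((a + j) * (b + i)) (sbr (j * a) P₁ X) (sbr (i * b) P₂ Y) = 0 := by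
    rw [← hKK]; congr 1; ring
  -- Normal ordering X U against P₂ and Y V against P₁ produces, besides the contractions already
  -- present on the left, one product V U each. These carry θ(n) and θ(m) with opposite signs and
  -- make up the double contraction.
  have e5 : sbr ((a + j + b) * i) P₂ (X * U) = V * U + sgn (i * a) • (X * sbr (i * (j + b)) P₂ U)
      := by
    rw [show (a + j + b) * i = i * a + i * (j + b) by ring, sbr_mul_right, hV]
  have e6 : sbr ((b + i + a) * j) P₁ (Y * V) =
      sgn ((j + b) * (i + a)) • (V * U) + sgn (j * b) • (Y * sbr (j * (i + a)) P₁ V) := by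
    rw [show (b + i + a) * j = j * b + j * (i + a) by ring, sbr_mul_right, hU,
      sbr_eq_zero_iff.1 hUV]
  rw [nord_eq, nord_eq, nord_eq, nord_eq, sbr_add_left, sbr_add_right, sbr_add_right,
    sbr_smul_right, sbr_smul_left, sbr_smul_left, sbr_smul_right, e5, e6,
    show b * i = i * b by ring, show a * j = j * a by ring, e1, e2, e3, e4]
  generalize X * sbr (i * (j + b)) P₂ U = Z₁
  generalize Y * sbr (j * (i + a)) P₁ V = Z₂
  generalize X * U * P₂ = Z₃
  generalize Y * V * P₁ = Z₄
  generalize V * U = Z₅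
  -- Only the Koszul signs remain to be compared. They depend on four parities, and each of the
  -- sixteen cases is a linear identity in Z₁, …, Z₅.
  rcases zmod_two_cases a with rfl | rfl <;> rcases zmod_two_cases b with rfl | rfl <;>
  rcases zmod_two_cases i with rfl | rfl <;> rcases zmod_two_cases j with rfl | rfl <;>
    simp only [CharTwo.add_self_eq_zero, add_zero, zero_add, mul_one, mul_zero,
      sgn_zero, sgn_one] <;> module

end Nord

section LF

variable {W : Type*} [AddCommGroup W] [Module ℂ W]

theorem LF.of_fibers {ι κ : Type*} {f : ι × κ → Module.End ℂ W}
    (h1 : ∀ w, {j | ∃ i, f (i, j) w ≠ 0}.Finite) (h2 : ∀ j, LF fun i => f (i, j)) : LF f :=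
  fun w => by
  have : (⋃ j ∈ {j | ∃ i, f (i, j) w ≠ 0},
      (Function.support fun i => f (i, j) w) ×ˢ ({j} : Set κ)).Finite :=
    (h1 w).biUnion fun j _ => (h2 j w).prod (Set.finite_singleton j)
  refine this.subset fun x hx => ?_
  simp only [Set.mem_iUnion]
  exact ⟨x.2, ⟨x.1, hx⟩, hx, rfl⟩

/-- The sums over frequencies produced by double contractions. -/
theorem hasLS_theta {φ F : ℤ → ℂ} (hF0 : F 0 = 0) (hF : ∀ k, F (k + 1) = F k + φ (k + 1))
    (T : Module.End ℂ W) (k : ℤ) :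
    HasLS (fun n : ℤ => ((theta (n - k) - theta n) * φ n) • T) (-(F k) • T) := by
  -- Raising k by one changes the weight at n = k + 1 only, where it drops by one. The sum therefore
  -- telescopes to minus the discrete primitive F of φ, for negative k as well.
  have step : ∀ k, HasLS (fun n : ℤ => ((theta (n - (k + 1)) - theta (n - k)) * φ n) • T)
      (-(φ (k + 1)) • T) := by
    intro k
    have h := HasLS.single (f := fun n : ℤ =>
      ((theta (n - (k + 1)) - theta (n - k)) * φ n) • T) (k + 1) ?_
    · simpa [theta] using h
    · intro n hn
      have : theta (n - (k + 1)) = theta (n - k) := by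
        unfold theta
        congr 1
        exact propext ⟨fun h => by omega, fun h => by omega⟩
      simp [this]
  induction k using Int.induction_on with
  | zero => simpa [hF0] using HasLS.zero
  | succ k ih =>
    have h := ih.add (step k)
    rw [hF]
    convert h using 1
    · funext n; rw [← add_smul]; congr 1; ring
    · rw [← add_smul]; congr 1; ring
  | pred k ih =>
    have h := ih.sub (step (-(k : ℤ) - 1))
    rw [sub_add_cancel] at h
    have h2 := hF (-(k : ℤ) - 1)
    rw [sub_add_cancel] at h2
    convert h using 1
    · funext n; rw [← sub_smul]; congr 1; ring
    · rw [← sub_smul]; congr 1; rw [h2]; ring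

end LF

namespace TrajOps

variable {N M : ℕ} {W : Type*} [AddCommGroup W] [Module ℂ W] {R : TrajOps N M W}
  {p r s : ZMod 2} {c k₁ k₂ : ℂ}

/-- Normal ordering makes the product finite. The non-positive modes of p act first, and the energy
condition leaves finitely many of them; for the positive modes A acts first, and its truncation
bounds the sum on the other side (`mulOK_fpos`). -/
theorem mulOK_fneg {A P : Fld W} (hP : Truncated P) : MulOK A (fneg P) := fun n =>
  LF.of_bounds fun w => by
    obtain ⟨K, hK⟩ := hP w
    refine ⟨K, 0, fun b hb => ?_⟩
    rw [Module.End.mul_apply, fneg]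
    split_ifs with h
    · rw [hK b (by omega), map_zero]
    · simp

theorem mulOK_fpos {A P : Fld W} (hA : Truncated A) : MulOK (fpos P) A := fun n =>
  LF.of_bounds fun w => by
    obtain ⟨K, hK⟩ := hA w
    refine ⟨K, n, fun b hb => ?_⟩
    rw [Module.End.mul_apply]
    by_cases h : b < K
    · rw [hK b h, map_zero]
    · rw [fpos, if_neg (by omega)]; rfl

theorem _root_.SuperTraj.Truncated.smul {P : Fld W} (a : ℂ) (hP : Truncated P) :
    Truncated fun n => a • P n := fun w => by
  obtain ⟨K, hK⟩ := hP w
  exact ⟨K, fun n hn => by rw [LinearMap.smul_apply, hK n hn, smul_zero]⟩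

theorem trunc_pField (hR : R.IsRep c k₁ k₂) (i : SIdx N M) : Truncated (R.pField i) :=
  (hR.trunc_p i).smul _

theorem two_pi_ne_zero : (2 * Real.pi : ℂ) ≠ 0 := by
  simp [Real.pi_ne_zero]

namespace QRing

variable {hR : R.IsRep c k₁ k₂}

theorem trunc (A : QRing hR) : Truncated A.fld := fun w => by
  obtain ⟨K, hK⟩ := trunc₂_of_mem hR (1 : QRing hR).2 A.2 w
  refine ⟨K, fun n hn => ?_⟩
  have h := hK 0 n (Or.inr hn)
  have h1 : (1 : QRing hR).1 0 = 1 := by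
    change (fexp 0 : Fld W) 0 = 1
    simp [fexp]
  rwa [h1] at h

/-- The normal-ordered operator `∫ dt :A(t) p_i(t):`, for `A` such that the sign of the reordering
is `(-1)^t`. -/
def pop (i : SIdx N M) (t : ZMod 2) (A : QRing hR) : Module.End ℂ W :=
  integ (fmul A.fld (fneg (R.pField i)) + sgn t • fmul (fpos (R.pField i)) A.fld)

theorem hasLS_pop (i : SIdx N M) (t : ZMod 2) (A : QRing hR) :
    HasLS (fun n => nord t n (A.fld (-n)) (R.p i n)) (pop i t A) := by
  have h1 := ((mulOK_fneg (A := A.fld) (trunc_pField hR i)).hasLS 0)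
  have h2 := ((mulOK_fpos (P := R.pField i) (trunc A)).hasLS 0).equiv (Equiv.neg ℤ)
  refine ((h1.add (h2.smul (sgn t))).smul (2 * Real.pi)).congr fun n => ?_
  simp only [Equiv.neg_apply, fneg, fpos, pField, nord, zero_sub, neg_neg]
  by_cases h : n ≤ 0
  · rw [if_pos h, if_pos h, if_neg (by omega), mul_smul_comm, zero_mul, smul_zero, add_zero,
      smul_smul, mul_one_div, div_self two_pi_ne_zero, one_smul]
  · rw [if_neg h, if_neg h, if_pos (by omega), mul_zero, zero_add, smul_mul_assoc, smul_comm,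
      smul_smul (2 * Real.pi : ℂ), mul_one_div, div_self two_pi_ne_zero, one_smul]

theorem pop_add (i : SIdx N M) (t : ZMod 2) (A B : QRing hR) :
    pop i t (A + B) = pop i t A + pop i t B :=
  (hasLS_pop i t (A + B)).unique (((hasLS_pop i t A).add (hasLS_pop i t B)).congr fun n => by
    rw [fld_add, Pi.add_apply, nord_add])

theorem pop_smul (i : SIdx N M) (t : ZMod 2) (a : ℂ) (A : QRing hR) :
    pop i t (a • A) = a • pop i t A :=
  (hasLS_pop i t (a • A)).unique (((hasLS_pop i t A).smul a).congr fun n => by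
    rw [fld_smul, Pi.smul_apply, nord_smul])

/-- `pop` as a linear map. -/
def popL (hR : R.IsRep c k₁ k₂) (i : SIdx N M) (t : ZMod 2) : QRing hR →ₗ[ℂ] Module.End ℂ W where
  toFun := pop i t
  map_add' := pop_add i t
  map_smul' := pop_smul i t

/-- The sum of normal-ordered products in which the coefficient is a convolution. -/
theorem hasLS_pop_mul (i : SIdx N M) (t : ZMod 2) (A B : QRing hR) :
    HasLS (fun x : ℤ × ℤ =>
      nord t x.2 (A.fld (-x.1) * (E hR x.1 * B).fld (-x.2)) (R.p i x.2)) (pop i t (A * B)) := by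
  have inner : ∀ n, HasLS (fun m : ℤ => A.fld (-m) * (E hR m * B).fld (-n))
      ((A * B).fld (-n)) := by
    intro n
    refine ((hasLS_mul A B (-n)).equiv (Equiv.subRight n)).congr fun m => ?_
    rw [fld_E_mul, Equiv.subRight_apply]
    congr 2 <;> ring
  have hin : ∀ n, HasLS (fun m : ℤ => nord t n (A.fld (-m) * (E hR m * B).fld (-n)) (R.p i n))
      (nord t n ((A * B).fld (-n)) (R.p i n)) := fun n => (inner n).nord t n _
  refine LF.hasLS_of_inner_right (LF.of_fibers (fun w => ?_) fun n => (hin n).1) hin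
    (hasLS_pop i t (A * B))
  obtain ⟨K, hK⟩ := hR.trunc_p i w
  obtain ⟨L, hL⟩ := trunc₂_of_mem hR A.2 B.2 w
  -- For n ≤ 0 the momentum acts first and bounds n from below. For n > 0 the two coefficient
  -- frequencies add up to -n, so if n > -2L one of them lies below L and kills the vector.
  refine (Set.finite_Icc (min K 1) (max 0 (-L - L))).subset ?_
  rintro n ⟨m, hm⟩
  rw [Set.mem_Icc]
  simp only [nord] at hm
  split_ifs at hm with h
  · refine ⟨?_, by omega⟩
    by_contra hn
    refine hm ?_
    rw [Module.End.mul_apply, hK n (by omega), map_zero]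
  · refine ⟨by omega, ?_⟩
    by_contra hn
    refine hm ?_
    rw [LinearMap.smul_apply, Module.End.mul_apply, Module.End.mul_apply, fld_E_mul]
    have := hL (-m) (-n + m) (by omega)
    rw [show A.fld (-m) (B.fld (-n + m) w) = 0 from this]
    simp

/-- In the coordinates k = n - m and n, the product A_k B_{-k} does not depend on n. The sum over n
is thus numerical and equals -F(k), and what remains is the zero mode of a product whose first
factor has the modes F(k) A_k. -/
theorem hasLS_contraction {φ F : ℤ → ℂ} (hF0 : F 0 = 0)
    (hF : ∀ k, F (k + 1) = F k + φ (k + 1)) {A A' : QRing hR}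
    (hA : ∀ k, A'.fld k = F k • A.fld k) (B : QRing hR) :
    HasLS (fun x : ℤ × ℤ => ((theta x.1 - theta x.2) * φ x.2) •
      (A.fld (x.2 - x.1) * B.fld (x.1 - x.2))) (-(A' * B).fld 0) := by
  let e : ℤ × ℤ ≃ ℤ × ℤ :=
    { toFun := fun x => (x.2, x.2 - x.1)
      invFun := fun x => (x.1 - x.2, x.1)
      left_inv := fun x => by ext <;> simp
      right_inv := fun x => by ext <;> simp }
  have hin : ∀ k, HasLS (fun n : ℤ => ((theta (n - k) - theta n) * φ n) •
      (A.fld k * B.fld (-k))) (-(F k) • (A.fld k * B.fld (-k))) := fun k =>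
    hasLS_theta hF0 hF _ k
  have hlf : LF fun x : ℤ × ℤ => ((theta (x.1 - x.2) - theta x.1) * φ x.1) •
      (A.fld x.2 * B.fld (-x.2)) := by
    refine LF.of_fibers (fun w => ?_) fun k => (hin k).1
    refine (((hasLS_mul A B 0).equiv (Equiv.neg ℤ)).1 w).subset ?_
    rintro k ⟨n, hn⟩ h0
    refine hn ?_
    simp only [Equiv.neg_apply, zero_sub, neg_neg] at h0
    rw [LinearMap.smul_apply, h0, smul_zero]
  have hout : HasLS (fun k : ℤ => -(F k) • (A.fld k * B.fld (-k))) (-(A' * B).fld 0) := by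
    refine (((hasLS_mul A' B 0).equiv (Equiv.neg ℤ)).neg).congr fun k => ?_
    simp only [Equiv.neg_apply, zero_sub, neg_neg]
    rw [hA, smul_mul_assoc, neg_smul]
  have := (hlf.hasLS_of_inner_right hin hout).equiv e
  refine this.congr fun x => ?_
  simp [e]

theorem fld_d_apply (A : QRing hR) (k : ℤ) : (d hR A).fld k = (-Complex.I * k) • A.fld k := rfl

/-- The sum of the double contractions between two modes that are local up to first derivatives. -/
theorem hasLS_double_contraction (α β x y : QRing hR) :
    HasLS (fun z : ℤ × ℤ => (theta z.1 - theta z.2) •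
      ((α.fld (z.2 - z.1) - (Complex.I * z.2) • x.fld (z.2 - z.1)) *
        (β.fld (z.1 - z.2) - (Complex.I * z.1) • y.fld (z.1 - z.2))))
      ((-Complex.I • (d hR α * β) - (Complex.I / 2) • (d hR (d hR x) * β)
        - (1 / 2 : ℂ) • (d hR x * β) + (Complex.I / 2) • (d hR (d hR α) * y)
        - (1 / 2 : ℂ) • (d hR α * y)
        + (Complex.I / 6) • ((d hR (d hR (d hR x)) + d hR x) * y)).fld 0) := by
  have I2 : Complex.I * Complex.I = -1 := Complex.I_mul_I
  -- The k-th mode of `d A` is -ik A_k, so k acts as i `d`. The primitives of 1, n and n² are k,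
  -- k(k+1)/2 and k(k+1)(2k+1)/6, which become the three differential operators in `c0`, `c1` and
  -- `c2`.
  have c0 : ∀ A B : QRing hR, HasLS (fun z : ℤ × ℤ => ((theta z.1 - theta z.2) * 1) •
      (A.fld (z.2 - z.1) * B.fld (z.1 - z.2))) (-((Complex.I • d hR A) * B).fld 0) :=
    fun A B => hasLS_contraction (φ := fun _ => 1) (F := fun k => (k : ℂ)) (by simp)
      (fun k => by push_cast; ring) (fun k => by
        rw [fld_smul, Pi.smul_apply, fld_d_apply, smul_smul]; congr 1
        linear_combination (-k : ℂ) * I2) B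
  have c1 : ∀ A B : QRing hR, HasLS (fun z : ℤ × ℤ => ((theta z.1 - theta z.2) * (z.2 : ℂ)) •
      (A.fld (z.2 - z.1) * B.fld (z.1 - z.2)))
      (-(((1 / 2 : ℂ) • (Complex.I • d hR A - d hR (d hR A))) * B).fld 0) :=
    fun A B => hasLS_contraction (φ := fun n => (n : ℂ)) (F := fun k => (k ^ 2 + k : ℂ) / 2)
      (by simp) (fun k => by push_cast; ring) (fun k => by
        simp only [fld_smul, fld_sub, Pi.smul_apply, Pi.sub_apply, fld_d_apply, smul_smul,
          ← sub_smul]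
        congr 1
        linear_combination (-(k : ℂ) / 2 - (k : ℂ) ^ 2 / 2) * I2) B
  have c2 : ∀ A B : QRing hR, HasLS (fun z : ℤ × ℤ =>
      ((theta z.1 - theta z.2) * (z.2 : ℂ) ^ 2) • (A.fld (z.2 - z.1) * B.fld (z.1 - z.2)))
      (-(((1 / 6 : ℂ) • (Complex.I • d hR A - (3 : ℂ) • d hR (d hR A)
        - (2 * Complex.I) • d hR (d hR (d hR A)))) * B).fld 0) :=
    fun A B => hasLS_contraction (φ := fun n => (n : ℂ) ^ 2)
      (F := fun k => (2 * k ^ 3 + 3 * k ^ 2 + k : ℂ) / 6)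
      (by simp) (fun k => by push_cast; ring) (fun k => by
        simp only [fld_smul, fld_sub, Pi.smul_apply, Pi.sub_apply, fld_d_apply, smul_smul,
          ← sub_smul]
        congr 1
        have I4 : Complex.I * Complex.I * (Complex.I * Complex.I) = 1 := by rw [I2]; ring
        linear_combination (-(k : ℂ) / 6 - (k : ℂ) ^ 2 / 2) * I2 + ((k : ℂ) ^ 3 / 3) * I4) B
  -- All powers are expressed in n: since m = n - k, the factor -im equals -in + ik, and ik acts on
  -- the left factor as -`d`.
  have key := ((((c0 α β).sub ((c1 x β).smul Complex.I)).sub ((c1 α y).smul Complex.I)).sub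
    (c0 (d hR α) y |>.smul 1)).sub ((c2 x y).sub ((c1 (d hR x) y).smul Complex.I))
  have hv := key.congr (g := fun z : ℤ × ℤ => (theta z.1 - theta z.2) •
      ((α.fld (z.2 - z.1) - (Complex.I * z.2) • x.fld (z.2 - z.1)) *
        (β.fld (z.1 - z.2) - (Complex.I * z.1) • y.fld (z.1 - z.2)))) fun z => by
    simp only [fld_d_apply, smul_mul_assoc, mul_smul_comm, sub_mul, mul_sub, smul_sub, smul_smul]
    match_scalars
    · ring
    · ring
    · ring
    · linear_combination
        (-(theta z.1 - theta z.2) * (z.2 : ℂ) ^ 2) * I2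
  convert hv using 1
  simp only [← mode_apply, map_sub, map_add, map_smul, smul_mul_assoc, sub_mul, add_mul]
  match_scalars
  all_goals first | ring1 | (ring_nf; simp only [Complex.I_sq]; ring1)

end QRing

end TrajOps

end SuperTraj

namespace SuperTraj

/-! ### Brackets of normal-ordered operators linear in the momentum -/

section Alg

variable {W : Type*} [AddCommGroup W] [Module ℂ W]

/-- Only P contracts with Q, and the contraction Z supercommutes with X, so both orderings of X and
P give the same result. -/
theorem sbr_nord {a b j : ZMod 2} {X P Q Z : Module.End ℂ W} (m : ℤ)
    (hXQ : sbr (a * b) X Q = 0) (hPQ : sbr (j * b) P Q = Z) (hXZ : sbr (a * (j + b)) X Z = 0) :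
    sbr ((a + j) * b) (nord (a * j) m X P) Q = X * Z := by
  unfold nord
  split_ifs
  · rw [show (a + j) * b = j * b + a * b by ring, sbr_mul_left, hXQ, hPQ]; simp
  · rw [sbr_smul_left, show (a + j) * b = a * b + j * b by ring, sbr_mul_left, hXQ, hPQ,
      mul_zero, zero_add, sbr_eq_zero_iff.1 hXZ]
    simp only [smul_smul, ← sgn_add, mul_add]

/-- The coefficients supercommute with each other and with the currents P and Q, so the bracket of
the products comes entirely from that of the currents. -/
theorem sbr_mul_mul {a b t u : ZMod 2} {A B P Q : Module.End ℂ W} (hAB : sbr (a * b) A B = 0)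
    (hPB : sbr (t * b) P B = 0) (hQA : sbr (u * a) Q A = 0) :
    sbr ((a + t) * (b + u)) (A * P) (B * Q) = sgn (t * b) • (A * B * sbr (t * u) P Q) := by
  have h1 : sbr ((a + t) * b) (A * P) B = 0 := by
    rw [show (a + t) * b = t * b + a * b by ring, sbr_mul_left, hAB, hPB]; simp
  have h2 : sbr ((a + t) * u) (A * P) Q = A * sbr (t * u) P Q := by
    rw [show (a + t) * u = t * u + u * a by ring, sbr_mul_left, sbr_swap_zero hQA]; simp
  rw [mul_add, sbr_mul_right, h1, h2, zero_mul, zero_add, ← mul_assoc, sbr_eq_zero_iff.1 hAB,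
    smul_mul_assoc]
  rw [smul_smul, add_mul, sgn_add, mul_comm (sgn (a * b))]

end Alg

namespace TrajOps

variable {N M : ℕ} {W : Type*} [AddCommGroup W] [Module ℂ W] {R : TrajOps N M W}
  {p r s : ZMod 2} {c k₁ k₂ : ℂ}

namespace QRing

variable {hR : R.IsRep c k₁ k₂}

theorem Hom.sbr {A B : QRing hR} (hA : Hom p A) (hB : Hom r B) (m n : ℤ) :
    sbr (p * r) (A.fld m) (B.fld n) = 0 := QFun.comm hR hA hB m n

/-- The contribution of the double contractions. -/
def contr (α β x y : QRing hR) : QRing hR :=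
  -Complex.I • (d hR α * β) - (Complex.I / 2) • (d hR (d hR x) * β)
    - (1 / 2 : ℂ) • (d hR x * β) + (Complex.I / 2) • (d hR (d hR α) * y)
    - (1 / 2 : ℂ) • (d hR α * y) + (Complex.I / 6) • ((d hR (d hR (d hR x)) + d hR x) * y)

/-- The bracket of two normal-ordered operators linear in the momentum. -/
theorem sbr_pop_pop {i j : SIdx N M} {X Y α β x y : QRing hR}
    (hX : Hom (p + sdeg j) X) (hY : Hom (r + sdeg i) Y)
    (hα : Hom (p + sdeg j + sdeg i) α) (hβ : Hom (r + sdeg i + sdeg j) β)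
    (hx : Hom (p + sdeg j + sdeg i) x) (hy : Hom (r + sdeg i + sdeg j) y)
    (hXp : ∀ n k, sbr (sdeg i * (p + sdeg j)) (R.p i n) (X.fld k) =
      α.fld (n + k) - (Complex.I * n) • x.fld (n + k))
    (hYp : ∀ n k, sbr (sdeg j * (r + sdeg i)) (R.p j n) (Y.fld k) =
      β.fld (n + k) - (Complex.I * n) • y.fld (n + k))
    (hXK : ∀ n, ∃ K : QRing hR, Hom (sdeg j + (p + sdeg j)) K ∧
      ∀ k, sbr (sdeg j * (p + sdeg j)) (R.p j n) (X.fld k) = K.fld k)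
    (hYK : ∀ n, ∃ K : QRing hR, Hom (sdeg i + (r + sdeg i)) K ∧
      ∀ k, sbr (sdeg i * (r + sdeg i)) (R.p i n) (Y.fld k) = K.fld k) :
    sbr (p * r) (pop j ((p + sdeg j) * sdeg j) X) (pop i ((r + sdeg i) * sdeg i) Y) =
      pop i ((p + r + sdeg i) * sdeg i) (X * β - d hR X * y)
        - sgn (p * r) • pop j ((p + r + sdeg j) * sdeg j) (Y * α - d hR Y * x)
        + sgn ((p + r + sdeg i) * sdeg i) • (contr α β x y).fld 0 := by
  have h1 := (hasLS_pop j ((p + sdeg j) * sdeg j) X).sbr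
    (hasLS_pop i ((r + sdeg i) * sdeg i) Y) (p * r)
  have s1 := (hasLS_pop_mul i ((p + r + sdeg i) * sdeg i) X β).sub
    (hasLS_pop_mul i ((p + r + sdeg i) * sdeg i) (d hR X) y)
  have s2 := ((hasLS_pop_mul j ((p + r + sdeg j) * sdeg j) Y α).sub
    (hasLS_pop_mul j ((p + r + sdeg j) * sdeg j) (d hR Y) x)).equiv (Equiv.prodComm ℤ ℤ)
  have s3 := hasLS_double_contraction α β x y
  have h2 := (s1.sub (s2.smul (sgn (p * r)))).add (s3.smul (sgn ((p + r + sdeg i) * sdeg i)))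
  have e1 : pop i ((p + r + sdeg i) * sdeg i) (X * β - d hR X * y) =
    pop i ((p + r + sdeg i) * sdeg i) (X * β) - pop i ((p + r + sdeg i) * sdeg i) (d hR X * y) :=
    map_sub (popL hR i _) _ _
  have e2 : pop j ((p + r + sdeg j) * sdeg j) (Y * α - d hR Y * x) =
    pop j ((p + r + sdeg j) * sdeg j) (Y * α) - pop j ((p + r + sdeg j) * sdeg j) (d hR Y * x) :=
    map_sub (popL hR j _) _ _
  rw [e1, e2]
  refine h1.unique (h2.congr fun z => ?_)
  obtain ⟨m, n⟩ := z
  obtain ⟨K, hK, hKX⟩ := hXK m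
  obtain ⟨K', hK', hKY⟩ := hYK n
  have hU := hYp m (-n)
  have hV := hXp n (-m)
  set U := β.fld (m + -n) - (Complex.I * m) • y.fld (m + -n) with hUdef
  set V := α.fld (n + -m) - (Complex.I * n) • x.fld (n + -m) with hVdef
  have hcast1 : r + sdeg i + sdeg j = sdeg j + (r + sdeg i) := add_comm _ _
  have hcast2 : p + sdeg j + sdeg i = sdeg i + (p + sdeg j) := add_comm _ _
  rw [hcast1] at hβ hy
  rw [hcast2] at hα hx
  have sub_zero' : ∀ {s : ZMod 2} {A B C : Module.End ℂ W} (a : ℂ), SuperTraj.sbr s A B = 0 →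
      SuperTraj.sbr s A C = 0 → SuperTraj.sbr s A (B - a • C) = 0 := by
    intro s A B C a h h'
    rw [sub_eq_add_neg, ← neg_smul, sbr_add_right, sbr_smul_right, h, h']; simp
  have w := sbr_nord_nord (W := W) (a := p + sdeg j) (b := r + sdeg i) (i := sdeg i)
    (j := sdeg j) (X := X.fld (-m)) (Y := Y.fld (-n)) (P₁ := R.p j m) (P₂ := R.p i n) m n
    (hR.pp j i m n) (hX.sbr hY _ _) hU hV
    (sub_zero' _ (hX.sbr hβ _ _) (hX.sbr hy _ _))
    (sub_zero' _ (hY.sbr hα _ _) (hY.sbr hx _ _))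
    (sub_zero' _ (sbr_swap_zero (sub_zero' _ (by rw [mul_comm]; exact hα.sbr hβ _ _)
        (by rw [mul_comm]; exact hα.sbr hy _ _)))
      (sbr_swap_zero (sub_zero' _ (by rw [mul_comm]; exact hx.sbr hβ _ _)
        (by rw [mul_comm]; exact hx.sbr hy _ _))))
    (by rw [hKY]; exact hX.sbr hK' _ _) (by rw [hKX]; exact hY.sbr hK _ _)
    (by rw [hKX, hKY]; exact hK.sbr hK' _ _)
  have z1 : p + sdeg j + sdeg j = p := by rw [add_assoc, zmod_two_add_self, add_zero]
  have z2 : r + sdeg i + sdeg i = r := by rw [add_assoc, zmod_two_add_self, add_zero]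
  rw [z1, z2, show p + (r + sdeg i) = p + r + sdeg i by ring,
    show r + (p + sdeg j) = p + r + sdeg j by ring] at w
  rw [w]
  congr 1
  · congr 1
    · dsimp only
      rw [← nord_sub]
      congr 1
      -- The factor im that accompanies the velocity part y of the contraction turns X_{-m} into a
      -- mode of `d X`, whence the term -Ẋ y in the coefficient.
      rw [fld_E_mul, fld_E_mul, hUdef, mul_sub, fld_d_apply, add_comm m]
      rw [mul_smul_comm, smul_mul_assoc]
      congr 2
      push_cast; ring
    · congr 1
      simp only [Equiv.prodComm_apply, Prod.swap]
      rw [← nord_sub]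
      congr 1
      rw [fld_E_mul, fld_E_mul, hVdef, mul_sub, fld_d_apply, add_comm n]
      rw [mul_smul_comm, smul_mul_assoc]
      congr 2
      push_cast; ring
  · rw [smul_smul, mul_comm]
    rfl

/-- The normal-ordered operator `∫ dt :X^i(t) p_i(t):`. -/
def dop (p : ZMod 2) (X : SIdx N M → QRing hR) : Module.End ℂ W :=
  ∑ i, pop i ((p + sdeg i) * sdeg i) (X i)

/-- The sums `x'` and `y'` are kept as parameters because the velocity parts of the generators are
diagonal in the indices, so that these sums collapse to one term in the application. -/
theorem sbr_dop_dop {X Y x' y' : SIdx N M → QRing hR} {α β x y : SIdx N M → SIdx N M → QRing hR}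
    (hX : ∀ j, Hom (p + sdeg j) (X j)) (hY : ∀ i, Hom (r + sdeg i) (Y i))
    (hα : ∀ i j, Hom (p + sdeg j + sdeg i) (α i j))
    (hβ : ∀ j i, Hom (r + sdeg i + sdeg j) (β j i))
    (hx : ∀ i j, Hom (p + sdeg j + sdeg i) (x i j))
    (hy : ∀ j i, Hom (r + sdeg i + sdeg j) (y j i))
    (hXp : ∀ i j n k, sbr (sdeg i * (p + sdeg j)) (R.p i n) ((X j).fld k) =
      (α i j).fld (n + k) - (Complex.I * n) • (x i j).fld (n + k))
    (hYp : ∀ j i n k, sbr (sdeg j * (r + sdeg i)) (R.p j n) ((Y i).fld k) =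
      (β j i).fld (n + k) - (Complex.I * n) • (y j i).fld (n + k))
    (hx' : ∀ j, ∑ i, d hR (Y i) * x i j = x' j) (hy' : ∀ i, ∑ j, d hR (X j) * y j i = y' i) :
    sbr (p * r) (dop p X) (dop r Y) =
      dop (p + r) (fun i => ∑ j, X j * β j i - y' i)
        - sgn (p * r) • dop (p + r) (fun j => ∑ i, Y i * α i j - x' j)
        + ∑ i, ∑ j, sgn ((p + r + sdeg i) * sdeg i) •
          (contr (α i j) (β j i) (x i j) (y j i)).fld 0 := by
  -- Wick's theorem also involves the contraction of a momentum with its own coefficient. For fixed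
  -- n this is a mode of e^{int}(α - in x), hence again of a homogeneous functional, and so
  -- supercommutes with the other functionals.
  have aux : ∀ {A B : QRing hR} {n : ℤ}, ∀ k,
      (E hR n * (A - (Complex.I * n) • B)).fld k = A.fld (n + k) - (Complex.I * n) • B.fld (n + k)
      := fun k => by rw [fld_E_mul, add_comm]; rfl
  have key : ∀ i j, sbr (p * r) (pop j ((p + sdeg j) * sdeg j) (X j))
      (pop i ((r + sdeg i) * sdeg i) (Y i)) = _ := fun i j =>
    sbr_pop_pop (hX j) (hY i) (hα i j) (hβ j i) (hx i j) (hy j i) (hXp i j) (hYp j i)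
      (fun n => ⟨E hR n * (α j j - (Complex.I * n) • x j j),
        ((hom_E n).mul ((hα j j).sub ((hx j j).smul _))).cast (by ring),
        fun k => by rw [hXp, aux]⟩)
      (fun n => ⟨E hR n * (β i i - (Complex.I * n) • y i i),
        ((hom_E n).mul ((hβ i i).sub ((hy i i).smul _))).cast (by ring),
        fun k => by rw [hYp, aux]⟩)
  rw [dop, dop, sbr_sum_left]
  simp only [sbr_sum_right]
  rw [Finset.sum_comm]
  simp only [key, Finset.sum_add_distrib, Finset.sum_sub_distrib]
  congr 2
  · rw [dop]
    refine Finset.sum_congr rfl fun i _ => ?_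
    rw [← hy', ← Finset.sum_sub_distrib]
    exact (map_sum (popL hR i _) _ _).symm
  · rw [Finset.sum_comm, dop, Finset.smul_sum]
    refine Finset.sum_congr rfl fun j _ => ?_
    rw [← hx', ← Finset.sum_sub_distrib, ← Finset.smul_sum]
    congr 1
    exact (map_sum (popL hR j _) _ _).symm

theorem dop_sub_smul (X Y : SIdx N M → QRing hR) (a : ℂ) :
    dop p (fun i => X i - a • Y i) = dop p X - a • dop p Y := by
  simp only [dop, Finset.smul_sum, ← Finset.sum_sub_distrib]
  refine Finset.sum_congr rfl fun i _ => ?_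
  rw [sub_eq_add_neg, ← neg_smul, pop_add, pop_smul, neg_smul, ← sub_eq_add_neg]

/-- The action on the trajectory. -/
theorem sbr_dop_q {X : SIdx N M → QRing hR} (hX : ∀ j, Hom (p + sdeg j) (X j)) (i : SIdx N M)
    (n : ℤ) : sbr (p * sdeg i) (dop p X) (R.q i n) = (X i).fld n := by
  have h : ∀ j, sbr (p * sdeg i) (pop j ((p + sdeg j) * sdeg j) (X j)) (R.q i n) =
      if i = j then (X j).fld n else 0 := by
    intro j
    refine ((hasLS_pop j _ (X j)).sbr_left (p * sdeg i) (R.q i n)).unique ?_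
    have hs := HasLS.single (f := fun m => SuperTraj.sbr (p * sdeg i)
      (nord ((p + sdeg j) * sdeg j) m ((X j).fld (-m)) (R.p j m)) (R.q i n)) (-n)
    have val : ∀ m, SuperTraj.sbr (p * sdeg i)
        (nord ((p + sdeg j) * sdeg j) m ((X j).fld (-m)) (R.p j m)) (R.q i n) =
        (X j).fld (-m) * if i = j ∧ m + n = 0 then 1 else 0 := by
      intro m
      have hz : SuperTraj.sbr ((p + sdeg j) * (sdeg j + sdeg i)) ((X j).fld (-m))
          (if i = j ∧ m + n = 0 then 1 else 0) = 0 := by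
        split_ifs with h
        · rw [h.1, zmod_two_add_self]; simp [sbr_def]
        · simp
      have := sbr_nord m ((hX j).sbr (hom_qv (hR := hR) i) (-m) n) (hR.pq j i m n) hz
      rwa [show p + sdeg j + sdeg j = p by rw [add_assoc, zmod_two_add_self, add_zero]] at this
    have h0 := hs fun m hm => by
      rw [val, if_neg (fun h => hm (by omega)), mul_zero]
    convert h0 using 1
    rw [val]
    by_cases hij : i = j <;> simp [hij]
  rw [dop, sbr_sum_left]
  simp [h]

theorem sbr_dop_eq_zero {X : SIdx N M → QRing hR} (hX : ∀ j, Hom (p + sdeg j) (X j))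
    {Q : Module.End ℂ W} (hq : ∀ i n, sbr (s * sdeg i) Q (R.q i n) = 0)
    (hp : ∀ i n, sbr (s * sdeg i) Q (R.p i n) = 0) : sbr (p * s) (dop p X) Q = 0 := by
  rw [dop, sbr_sum_left]
  refine Finset.sum_eq_zero fun j _ => ?_
  refine ((hasLS_pop j _ (X j)).sbr_left (p * s) Q).unique (HasLS.zero.congr fun m => ?_)
  have h1 : SuperTraj.sbr ((p + sdeg j) * s) ((X j).fld (-m)) Q = 0 := by
    rw [mul_comm]
    exact sbr_swap_zero (QFun.sbr_eq_zero hq (hX j) _)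
  have h2 : SuperTraj.sbr (sdeg j * s) (R.p j m) Q = 0 := by
    rw [mul_comm]
    exact sbr_swap_zero (hp j m)
  have := sbr_nord m h1 h2 (sbr_zero_right _ _)
  rw [show p + sdeg j + sdeg j = p by rw [add_assoc, zmod_two_add_self, add_zero]] at this
  rw [this, mul_zero]

end QRing

end TrajOps

end SuperTraj

namespace SuperTraj

/-! ### Currents that commute with the trajectory and its momentum -/

namespace TrajOps

variable {N M : ℕ} {W : Type*} [AddCommGroup W] [Module ℂ W] {R : TrajOps N M W}
  {p r s t u : ZMod 2} {c k₁ k₂ : ℂ}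

variable (R) in
/-- The modes of a field of parity `t` that commutes with the trajectory and its momentum. -/
structure IsExt (t : ZMod 2) (P : ℤ → Module.End ℂ W) : Prop where
  trunc : Truncated P
  q : ∀ n i m, sbr (t * sdeg i) (P n) (R.q i m) = 0
  p : ∀ n i m, sbr (t * sdeg i) (P n) (R.p i m) = 0

theorem isExt_T (hR : R.IsRep c k₁ k₂) (μ ν : Idx N M) : R.IsExt (deg μ + deg ν) (R.T μ ν) :=
  ⟨hR.trunc_T μ ν, fun n i m => hR.Tq μ ν n i m, fun n i m => hR.Tp μ ν n i m⟩

/-- The factor i accounts for the prefactor i/2π of L(t), where p(t) and T(t) have 1/2π. -/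
theorem isExt_L (hR : R.IsRep c k₁ k₂) : R.IsExt 0 fun n => Complex.I • R.L n :=
  ⟨hR.trunc_L.smul _, fun n i m => by rw [zero_mul, sbr_smul_left, hR.Lq, smul_zero],
    fun n i m => by rw [zero_mul, sbr_smul_left, hR.Lp, smul_zero]⟩

/-- No normal ordering is needed here: P bounds its own frequency from below, and since it
supercommutes with A the truncation of A bounds it from above. -/
theorem QFun.mulOK_ext (hR : R.IsRep c k₁ k₂) {A : Fld W} (hA : R.QFun p A)
    {P : ℤ → Module.End ℂ W} (hP : R.IsExt t P) : MulOK A P := fun n =>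
  LF.of_bounds fun w => by
    obtain ⟨K, hK⟩ := hP.trunc w
    obtain ⟨L, hL⟩ := hA.truncated hR w
    refine ⟨K, n - L, fun b hb => ?_⟩
    rw [Module.End.mul_apply]
    by_cases h : b < K
    · rw [hK b h, map_zero]
    · have := sbr_eq_zero_iff.1 (sbr_swap_zero (hA.sbr_eq_zero (hP.q b) (n - b)))
      have h2 := LinearMap.congr_fun this w
      simp only [Module.End.mul_apply, LinearMap.smul_apply] at h2
      rw [h2, hL _ (by omega), map_zero, smul_zero]

namespace QRing

variable {hR : R.IsRep c k₁ k₂} {P Q : ℤ → Module.End ℂ W}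

theorem _root_.SuperTraj.TrajOps.IsExt.comm (hP : R.IsExt t P) {A : QRing hR} (hA : Hom p A)
    (n m : ℤ) : sbr (t * p) (P n) (A.fld m) = 0 := QFun.sbr_eq_zero (hP.q n) hA m

/-- The operator `∫ dt A(t) P(t)`. -/
def cop (A : QRing hR) (P : ℤ → Module.End ℂ W) : Module.End ℂ W :=
  integ (fmul A.fld fun n => (1 / (2 * Real.pi) : ℂ) • P n)

theorem hasLS_cop {A : QRing hR} (hA : Hom p A) (hP : R.IsExt t P) :
    HasLS (fun n => A.fld (-n) * P n) (cop A P) := by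
  have hP' : R.IsExt t fun n => (1 / (2 * Real.pi) : ℂ) • P n :=
    ⟨hP.trunc.smul _, fun n i m => by rw [sbr_smul_left, hP.q, smul_zero],
      fun n i m => by rw [sbr_smul_left, hP.p, smul_zero]⟩
  refine (((QFun.mulOK_ext hR hA hP').hasLS 0).smul (2 * Real.pi)).congr fun n => ?_
  rw [mul_smul_comm, smul_smul, mul_one_div, div_self two_pi_ne_zero, one_smul, zero_sub]

theorem cop_add {A B : QRing hR} (hA : Hom p A) (hB : Hom p B) (hP : R.IsExt t P) :
    cop (A + B) P = cop A P + cop B P :=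
  (hasLS_cop (hA.add hB) hP).unique (((hasLS_cop hA hP).add (hasLS_cop hB hP)).congr fun n => by
    rw [fld_add, Pi.add_apply, add_mul])

theorem cop_smul {A : QRing hR} (hA : Hom p A) (hP : R.IsExt t P) (a : ℂ) :
    cop (a • A) P = a • cop A P :=
  (hasLS_cop (hA.smul a) hP).unique (((hasLS_cop hA hP).smul a).congr fun n => by
    rw [fld_smul, Pi.smul_apply, smul_mul_assoc])

theorem cop_sub {A B : QRing hR} (hA : Hom p A) (hB : Hom p B) (hP : R.IsExt t P) :
    cop (A - B) P = cop A P - cop B P := by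
  rw [sub_eq_add_neg, cop_add hA hB.neg hP, ← neg_one_smul ℂ B, cop_smul hB hP]
  simp [sub_eq_add_neg]

theorem cop_zero (hP : R.IsExt t P) : cop (0 : QRing hR) P = 0 :=
  (hasLS_cop (Hom.zero (p := 0)) hP).unique (HasLS.zero.congr fun n => by simp)

theorem cop_sum {ι : Type*} (f : Finset ι) {A : ι → QRing hR} (hA : ∀ i ∈ f, Hom p (A i))
    (hP : R.IsExt t P) : cop (∑ i ∈ f, A i) P = ∑ i ∈ f, cop (A i) P := by
  classical
  induction f using Finset.induction_on with
  | empty => simpa using cop_zero hP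
  | insert a f ha ih =>
    have h1 : ∀ i ∈ f, Hom p (A i) := fun i hi => hA i (Finset.mem_insert_of_mem hi)
    rw [Finset.sum_insert ha, Finset.sum_insert ha,
      cop_add (hA a (Finset.mem_insert_self a f)) (Hom.sum f h1) hP, ih h1]

/-- The operator `∫ dt A(t) B(t) P(t)` as a double sum over modes. -/
theorem hasLS_cop_mul {A B : QRing hR} (hA : Hom p A) (hB : Hom r B) (hP : R.IsExt t P) :
    HasLS (fun x : ℤ × ℤ => A.fld (-x.1) * B.fld (-x.2) * P (x.1 + x.2)) (cop (A * B) P) := by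
  let e : ℤ × ℤ ≃ ℤ × ℤ :=
    { toFun := fun x => (x.1, x.1 + x.2)
      invFun := fun x => (x.1, x.2 - x.1)
      left_inv := fun x => by ext <;> simp
      right_inv := fun x => by ext <;> simp }
  have hin : ∀ l, HasLS (fun m : ℤ => A.fld (-m) * B.fld (m - l) * P l)
      ((A * B).fld (-l) * P l) := by
    intro l
    refine (((hasLS_mul A B (-l)).equiv (Equiv.subRight l)).comp (P l)).congr fun m => ?_
    rw [Equiv.subRight_apply]
    congr 3
    ring
  have hlf : LF fun x : ℤ × ℤ => A.fld (-x.1) * B.fld (x.1 - x.2) * P x.2 := by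
    refine LF.of_fibers (fun w => ?_) fun k => (hin k).1
    obtain ⟨K, hK⟩ := hP.trunc w
    obtain ⟨L, hL⟩ := trunc₂_of_mem hR A.2 B.2 w
    refine (Set.finite_Icc K (-L - L)).subset ?_
    rintro l ⟨m, hm⟩
    rw [Set.mem_Icc]
    refine ⟨?_, ?_⟩
    · by_contra h
      refine hm ?_
      rw [Module.End.mul_apply, hK l (by omega), map_zero]
    · by_contra h
      refine hm ?_
      have h1 := sbr_eq_zero_iff.1 (sbr_swap_zero (hP.comm hA l (-m)))
      have h2 := sbr_eq_zero_iff.1 (sbr_swap_zero (hP.comm hB l (m - l)))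
      dsimp only
      rw [mul_assoc, h2, mul_smul_comm, ← mul_assoc, h1]
      simp only [LinearMap.smul_apply, Module.End.mul_apply, smul_mul_assoc]
      rw [show A.fld (-m) (B.fld (m - l) w) = 0 from hL _ _ (by omega)]
      simp
  refine ((hlf.hasLS_of_inner_right hin (hasLS_cop (hA.mul hB) hP)).equiv e).congr fun x => ?_
  simp [e]

/-- Central terms live on the diagonal m + n = 0 of the double sum. There the coefficients have
opposite frequencies, so they add up to the zero mode of A B, that is, its mean over the circle. -/
theorem hasLS_diag (A B : QRing hR) :
    HasLS (fun x : ℤ × ℤ => if x.1 + x.2 = 0 then A.fld (-x.1) * B.fld (-x.2) else 0)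
      ((A * B).fld 0) := by
  let e : ℤ × ℤ ≃ ℤ × ℤ :=
    { toFun := fun x => (x.1, x.1 + x.2)
      invFun := fun x => (x.1, x.2 - x.1)
      left_inv := fun x => by ext <;> simp
      right_inv := fun x => by ext <;> simp }
  have h0 := hasLS_mul A B 0
  have hin : ∀ l : ℤ, HasLS (fun m : ℤ => if l = 0 then A.fld (-m) * B.fld m else 0)
      (if l = 0 then (A * B).fld 0 else 0) := by
    intro l
    split_ifs
    · simpa using h0
    · exact HasLS.zero
  have hlf : LF fun x : ℤ × ℤ => if x.2 = 0 then A.fld (-x.1) * B.fld x.1 else 0 := by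
    refine LF.of_fibers (fun w => (Set.finite_singleton 0).subset ?_) fun k => (hin k).1
    rintro l ⟨m, hm⟩
    by_contra h
    exact hm (by simp [show l ≠ 0 from h])
  have hout : HasLS (fun l : ℤ => if l = 0 then (A * B).fld 0 else 0) ((A * B).fld 0) := by
    simpa using HasLS.single (f := fun l : ℤ => if l = 0 then (A * B).fld 0 else 0) 0
      (fun _ hb => if_neg hb)
  refine ((hlf.hasLS_of_inner_right hin hout).equiv e).congr fun x => ?_
  simp only [e, Equiv.coe_fn_mk]
  split_ifs with h
  · rw [show -x.2 = x.1 by omega]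
  · rfl

theorem hasLS_sbr_cop {A B : QRing hR} (hA : Hom p A) (hB : Hom r B) (hP : R.IsExt t P)
    (hQ : R.IsExt u Q) :
    HasLS (fun x : ℤ × ℤ => sgn (t * r) •
      (A.fld (-x.1) * B.fld (-x.2) * SuperTraj.sbr (t * u) (P x.1) (Q x.2)))
      (SuperTraj.sbr ((p + t) * (r + u)) (cop A P) (cop B Q)) :=
  ((hasLS_cop hA hP).sbr (hasLS_cop hB hQ) ((p + t) * (r + u))).congr fun _ =>
    sbr_mul_mul (hA.sbr hB _ _) (hP.comm hB _ _) (hQ.comm hA _ _)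

theorem fld_d_neg (A : QRing hR) (m : ℤ) :
    (d hR A).fld (-m) = (Complex.I * m) • A.fld (-m) := by
  rw [fld_d_apply]; congr 1; push_cast; ring

/-- A factor m next to A_{-m}, or n next to B_{-n}, is a time derivative. Hence n - m gives A Ḃ - Ȧ
B, and the Virasoro cocycle m³ - m gives a multiple of the third derivative plus the first. -/
theorem sbr_cop_L_L {A B : QRing hR} (hA : Hom p A) (hB : Hom r B) :
    SuperTraj.sbr (p * r) (cop A fun n => Complex.I • R.L n) (cop B fun n => Complex.I • R.L n) =
      cop (A * d hR B - d hR A * B) (fun n => Complex.I • R.L n)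
        + (Complex.I * (c / 12)) • ((d hR (d hR (d hR A)) + d hR A) * B).fld 0 := by
  have hL := isExt_L hR
  have h := hasLS_sbr_cop hA hB hL hL
  simp only [add_zero, zero_mul, sgn_zero, one_smul] at h
  rw [cop_sub (hA.mul hB.d) (hA.d.mul hB) hL]
  refine h.unique ((((hasLS_cop_mul hA hB.d hL).sub (hasLS_cop_mul hA.d hB hL)).add
    ((hasLS_diag (d hR (d hR (d hR A)) + d hR A) B).smul (Complex.I * (c / 12)))).congr
    ?_)
  rintro ⟨m, n⟩
  have I2 : Complex.I * Complex.I = -1 := Complex.I_mul_I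
  simp only [sbr_smul_left, sbr_smul_right, hR.virkm.vir, fld_add, Pi.add_apply, fld_d_neg,
    smul_mul_assoc, mul_smul_comm, smul_smul, smul_sub, mul_sub, add_mul, mul_one]
  split_ifs with h0
  · match_scalars
    · linear_combination (-(n : ℂ) + m + (n - m)) * I2
    · have I4 : Complex.I ^ 4 = 1 := Complex.I_pow_four
      linear_combination (c / 12 * m ^ 3) * I4 + (c / 12 * m ^ 3) * I2
  · match_scalars
    · linear_combination (-(n : ℂ) + m + (n - m)) * I2
    · ring

/-- The bracket of L with T is n T_{m+n}, and n differentiates the coefficient of T. This is the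
reparametrization by A acting on B. -/
theorem sbr_cop_L_T {A B : QRing hR} (hA : Hom p A) (hB : Hom r B) (μ ν : Idx N M) :
    SuperTraj.sbr (p * (r + (deg μ + deg ν))) (cop A fun n => Complex.I • R.L n)
      (cop B (R.T μ ν)) = cop (A * d hR B) (R.T μ ν) := by
  have hL := isExt_L hR
  have hT := isExt_T hR μ ν
  have h := hasLS_sbr_cop hA hB hL hT
  simp only [add_zero, zero_mul, sgn_zero, one_smul] at h
  refine h.unique ((hasLS_cop_mul hA hB.d hT).congr fun x => ?_)
  simp only [sbr_smul_left, hR.virkm.compat, fld_d_neg, smul_mul_assoc, mul_smul_comm, smul_smul]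

/-- The central term of the current algebra is linear in the frequency m, hence it differentiates
the first coefficient once. -/
theorem sbr_cop_T_T {A B : QRing hR} (hA : Hom p A) (hB : Hom r B) (μ ν σ τ : Idx N M) :
    SuperTraj.sbr ((p + (deg μ + deg ν)) * (r + (deg σ + deg τ))) (cop A (R.T μ ν))
      (cop B (R.T σ τ)) = sgn ((deg μ + deg ν) * r) •
        ((if σ = ν then cop (A * B) (R.T μ τ) else 0)
          - sgn ((deg μ + deg ν) * (deg σ + deg τ)) •
            (if μ = τ then cop (A * B) (R.T σ ν) else 0)
          - (Complex.I * ((if μ = τ ∧ σ = ν then k₁ * sgn (deg μ) else 0)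
            + (if μ = ν ∧ σ = τ then k₂ * sgn (deg μ + deg σ) else 0))) •
              (d hR A * B).fld 0) := by
  have h := hasLS_sbr_cop hA hB (isExt_T hR μ ν) (isExt_T hR σ τ)
  have h1 := hasLS_cop_mul hA hB (isExt_T hR μ τ)
  have h2 := hasLS_cop_mul hA hB (isExt_T hR σ ν)
  set κ := (if μ = τ ∧ σ = ν then k₁ * sgn (deg μ) else 0)
            + (if μ = ν ∧ σ = τ then k₂ * sgn (deg μ + deg σ) else 0) with hκ
  have h1' : HasLS (fun x : ℤ × ℤ => if σ = ν then
      A.fld (-x.1) * B.fld (-x.2) * R.T μ τ (x.1 + x.2) else 0)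
      (if σ = ν then cop (A * B) (R.T μ τ) else 0) := by
    split_ifs
    · exact h1
    · exact HasLS.zero
  have h2' : HasLS (fun x : ℤ × ℤ => if μ = τ then
      A.fld (-x.1) * B.fld (-x.2) * R.T σ ν (x.1 + x.2) else 0)
      (if μ = τ then cop (A * B) (R.T σ ν) else 0) := by
    split_ifs
    · exact h2
    · exact HasLS.zero
  refine h.unique ((((h1'.sub (h2'.smul _)).sub
    ((hasLS_diag (d hR A) B).smul (Complex.I * κ))).smul _).congr ?_)
  rintro ⟨m, n⟩
  have I2 : Complex.I * Complex.I = -1 := Complex.I_mul_I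
  rw [hR.virkm.km, ← hκ]
  congr 1
  dsimp only
  rw [mul_add (A.fld (-m) * B.fld (-n)), mul_sub (A.fld (-m) * B.fld (-n)),
    sub_eq_add_neg _ ((Complex.I * κ) • _)]
  congr 1
  · congr 1
    · split_ifs <;> simp
    · rw [mul_smul_comm]; split_ifs <;> simp
  · split_ifs with h0
    · rw [fld_d_neg, smul_mul_assoc, smul_smul, mul_smul_comm, mul_one, ← neg_smul]
      congr 1
      linear_combination (-κ * m) * I2
    · simp

theorem sbr_cop_of_action {D : Module.End ℂ W} {B B' : QRing hR} (hB : Hom r B)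
    (hB' : Hom (p + r) B') (hQ : R.IsExt u Q) (hD : ∀ n, SuperTraj.sbr (p * r) D (B.fld n) = B'.fld n)
    (hDQ : ∀ n, SuperTraj.sbr (p * u) D (Q n) = 0) :
    SuperTraj.sbr (p * (r + u)) D (cop B Q) = cop B' Q := by
  refine ((hasLS_cop hB hQ).sbr_right _ D).unique ((hasLS_cop hB' hQ).congr fun n => ?_)
  rw [mul_add, sbr_mul_right, hD, hDQ]; simp

theorem sbr_cop_eq_zero {A : QRing hR} (hA : Hom p A) (hP : R.IsExt t P) {X : Module.End ℂ W}
    (h1 : ∀ n, SuperTraj.sbr (p * s) (A.fld n) X = 0) (h2 : ∀ n, SuperTraj.sbr (t * s) (P n) X = 0) :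
    SuperTraj.sbr ((p + t) * s) (cop A P) X = 0 := by
  refine ((hasLS_cop hA hP).sbr_left _ X).unique (HasLS.zero.congr fun n => ?_)
  rw [show (p + t) * s = t * s + p * s by ring, sbr_mul_left, h1, h2]; simp

end QRing

end TrajOps

end SuperTraj

namespace SuperTraj

namespace TrajOps

variable {N M : ℕ} {W : Type*} [AddCommGroup W] [Module ℂ W] {R : TrajOps N M W}
  {p r s t u : ZMod 2} {c k₁ k₂ : ℂ}

namespace QRing

variable {hR : R.IsRep c k₁ k₂} {ξ η : VF N M}

/-! ### The generators -/

/-- The field `ξ̃^i`. -/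
def tld (hR : R.IsRep c k₁ k₂) (ξ : VF N M) (i : SIdx N M) : QRing hR :=
  ev hR (ξ (some i)) - ev hR (ξ none) * qd hR (some i)

theorem fld_tld (ξ : VF N M) (i : SIdx N M) : (tld hR ξ i).fld = R.xiTilde ξ i := by
  rw [tld, fld_sub, fld_mul, fld_ev, fld_ev, fld_qd]; rfl

theorem hom_ev_none (hξ : ξ.IsHomog p) : Hom p (ev hR (ξ none)) :=
  hom_ev ((hξ none).cast (add_zero p))

theorem hom_ev_some (hξ : ξ.IsHomog p) (i : SIdx N M) : Hom (p + sdeg i) (ev hR (ξ (some i))) :=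
  hom_ev (hξ (some i))

theorem hom_ev_pd (hξ : ξ.IsHomog p) (ν μ : Idx N M) :
    Hom (p + deg μ + deg ν) (ev hR (pd ν (ξ μ))) := hom_ev ((hξ μ).pd ν)

theorem hom_tld (hξ : ξ.IsHomog p) (i : SIdx N M) : Hom (p + sdeg i) (tld hR ξ i) :=
  (hom_ev_some hξ i).sub ((hom_ev_none hξ).mul (hom_qd (some i)))

/-- The part of the generator that is linear in `T`. -/
def topp (hR : R.IsRep c k₁ k₂) (p : ZMod 2) (ξ : VF N M) : Module.End ℂ W :=
  ∑ μ, ∑ ν, sgn ((p + deg μ) * deg ν + deg μ) • cop (ev hR (pd ν (ξ μ))) (R.T ν μ)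

/-- The part of the generator that is linear in `L`. -/
def lop (hR : R.IsRep c k₁ k₂) (ξ : VF N M) : Module.End ℂ W :=
  cop (ev hR (ξ none)) fun n => Complex.I • R.L n

theorem gen_eq (hR : R.IsRep c k₁ k₂) (p : ZMod 2) (ξ : VF N M) :
    R.gen p ξ = dop p (tld hR ξ) + lop hR ξ + topp hR p ξ := by
  have hsq : ∀ a : ZMod 2, a * a = a := by decide
  unfold gen dop lop topp
  congr 1
  · congr 1
    · refine Finset.sum_congr rfl fun i _ => ?_
      rw [pop, fld_tld, add_mul, hsq]
    · rw [cop, fld_ev]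
      congr 2
      funext n
      rw [LField, smul_smul]
      congr 1
      ring
  · refine Finset.sum_congr rfl fun μ _ => Finset.sum_congr rfl fun ν _ => ?_
    rw [cop, fld_ev]; rfl

/-! ### The action of the momentum -/

/-- The mode p_{i,n} sends q^j(t) to δ^j_i e^{int}, so it acts on functions of the trajectory as
e^{int}∂_i. -/
theorem sbr_p_ev {f : STFun N M} (hf : HasParity p f) (i : SIdx N M) (n k : ℤ) :
    sbr (sdeg i * p) (R.p i n) ((ev hR f).fld k) = (E hR n * ev hR (pd (some i) f)).fld k := by
  have h := sbr_fld_ev (hR := hR) (X := R.p i n) (s := sdeg i)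
    (Y := fun j => if j = i then E hR n else 0) (fun j m => ?_) (fun j => ?_) hf k
  · rw [h]
    simp
  · rw [hR.pq]
    by_cases h : j = i
    · simp only [h, true_and, if_true, fld_E, fexp]
      congr 1
      exact propext ⟨fun h => by omega, fun h => by omega⟩
    · simp [h]
  · split_ifs with h
    · rw [h, zmod_two_add_self]; exact hom_E n
    · exact Hom.zero

theorem sbr_p_qd (i j : SIdx N M) (n k : ℤ) :
    sbr (sdeg i * sdeg j) (R.p i n) ((qd hR (some j)).fld k) =
      (if i = j then (Complex.I * n) • E hR n else 0 : QRing hR).fld k := by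
  have h := sbr_fld_d (hR := hR) (X := R.p i n) (s := sdeg i) (p := sdeg j)
    (A := qv hR j) (A' := if i = j then E hR n else 0) (fun m => ?_) k
  · rw [qd, h]
    split_ifs
    · rw [d_E]
    · rw [map_zero]
  · rw [fld_qv, hR.pq]
    by_cases h : i = j
    · simp only [h, true_and, if_true, fld_E, fexp]
      congr 1
      exact propext ⟨fun h => by omega, fun h => by omega⟩
    · simp [h, Ne.symm h]

/-- The derivative of `ξ̃^j` with respect to `q^i`. -/
def jac (hR : R.IsRep c k₁ k₂) (ξ : VF N M) (i j : SIdx N M) : QRing hR :=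
  ev hR (pd (some i) (ξ (some j))) - ev hR (pd (some i) (ξ none)) * qd hR (some j)

/-- Minus the derivative of `ξ̃^j` with respect to `q̇^i`. -/
def jacd (hR : R.IsRep c k₁ k₂) (p : ZMod 2) (ξ : VF N M) (i j : SIdx N M) : QRing hR :=
  if i = j then sgn (p * sdeg i) • ev hR (ξ none) else 0

theorem hom_jac (hξ : ξ.IsHomog p) (i j : SIdx N M) :
    Hom (p + sdeg j + sdeg i) (jac hR ξ i j) := by
  refine (hom_ev_pd hξ (some i) (some j)).sub ?_
  refine ((hom_ev_pd hξ (some i) none).mul (hom_qd (some j))).cast ?_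
  simp only [deg]; ring

theorem hom_jacd (hξ : ξ.IsHomog p) (i j : SIdx N M) :
    Hom (p + sdeg j + sdeg i) (jacd hR p ξ i j) := by
  unfold jacd
  split_ifs with h
  · subst h
    rw [add_assoc, zmod_two_add_self, add_zero]
    exact (hom_ev_none hξ).smul _
  · exact Hom.zero

/-- Besides q, the field ξ̃^j contains a velocity only in -ξ^0 q̇^j. The action of p_{i,n} is
therefore e^{int} times an expression of degree one in n, the form required by
`hasLS_double_contraction`; its linear part is diagonal in i, j. -/
theorem sbr_p_tld (hξ : ξ.IsHomog p) (i j : SIdx N M) (n k : ℤ) :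
    sbr (sdeg i * (p + sdeg j)) (R.p i n) ((tld hR ξ j).fld k) =
      (jac hR ξ i j).fld (n + k) - (Complex.I * n) • (jacd hR p ξ i j).fld (n + k) := by
  have h1 := sbr_p_ev (hR := hR) (hξ (some j)) i n k
  have h2 := sbr_fld_mul (hR := hR) (X := R.p i n) (s := sdeg i) (p := p) (r := sdeg j)
    (A := ev hR (ξ none)) (B := qd hR (some j))
    (fun m => by
      have := sbr_p_ev (hR := hR) (hξ none) i n m
      rwa [show p + deg (none : Idx N M) = p from add_zero p] at this)
    (fun m => sbr_p_qd i j n m) k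
  have h3 : (E hR n * ev hR (pd (some i) (ξ none)) * qd hR (some j) +
      sgn (sdeg i * p) • (ev hR (ξ none) * if i = j then (Complex.I * n) • E hR n else 0)) =
      E hR n * (ev hR (pd (some i) (ξ none)) * qd hR (some j) +
        (Complex.I * n) • jacd hR p ξ i j) := by
    rw [mul_add, mul_assoc, jacd]
    congr 1
    split_ifs
    · rw [mul_smul_comm, mul_smul_comm, mul_smul_comm, smul_comm, mul_comm (sdeg i),
        (hom_E n).comm_of_even (hom_ev_none hξ)]
    · simp
  rw [h3, fld_E_mul] at h2
  rw [fld_E_mul] at h1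
  rw [tld, fld_sub, Pi.sub_apply, sub_eq_add_neg, ← neg_one_smul ℂ, sbr_add_right, sbr_smul_right,
    h2]
  rw [show p + sdeg j = p + deg (some j) from rfl, h1, add_comm k, jac, fld_add, fld_sub]
  simp only [Pi.add_apply, Pi.sub_apply, fld_smul, Pi.smul_apply]
  module

/-! ### Vector fields acting on functions -/

/-- The value of `ξ^μ ∂_μ f` on the trajectory. -/
def vact (hR : R.IsRep c k₁ k₂) (ξ : VF N M) (f : STFun N M) : QRing hR :=
  ∑ μ, ev hR (ξ μ) * ev hR (pd μ f)

theorem hom_vact (hξ : ξ.IsHomog p) {f : STFun N M} (hf : HasParity r f) :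
    Hom (p + r) (vact hR ξ f) := by
  refine Hom.sum _ fun μ _ => ((hom_ev (hξ μ)).mul (hom_ev (hf.pd μ))).cast ?_
  have : ∀ a b d : ZMod 2, a + d + (b + d) = a + b := by decide
  exact this _ _ _

/-- The sum over spatial indices lacks ξ^0∂_0 f, and q̇^i∂_i f lacks the explicit time derivative
∂_0 f; multiplied by ξ^0, the two omissions cancel. -/
theorem sum_tld_mul (ξ : VF N M) (f : STFun N M) :
    ∑ i, tld hR ξ i * ev hR (pd (some i) f) =
      vact hR ξ f - ev hR (ξ none) * d hR (ev hR f) := by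
  rw [d_ev, vact, Fintype.sum_option, Fintype.sum_option, qd, one_mul, mul_add, Finset.mul_sum]
  simp only [tld, sub_mul, Finset.sum_sub_distrib, mul_assoc]
  abel

/-- The p-part alone represents ξ only up to the reparametrization -ξ^0 d/dt, because it moves the
trajectory at fixed time. The L-part compensates for this wherever f(q) multiplies T. -/
theorem sbr_dop_ev (hξ : ξ.IsHomog p) {f : STFun N M} (hf : HasParity r f) (n : ℤ) :
    sbr (p * r) (dop p (tld hR ξ)) ((ev hR f).fld n) =
      (vact hR ξ f - ev hR (ξ none) * d hR (ev hR f)).fld n := by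
  rw [sbr_fld_ev (fun i n => sbr_dop_q (hom_tld hξ) i n) (fun i => hom_tld hξ i) hf, sum_tld_mul]

theorem ev_bracket (ξ η : VF N M) (ν : Idx N M) :
    ev hR (VF.bracket p r ξ η ν) = vact hR ξ (η ν) - sgn (p * r) • vact hR η (ξ ν) := by
  simp only [VF.bracket, vact, map_sum, map_sub, map_smul, ev_mul, Finset.sum_sub_distrib,
    Finset.smul_sum]

/-- The Leibniz rule splits the Jacobian of a bracket into a commutator of Jacobians, to be matched
with the brackets of T, and the transport of each Jacobian along the other field, to be matched with
the mixed brackets. -/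
theorem ev_pd_bracket (hξ : ξ.IsHomog p) (hη : η.IsHomog r) (ν μ : Idx N M) :
    ev hR (pd ν (VF.bracket p r ξ η μ)) =
      ((∑ ρ, ev hR (pd ν (ξ ρ)) * ev hR (pd ρ (η μ)))
        - sgn (p * r) • ∑ ρ, ev hR (pd ν (η ρ)) * ev hR (pd ρ (ξ μ)))
      + (sgn (p * deg ν) • vact hR ξ (pd ν (η μ))
        - (sgn (p * r) * sgn (r * deg ν)) • vact hR η (pd ν (ξ μ))) := by
  have aux : ∀ {p : ZMod 2} {ξ : VF N M} (hξ : ξ.IsHomog p) (f : STFun N M),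
      ev hR (pd ν (∑ ρ, (ξ ρ).mul (pd ρ f))) =
        (∑ ρ, ev hR (pd ν (ξ ρ)) * ev hR (pd ρ f)) + sgn (p * deg ν) • vact hR ξ (pd ν f) := by
    intro p ξ hξ f
    rw [vact, Finset.smul_sum, ← Finset.sum_add_distrib, map_sum, map_sum]
    refine Finset.sum_congr rfl fun ρ _ => ?_
    rw [STFun.pd_mul (hξ ρ), map_add, map_smul, ev_mul, ev_mul, STFun.pd_pd ν ρ, map_smul,
      mul_smul_comm, smul_smul]
    congr 2
    rw [← sgn_add]
    congr 1
    have : ∀ a b c : ZMod 2, a * (b + c) + a * c = b * a := by decide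
    exact this _ _ _
  have hb : VF.bracket p r ξ η μ =
      (∑ ρ, (ξ ρ).mul (pd ρ (η μ))) - sgn (p * r) • ∑ ρ, (η ρ).mul (pd ρ (ξ μ)) := by
    simp only [VF.bracket, Finset.sum_sub_distrib, Finset.smul_sum]
  rw [hb, map_sub, map_sub, map_smul, map_smul, aux hξ, aux hη, smul_add, smul_smul]
  abel

/-! ### Brackets of the parts of the generators -/

/-- The single contractions rebuild the field of [ξ,η]. The terms where ξ^0 or η^0 multiplies a time
derivative of a component, and those with q̈^i, cancel by graded antisymmetry. -/
theorem sbr_dop_dop_tld (hξ : ξ.IsHomog p) (hη : η.IsHomog r) :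
    sbr (p * r) (dop p (tld hR ξ)) (dop r (tld hR η)) =
      dop (p + r) (tld hR (VF.bracket p r ξ η))
        + ∑ i, ∑ j, sgn ((p + r + sdeg i) * sdeg i) •
          (contr (jac hR ξ i j) (jac hR η j i) (jacd hR p ξ i j) (jacd hR r η j i)).fld 0 := by
  have hJ : ∀ {p : ZMod 2} {ξ η : VF N M} (i : SIdx N M),
      ∑ j, d hR (tld hR ξ j) * jacd hR p η j i =
        sgn (p * sdeg i) • (d hR (tld hR ξ i) * ev hR (η none)) := by
    intro p ξ η i
    simp [jacd, mul_ite]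
  rw [sbr_dop_dop (fun j => hom_tld hξ j) (fun i => hom_tld hη i) (fun i j => hom_jac hξ i j)
    (fun i j => hom_jac hη i j) (fun i j => hom_jacd hξ i j) (fun i j => hom_jacd hη i j)
    (fun i j n k => sbr_p_tld hξ i j n k) (fun i j n k => sbr_p_tld hη i j n k)
    (fun j => hJ j) (fun i => hJ i), ← dop_sub_smul]
  congr 2
  funext i
  have hsum : ∀ (ξ η : VF N M), ∑ j, tld hR ξ j * jac hR η j i =
      (vact hR ξ (η (some i)) - ev hR (ξ none) * d hR (ev hR (η (some i))))
        - (vact hR ξ (η none) - ev hR (ξ none) * d hR (ev hR (η none))) * qd hR (some i) := by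
    intro ξ η
    rw [← sum_tld_mul, ← sum_tld_mul, Finset.sum_mul, ← Finset.sum_sub_distrib]
    refine Finset.sum_congr rfl fun j _ => ?_
    rw [jac, mul_sub, mul_assoc]
  have hd : ∀ {p r : ZMod 2} {ξ η : VF N M}, ξ.IsHomog p → η.IsHomog r →
      sgn (r * sdeg i) • (d hR (tld hR ξ i) * ev hR (η none)) =
      sgn (p * r) • (ev hR (η none) * d hR (tld hR ξ i)) := by
    intro p r ξ η hξ hη
    rw [(hom_tld hξ i).d.comm (hom_ev_none hη), smul_smul, ← sgn_add]
    congr 2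
    have : ∀ a b c : ZMod 2, b * c + (a + c) * b = a * b := by decide
    exact this _ _ _
  rw [hsum, hsum, hd hξ hη, hd hη hξ, tld, tld, tld, ev_bracket, ev_bracket, mul_comm r p]
  have hxy := (hom_ev_none (hR := hR) hξ).comm (hom_ev_none hη)
  simp only [map_sub, d_mul, sub_mul, mul_sub, smul_sub, mul_add, smul_add, smul_mul_assoc,
    sgn_cancel]
  simp only [← mul_assoc, hxy, smul_mul_assoc]
  abel

theorem sbr_dop_lop (hξ : ξ.IsHomog p) (hη : η.IsHomog r) :
    sbr (p * r) (dop p (tld hR ξ)) (lop hR η) =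
      cop (vact hR ξ (η none) - ev hR (ξ none) * d hR (ev hR (η none)))
        fun n => Complex.I • R.L n := by
  have hη0 : HasParity r (η none) := (hη none).cast (add_zero r)
  have h := sbr_cop_of_action (hR := hR) (p := p) (r := r) (u := 0)
    (D := dop p (tld hR ξ)) (hom_ev hη0)
    ((hom_vact hξ hη0).sub ((hom_ev_none hξ).mul (hom_ev_none hη).d)) (isExt_L hR)
    (sbr_dop_ev hξ hη0)
    (fun n => sbr_dop_eq_zero (hom_tld hξ) ((isExt_L hR).q n) ((isExt_L hR).p n))
  rwa [add_zero] at h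

theorem sbr_lop_dop (hξ : ξ.IsHomog p) (hη : η.IsHomog r) :
    sbr (p * r) (lop hR ξ) (dop r (tld hR η)) =
      -(sgn (p * r) • cop (vact hR η (ξ none) - ev hR (η none) * d hR (ev hR (ξ none)))
        fun n => Complex.I • R.L n) := by
  rw [sbr_swap, mul_comm, sbr_dop_lop hη hξ]

theorem sbr_lop_lop (hξ : ξ.IsHomog p) (hη : η.IsHomog r) :
    sbr (p * r) (lop hR ξ) (lop hR η) =
      cop (ev hR (ξ none) * d hR (ev hR (η none)) - d hR (ev hR (ξ none)) * ev hR (η none))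
        (fun n => Complex.I • R.L n)
      + (Complex.I * (c / 12)) •
        ((d hR (d hR (d hR (ev hR (ξ none)))) + d hR (ev hR (ξ none))) * ev hR (η none)).fld 0 :=
  sbr_cop_L_L (hom_ev_none hξ) (hom_ev_none hη)

/-- The corrections -ξ^0 η̇^0 and its mirror image, left by the two brackets of p-parts with
L-parts, are cancelled by the Witt bracket ξ^0 η̇^0 - ξ̇^0 η^0 of the L-parts. -/
theorem lop_bracket (hξ : ξ.IsHomog p) (hη : η.IsHomog r) :
    lop hR (VF.bracket p r ξ η) =
      cop (vact hR ξ (η none) - ev hR (ξ none) * d hR (ev hR (η none)))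
        (fun n => Complex.I • R.L n)
      - sgn (p * r) • cop (vact hR η (ξ none) - ev hR (η none) * d hR (ev hR (ξ none)))
        (fun n => Complex.I • R.L n)
      + cop (ev hR (ξ none) * d hR (ev hR (η none)) - d hR (ev hR (ξ none)) * ev hR (η none))
        (fun n => Complex.I • R.L n) := by
  have hξ0 : HasParity p (ξ none) := (hξ none).cast (add_zero p)
  have hη0 : HasParity r (η none) := (hη none).cast (add_zero r)
  have h1 := (hom_vact (hR := hR) hξ hη0).sub ((hom_ev_none hξ).mul (hom_ev_none hη).d)
  have h2 := ((hom_vact (hR := hR) hη hξ0).sub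
    ((hom_ev_none hη).mul (hom_ev_none hξ).d)).cast (add_comm r p)
  have h3 := ((hom_ev_none (hR := hR) hξ).mul (hom_ev_none hη).d).sub
    ((hom_ev_none hξ).d.mul (hom_ev_none hη))
  have hL := isExt_L hR
  rw [← cop_smul h2 hL, ← cop_sub h1 (h2.smul _) hL, ← cop_add (h1.sub (h2.smul _)) h3 hL, lop,
    ev_bracket, (hom_ev_none (hR := hR) hξ).d.comm (hom_ev_none hη)]
  congr 1
  simp only [smul_sub]
  abel

/-- The p-part acts on the coefficient of T with the error -ξ^0 d/dt and the L-part acts on it as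
+ξ^0 d/dt, so that together they transport it along ξ exactly. -/
theorem sbr_dop_lop_topp (hξ : ξ.IsHomog p) (hη : η.IsHomog r) :
    sbr (p * r) (dop p (tld hR ξ)) (topp hR r η) + sbr (p * r) (lop hR ξ) (topp hR r η) =
      ∑ μ, ∑ ν, sgn ((r + deg μ) * deg ν + deg μ) • cop (vact hR ξ (pd ν (η μ))) (R.T ν μ) := by
  rw [topp]
  simp only [sbr_sum_right, sbr_smul_right]
  simp only [← Finset.sum_add_distrib]
  refine Finset.sum_congr rfl fun μ _ => Finset.sum_congr rfl fun ν _ => ?_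
  rw [← smul_add]
  congr 1
  have hf := (hη μ).pd ν
  have hT := isExt_T hR ν μ
  have hr : r + deg μ + deg ν + (deg ν + deg μ) = r := by
    have : ∀ a b c : ZMod 2, a + b + c + (c + b) = a := by decide
    exact this _ _ _
  have h0 := (hom_ev_none (hR := hR) hξ).mul (hom_ev (hR := hR) hf).d
  have h1 := sbr_cop_of_action (hR := hR) (p := p) (D := dop p (tld hR ξ)) (hom_ev hf)
    ((hom_vact hξ hf).sub h0) hT (sbr_dop_ev hξ hf)
    (fun n => sbr_dop_eq_zero (hom_tld hξ) (hT.q n) (hT.p n))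
  have h2 := sbr_cop_L_T (hom_ev_none (hR := hR) hξ) (hom_ev (hR := hR) hf) ν μ
  rw [hr] at h1 h2
  rw [h1, lop, h2, ← cop_add ((hom_vact hξ hf).sub h0) h0 hT, sub_add_cancel]

end QRing

end TrajOps

end SuperTraj

namespace SuperTraj

/-! ### Brackets of the currents T and assembly of the bracket of generators -/

namespace TrajOps

variable {N M : ℕ} {W : Type*} [AddCommGroup W] [Module ℂ W] {R : TrajOps N M W}
  {p r s t u : ZMod 2} {c k₁ k₂ : ℂ}

namespace QRing

variable {hR : R.IsRep c k₁ k₂} {ξ η : VF N M}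

/-- This isolates the sign bookkeeping. The two matrix products and the central term each carry a
Koszul sign, and equality of the signs is an identity in `ZMod 2` between polynomials in the
parities. -/
theorem sbr_topp_topp_term (hξ : ξ.IsHomog p) (hη : η.IsHomog r) (μ ν σ τ : Idx N M) :
    sgn ((r + deg σ) * deg τ + deg σ) • sgn ((p + deg μ) * deg ν + deg μ) •
      sbr (p * r) (cop (ev hR (pd ν (ξ μ))) (R.T ν μ)) (cop (ev hR (pd τ (η σ))) (R.T τ σ)) =
    (if τ = μ then sgn ((p + r + deg σ) * deg ν + deg σ) •
      cop (ev hR (pd ν (ξ μ)) * ev hR (pd μ (η σ))) (R.T ν σ) else 0)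
    - (if σ = ν then sgn (p * r) • sgn ((p + r + deg μ) * deg τ + deg μ) •
      cop (ev hR (pd τ (η ν)) * ev hR (pd ν (ξ μ))) (R.T τ μ) else 0)
    - Complex.I • (k₁ • (if σ = ν then if τ = μ then sgn ((p + r + deg ν) * deg ν) •
        (d hR (ev hR (pd ν (ξ μ))) * ev hR (pd μ (η ν))).fld 0 else 0 else 0)
      + k₂ • (if ν = μ then if τ = σ then (sgn (p * deg μ + deg μ) * sgn (r * deg σ + deg σ)) •
        (d hR (ev hR (pd μ (ξ μ))) * ev hR (pd σ (η σ))).fld 0 else 0 else 0)) := by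
  have hA := hom_ev_pd (hR := hR) hξ ν μ
  have hB := hom_ev_pd (hR := hR) hη τ σ
  have h := sbr_cop_T_T hA hB ν μ τ σ
  have e : ∀ a b d : ZMod 2, a + b + d + (d + b) = a := by decide
  rw [e, e] at h
  rw [h, smul_smul, smul_smul, smul_sub, smul_sub]
  refine congrArg₂ _ (congrArg₂ _ ?_ ?_) ?_
  · split_ifs with h1
    · subst h1
      simp only [← sgn_add]
      congr 2
      have : ∀ p r a b f : ZMod 2,
        (r + f) * b + f + ((p + b) * a + b) + (a + b) * (r + f + b) = (p + r + f) * a + f := by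
        decide
      exact this _ _ _ _ _
    · simp
  · split_ifs with h1 h2 h2
    · subst h1
      rw [hA.comm hB, cop_smul (hB.mul hA) (isExt_T hR τ μ)]
      simp only [smul_smul, ← sgn_add]
      congr 2
      have : ∀ p r a b f : ZMod 2,
        (r + a) * f + a + ((p + b) * a + b) + (a + b) * (r + a + f) +
          ((a + b) * (f + a) + (p + b + a) * (r + a + f)) = p * r + ((p + r + b) * f + b) := by
        decide
      exact this _ _ _ _ _
    · exact absurd h1.symm h2
    · exact absurd h2.symm h1
    · simp
  · rw [smul_smul, mul_left_comm, ← smul_smul, mul_add, add_smul]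
    congr 2
    · rw [← ite_and]
      by_cases h1 : σ = ν ∧ τ = μ
      · obtain ⟨rfl, rfl⟩ := h1
        simp only [and_self, if_true, smul_smul]
        rw [mul_comm k₁, ← mul_assoc, mul_comm k₁]
        simp only [← sgn_add]
        congr 3
        have : ∀ p r a b : ZMod 2, (r + a) * b + a + ((p + b) * a + b) + (a + b) * (r + a + b) + a
          = (p + r + a) * a := by decide
        exact this _ _ _ _
      · rw [if_neg h1, if_neg (fun h => h1 ⟨h.1.symm, h.2⟩)]; simp
    · rw [← ite_and]
      by_cases h1 : ν = μ ∧ τ = σ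
      · obtain ⟨rfl, rfl⟩ := h1
        simp only [and_self, if_true, smul_smul]
        rw [mul_comm k₂, ← mul_assoc, mul_comm k₂]
        simp only [← sgn_add]
        congr 3
        have : ∀ p r a b : ZMod 2, (r + b) * b + b + ((p + a) * a + a) + (a + a) * (r + b + b) +
          (a + b) = p * a + a + (r * b + b) := by decide
        exact this _ _ _ _
      · rw [if_neg h1, if_neg h1]; simp

/-- The coefficients are the Jacobian matrices of ξ and η contracted with currents of gl(N+1|M), so
the bracket is the graded commutator of these matrices. Of the central terms, k₁ multiplies a
supertrace of a product and k₂ a product of supertraces, i.e. of divergences. -/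
theorem sbr_topp_topp (hξ : ξ.IsHomog p) (hη : η.IsHomog r) :
    sbr (p * r) (topp hR p ξ) (topp hR r η) =
      ((∑ μ, ∑ ν, sgn ((p + r + deg μ) * deg ν + deg μ) •
          cop (∑ ρ, ev hR (pd ν (ξ ρ)) * ev hR (pd ρ (η μ))) (R.T ν μ))
        - sgn (p * r) • ∑ μ, ∑ ν, sgn ((p + r + deg μ) * deg ν + deg μ) •
          cop (∑ ρ, ev hR (pd ν (η ρ)) * ev hR (pd ρ (ξ μ))) (R.T ν μ))
      - Complex.I • (k₁ • (∑ μ, ∑ ν, sgn ((p + r + deg ν) * deg ν) •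
          (d hR (ev hR (pd ν (ξ μ))) * ev hR (pd μ (η ν))).fld 0)
        + k₂ • (d hR (ev hR (ξ.div p)) * ev hR (η.div r)).fld 0) := by
  have hc : ∀ {p r : ZMod 2} {ξ η : VF N M}, ξ.IsHomog p → η.IsHomog r → ∀ μ ν,
      cop (∑ ρ, ev hR (pd ν (ξ ρ)) * ev hR (pd ρ (η μ))) (R.T ν μ) =
        ∑ ρ, cop (ev hR (pd ν (ξ ρ)) * ev hR (pd ρ (η μ))) (R.T ν μ) := by
    intro p r ξ η hξ hη μ ν
    refine cop_sum (p := p + deg ν + (r + deg μ)) _ (fun ρ _ => ?_) (isExt_T hR ν μ)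
    refine ((hom_ev_pd hξ ν ρ).mul (hom_ev_pd hη ρ μ)).cast ?_
    have : ∀ a b d e f : ZMod 2, a + f + d + (b + e + f) = a + d + (b + e) := by decide
    exact this _ _ _ _ _
  simp only [hc hξ hη, hc hη hξ]
  simp only [topp, sbr_sum_left, sbr_sum_right, sbr_smul_left, sbr_smul_right]
  have hdiv : (d hR (ev hR (ξ.div p)) * ev hR (η.div r)).fld 0 = ∑ μ, ∑ σ,
      (sgn (p * deg μ + deg μ) * sgn (r * deg σ + deg σ)) •
        (d hR (ev hR (pd μ (ξ μ))) * ev hR (pd σ (η σ))).fld 0 := by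
    simp only [VF.div, map_sum, map_smul, Finset.sum_mul, Finset.mul_sum, smul_mul_assoc,
      mul_smul_comm, fld_sum, fld_smul, Finset.sum_apply, Pi.smul_apply]
    rw [Finset.sum_comm]
    refine Finset.sum_congr rfl fun μ _ => ?_
    simp only [Finset.smul_sum, smul_smul]
    exact Finset.sum_congr rfl fun σ _ => by rw [mul_comm]
  rw [hdiv]
  simp only [Finset.smul_sum, sbr_topp_topp_term hξ hη, Finset.sum_sub_distrib,
    Finset.sum_add_distrib, smul_add]
  have hb : ∀ G : Idx N M → Idx N M → Idx N M → Module.End ℂ W,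
      ∑ σ, ∑ τ, ∑ μ, ∑ ν, (if σ = ν then G μ τ ν else 0) = ∑ μ, ∑ τ, ∑ ν, G μ τ ν := by
    intro G
    simp only [Finset.sum_ite_eq, Finset.mem_univ, if_true]
    rw [Finset.sum_comm]
    exact (Finset.sum_congr rfl fun τ _ => Finset.sum_comm).trans Finset.sum_comm
  refine congrArg₂ _ (congrArg₂ _ ?_ ?_) (congrArg₂ _ ?_ ?_)
  · refine Finset.sum_congr rfl fun σ _ => ?_
    simp only [Finset.sum_ite_irrel, Finset.sum_const_zero, Finset.sum_ite_eq, Finset.mem_univ,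
      if_true]
    exact Finset.sum_comm
  · exact hb _
  · simp only [← Finset.smul_sum (r := k₁), ← Finset.smul_sum (r := Complex.I), Finset.sum_ite_eq,
      Finset.mem_univ, if_true]
    rw [Finset.sum_comm]
  · simp only [Finset.sum_ite_eq', Finset.mem_univ, if_true,
      smul_ite, smul_zero, Finset.sum_ite_irrel, Finset.sum_const_zero]
    exact Finset.sum_comm

/-- By `ev_pd_bracket`: the first difference is what the currents T produce among themselves, the
second what the p- and L-parts produce by transport. The signs arise from moving ∂_ν past a vector
field. -/
theorem topp_bracket (hξ : ξ.IsHomog p) (hη : η.IsHomog r) :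
    topp hR (p + r) (VF.bracket p r ξ η) =
      ((∑ μ, ∑ ν, sgn ((p + r + deg μ) * deg ν + deg μ) •
          cop (∑ ρ, ev hR (pd ν (ξ ρ)) * ev hR (pd ρ (η μ))) (R.T ν μ))
        - sgn (p * r) • ∑ μ, ∑ ν, sgn ((p + r + deg μ) * deg ν + deg μ) •
          cop (∑ ρ, ev hR (pd ν (η ρ)) * ev hR (pd ρ (ξ μ))) (R.T ν μ))
      + ((∑ μ, ∑ ν, sgn ((r + deg μ) * deg ν + deg μ) • cop (vact hR ξ (pd ν (η μ))) (R.T ν μ))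
        - sgn (p * r) • ∑ μ, ∑ ν, sgn ((p + deg μ) * deg ν + deg μ) •
          cop (vact hR η (pd ν (ξ μ))) (R.T ν μ)) := by
  rw [topp]
  simp only [Finset.smul_sum, ← Finset.sum_sub_distrib, ← Finset.sum_add_distrib]
  refine Finset.sum_congr rfl fun μ _ => Finset.sum_congr rfl fun ν _ => ?_
  have hT := isExt_T hR ν μ
  have h1 : ∀ {p r : ZMod 2} {ξ η : VF N M}, ξ.IsHomog p → η.IsHomog r →
      Hom (p + r + deg μ + deg ν) (∑ ρ, ev hR (pd ν (ξ ρ)) * ev hR (pd ρ (η μ))) := by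
    intro p r ξ η hξ hη
    refine Hom.sum _ fun ρ _ => ((hom_ev_pd hξ ν ρ).mul (hom_ev_pd hη ρ μ)).cast ?_
    have : ∀ a b d e f : ZMod 2, a + f + d + (b + e + f) = a + b + e + d := by decide
    exact this _ _ _ _ _
  have h2 : ∀ {p r : ZMod 2} {ξ η : VF N M}, ξ.IsHomog p → η.IsHomog r →
      Hom (p + r + deg μ + deg ν) (vact hR ξ (pd ν (η μ))) := by
    intro p r ξ η hξ hη
    exact (hom_vact hξ ((hη μ).pd ν)).cast (by ring)
  have a1 := h1 hξ hη
  have a2 := (h1 hη hξ).cast (r := p + r + deg μ + deg ν) (by ring)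
  have a3 := h2 hξ hη
  have a4 := (h2 hη hξ).cast (r := p + r + deg μ + deg ν) (by ring)
  rw [ev_pd_bracket hξ hη, cop_add (a1.sub (a2.smul _)) ((a3.smul _).sub (a4.smul _)) hT,
    cop_sub a1 (a2.smul _) hT, cop_smul a2 hT, cop_sub (a3.smul _) (a4.smul _) hT,
    cop_smul a3 hT, cop_smul a4 hT]
  simp only [smul_add, smul_sub, smul_smul, ← sgn_add]
  have s1 : ∀ p r a b : ZMod 2, (p + r + a) * b + a + p * b = (r + a) * b + a := by decide
  have s2 : ∀ p r a b : ZMod 2, (p + r + a) * b + a + (p * r + r * b) =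
    p * r + ((p + a) * b + a) := by decide
  have s3 : ∀ p r a b : ZMod 2, (p + r + a) * b + a + p * r = p * r + ((p + r + a) * b + a) := by
    decide
  rw [s1, s2, s3]

theorem sbr_topp_dop_lop (hξ : ξ.IsHomog p) (hη : η.IsHomog r) :
    sbr (p * r) (topp hR p ξ) (dop r (tld hR η)) + sbr (p * r) (topp hR p ξ) (lop hR η) =
      -(sgn (p * r) • ∑ μ, ∑ ν, sgn ((p + deg μ) * deg ν + deg μ) •
        cop (vact hR η (pd ν (ξ μ))) (R.T ν μ)) := by
  rw [sbr_swap _ _ (topp hR p ξ), sbr_swap _ _ (topp hR p ξ), mul_comm p r, ← sbr_dop_lop_topp hη hξ,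
    smul_add, neg_add]

/-- The bracket of two generators, with the extension in terms of contractions. -/
theorem sbr_gen_gen (hξ : ξ.IsHomog p) (hη : η.IsHomog r) :
    sbr (p * r) (R.gen p ξ) (R.gen r η) = R.gen (p + r) (VF.bracket p r ξ η)
      + ((∑ i, ∑ j, sgn ((p + r + sdeg i) * sdeg i) •
          (contr (jac hR ξ i j) (jac hR η j i) (jacd hR p ξ i j) (jacd hR r η j i)).fld 0)
        + (Complex.I * (c / 12)) •
          ((d hR (d hR (d hR (ev hR (ξ none)))) + d hR (ev hR (ξ none))) * ev hR (η none)).fld 0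
        - Complex.I • (k₁ • (∑ μ, ∑ ν, sgn ((p + r + deg ν) * deg ν) •
          (d hR (ev hR (pd ν (ξ μ))) * ev hR (pd μ (η ν))).fld 0)
        + k₂ • (d hR (ev hR (ξ.div p)) * ev hR (η.div r)).fld 0)) := by
  rw [gen_eq hR, gen_eq hR, gen_eq hR]
  simp only [sbr_add_left, sbr_add_right]
  have h1 := sbr_dop_dop_tld (hR := hR) hξ hη
  have h2 := sbr_dop_lop (hR := hR) hξ hη
  have h3 := sbr_lop_dop (hR := hR) hξ hη
  have h4 := sbr_lop_lop (hR := hR) hξ hη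
  have h5 := sbr_dop_lop_topp (hR := hR) hξ hη
  have h6 := sbr_topp_dop_lop (hR := hR) hξ hη
  have h7 := sbr_topp_topp (hR := hR) hξ hη
  have h8 := lop_bracket (hR := hR) hξ hη
  have h9 := topp_bracket (hR := hR) hξ hη
  linear_combination (norm := module) h1 + h2 + h3 + h4 + h5 + h6 + h7 - h8 - h9

end QRing

end TrajOps

end SuperTraj

namespace SuperTraj

namespace TrajOps

variable {N M : ℕ} {W : Type*} [AddCommGroup W] [Module ℂ W] {R : TrajOps N M W}
  {p r s t u : ZMod 2} {c k₁ k₂ : ℂ}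

namespace QRing

variable {hR : R.IsRep c k₁ k₂} {ξ η : VF N M}

/-! ### The extension -/

/-- The mode of frequency zero, i.e. the integral over the circle up to normalization. -/
def tr (hR : R.IsRep c k₁ k₂) : QRing hR →ₗ[ℂ] Module.End ℂ W where
  toFun A := A.fld 0
  map_add' A B := by rw [fld_add]; rfl
  map_smul' a A := by rw [fld_smul]; rfl

theorem tr_apply (A : QRing hR) : tr hR A = A.fld 0 := rfl

theorem tr_d (A : QRing hR) : tr hR (d hR A) = 0 := fld_d_zero A

theorem tr_d_mul (A B : QRing hR) : tr hR (d hR A * B) = -tr hR (A * d hR B) := by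
  have := tr_d (A * B)
  rw [d_mul, map_add] at this
  exact eq_neg_of_add_eq_zero_left this

theorem ev2_eq (f : STFun N M) : ev2 hR f = d hR (ev hR (pd none f)) +
    ∑ i, qd hR (some i) * d hR (ev hR (pd (some i) f)) := by
  rw [ev2, Fintype.sum_option, qd, one_mul]

theorem d_ev_eq (f : STFun N M) : d hR (ev hR f) = ev hR (pd none f) +
    ∑ i, qd hR (some i) * ev hR (pd (some i) f) := by
  rw [d_ev, Fintype.sum_option, qd, one_mul]

theorem sgn_smul_mul_qd {i : SIdx N M} {A : QRing hR} (hA : Hom (p + sdeg i) A) :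
    sgn ((p + sdeg i) * sdeg i) • (A * qd hR (some i)) = qd hR (some i) * A := by
  rw [hA.comm (hom_qd (some i)), smul_smul]
  simp [deg]

/-- The part of the extension that is quadratic in the second derivatives of the components. -/
def kin (hR : R.IsRep c k₁ k₂) (t : ZMod 2) (ξ η : VF N M) : QRing hR :=
  ∑ μ, ∑ ν, sgn ((t + deg ν) * deg ν) • (d hR (ev hR (pd ν (ξ μ))) * ev hR (pd μ (η ν)))

theorem kin_eq (t : ZMod 2) : kin hR t ξ η =
    d hR (ev hR (pd none (ξ none))) * ev hR (pd none (η none))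
    + (∑ i, sgn ((t + sdeg i) * sdeg i) •
        (d hR (ev hR (pd (some i) (ξ none))) * ev hR (pd none (η (some i)))))
    + (∑ j, d hR (ev hR (pd none (ξ (some j)))) * ev hR (pd (some j) (η none)))
    + ∑ i, ∑ j, sgn ((t + sdeg i) * sdeg i) •
        (d hR (ev hR (pd (some i) (ξ (some j)))) * ev hR (pd (some j) (η (some i)))) := by
  rw [kin, Fintype.sum_option, Fintype.sum_option]
  simp only [Fintype.sum_option, deg, mul_zero, sgn_zero, one_smul, Finset.sum_add_distrib]
  rw [Finset.sum_comm (s := (Finset.univ : Finset (SIdx N M)))]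
  abel

/-- The terms of the extension with two time derivatives on a component. -/
def accel (hR : R.IsRep c k₁ k₂) (t : ZMod 2) (ξ η : VF N M) : QRing hR :=
  (∑ ν, sgn ((t + deg ν) * deg ν) • (ev hR (pd ν (ξ none)) * ev2 hR (η ν)))
    - (∑ μ, ev2 hR (ξ μ) * ev hR (pd μ (η none)))
    - d hR (ev hR (ξ none)) * ev2 hR (η none)
    + ev2 hR (ξ none) * d hR (ev hR (η none))

theorem sum_d_mul_mul (hξ : ξ.IsHomog p) (hη : η.IsHomog r) :
    ∑ i, ∑ j, sgn ((p + r + sdeg i) * sdeg i) •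
      (d hR (ev hR (pd (some i) (ξ (some j)))) * (ev hR (pd (some j) (η none)) * qd hR (some i))) =
    ∑ j, (ev2 hR (ξ (some j)) - d hR (ev hR (pd none (ξ (some j))))) *
      ev hR (pd (some j) (η none)) := by
  rw [Finset.sum_comm]
  refine Finset.sum_congr rfl fun j _ => ?_
  rw [ev2_eq, add_sub_cancel_left, Finset.sum_mul]
  refine Finset.sum_congr rfl fun i _ => ?_
  rw [← mul_assoc, mul_assoc (qd hR (some i))]
  refine sgn_smul_mul_qd (((hom_ev_pd hξ _ _).d.mul (hom_ev_pd hη _ _)).cast ?_)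
  simp only [deg]
  have : ∀ p r i j : ZMod 2, p + j + i + (r + 0 + j) = p + r + i := by decide
  exact this _ _ _ _

theorem sum_d_mul_mul_mul (hξ : ξ.IsHomog p) (hη : η.IsHomog r) :
    ∑ i, ∑ j, sgn ((p + r + sdeg i) * sdeg i) •
      (d hR (ev hR (pd (some i) (ξ none)) * qd hR (some j)) *
        (ev hR (pd (some j) (η none)) * qd hR (some i))) =
    (ev2 hR (ξ none) - d hR (ev hR (pd none (ξ none)))) *
        (d hR (ev hR (η none)) - ev hR (pd none (η none)))
      + (d hR (ev hR (ξ none)) - ev hR (pd none (ξ none))) *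
        (d hR (d hR (ev hR (η none))) - ev2 hR (η none)) := by
  -- The second time derivative of η^0(q) exceeds q̇^ρ∂_ρ η̇^0 by the terms in which a derivative
  -- hits a velocity, namely q̈^j∂_jη^0.
  have h1 : d hR (d hR (ev hR (η none))) - ev2 hR (η none) =
      ∑ j, d hR (qd hR (some j)) * ev hR (pd (some j) (η none)) := by
    rw [d_ev_eq, ev2_eq, map_add, map_sum, add_sub_add_left_eq_sub, ← Finset.sum_sub_distrib]
    exact Finset.sum_congr rfl fun j _ => by rw [d_mul, add_sub_cancel_right]
  rw [h1, d_ev_eq (ξ none), d_ev_eq (η none), ev2_eq, add_sub_cancel_left, add_sub_cancel_left, add_sub_cancel_left,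
    Finset.sum_mul_sum, Finset.sum_mul_sum, ← Finset.sum_add_distrib]
  refine Finset.sum_congr rfl fun i _ => ?_
  rw [← Finset.sum_add_distrib]
  refine Finset.sum_congr rfl fun j _ => ?_
  rw [← mul_assoc, sgn_smul_mul_qd (((((hom_ev_pd hξ _ _).mul (hom_qd _)).d).mul
    (hom_ev_pd hη _ _)).cast _), d_mul]
  · noncomm_ring
  · simp only [deg]
    have : ∀ p r i j : ZMod 2, p + 0 + i + j + (r + 0 + j) = p + r + i := by decide
    exact this _ _ _ _

/-- Expanding both Jacobians of the tilded fields gives four products. The first, completed by time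
indices, is `kin`. The two mixed ones, one of them after integration by parts, and the one with only
ξ^0 and η^0 give `accel`. What is left over integrates to -ξ̈^0 η̇^0. -/
theorem tr_sum_d_jac_mul_jac (hξ : ξ.IsHomog p) (hη : η.IsHomog r) :
    ∑ i, ∑ j, sgn ((p + r + sdeg i) * sdeg i) • tr hR (d hR (jac hR ξ i j) * jac hR η j i) =
      tr hR (kin hR (p + r) ξ η + accel hR (p + r) ξ η)
        - tr hR (d hR (d hR (ev hR (ξ none))) * d hR (ev hR (η none))) := by
  have h1 : ∑ i, ∑ j, sgn ((p + r + sdeg i) * sdeg i) •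
      tr hR (d hR (jac hR ξ i j) * jac hR η j i) =
      tr hR (∑ i, ∑ j, sgn ((p + r + sdeg i) * sdeg i) •
        (d hR (ev hR (pd (some i) (ξ (some j)))) * ev hR (pd (some j) (η (some i)))))
      - tr hR (∑ i, ∑ j, sgn ((p + r + sdeg i) * sdeg i) •
        (d hR (ev hR (pd (some i) (ξ (some j)))) *
          (ev hR (pd (some j) (η none)) * qd hR (some i))))
      + tr hR (∑ i, sgn ((p + r + sdeg i) * sdeg i) • (ev hR (pd (some i) (ξ none)) *
          (ev2 hR (η (some i)) - d hR (ev hR (pd none (η (some i)))))))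
      + tr hR (∑ i, ∑ j, sgn ((p + r + sdeg i) * sdeg i) •
        (d hR (ev hR (pd (some i) (ξ none)) * qd hR (some j)) *
          (ev hR (pd (some j) (η none)) * qd hR (some i)))) := by
    simp only [map_sum, map_smul, ← Finset.sum_sub_distrib, ← Finset.sum_add_distrib]
    refine Finset.sum_congr rfl fun i _ => ?_
    rw [ev2_eq, add_sub_cancel_left, Finset.mul_sum, map_sum]
    simp only [Finset.smul_sum, ← Finset.sum_add_distrib, ← smul_sub, ← smul_add]
    refine Finset.sum_congr rfl fun j _ => ?_
    have h := tr_d_mul (ev hR (pd (some i) (ξ none)) * qd hR (some j))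
      (ev hR (pd (some j) (η (some i))))
    rw [mul_assoc] at h
    rw [jac, jac, map_sub, sub_mul, mul_sub, mul_sub, map_sub, map_sub, map_sub, h]
    congr 1
    abel
  have h2 : ∀ i : SIdx N M, tr hR (ev hR (pd (some i) (ξ none)) *
        d hR (ev hR (pd none (η (some i))))) =
      -tr hR (d hR (ev hR (pd (some i) (ξ none))) * ev hR (pd none (η (some i)))) := fun i => by
    rw [tr_d_mul, neg_neg]
  have h3 := tr_d_mul (ev hR (pd none (ξ none))) (d hR (ev hR (η none)))
  have h4 := tr_d_mul (d hR (ev hR (ξ none))) (d hR (ev hR (η none)))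
  rw [h1, sum_d_mul_mul hξ hη, sum_d_mul_mul_mul hξ hη, kin_eq, accel]
  simp only [Fintype.sum_option, map_add, map_sub, map_sum, sub_mul, mul_sub, map_smul, h2, h3, h4,
    Finset.sum_sub_distrib, smul_sub, smul_neg, Finset.sum_neg_distrib, deg, mul_zero, sgn_zero,
    one_smul]
  abel

/-- The supertrace of the spatial Jacobian of ξ̃ lacks ∂_0ξ^0 compared with the divergence, while
the velocity terms are -(ξ̇^0 - ∂_0ξ^0). The explicit time derivatives cancel. -/
theorem sum_sgn_jac (hξ : ξ.IsHomog p) :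
    ∑ i, sgn (p * sdeg i + sdeg i) • jac hR ξ i i =
      ev hR (ξ.div p) - d hR (ev hR (ξ none)) := by
  have hsq : ∀ a : ZMod 2, a * a = a := by decide
  have h : ∀ i, sgn (p * sdeg i + sdeg i) • (ev hR (pd (some i) (ξ none)) * qd hR (some i)) =
      qd hR (some i) * ev hR (pd (some i) (ξ none)) := by
    intro i
    rw [← sgn_smul_mul_qd ((hom_ev_pd hξ (some i) none).cast
      (show p + deg none + deg (some i) = p + sdeg i by simp [deg])), add_mul, hsq]
  simp only [VF.div, d_ev_eq, Fintype.sum_option, jac, smul_sub, h, Finset.sum_sub_distrib, deg,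
    map_add, map_sum, map_smul, mul_zero, add_zero, sgn_zero, one_smul]
  abel

/-- The density of the extension. -/
def extDensity (hR : R.IsRep c k₁ k₂) (p r : ZMod 2) (ξ η : VF N M) : QRing hR :=
  (1 + k₁) • kin hR (p + r) ξ η + k₂ • (d hR (ev hR (ξ.div p)) * ev hR (η.div r))
    + accel hR (p + r) ξ η
    + (1 / 2 : ℂ) • (d hR (ev hR (ξ.div p)) * d hR (ev hR (η none)))
    - (1 / 2 : ℂ) • (d hR (ev hR (ξ none)) * d hR (ev hR (η.div r)))
    - (2 - (c + 2 * ((N : ℂ) - M)) / 12) •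
      (d hR (d hR (ev hR (ξ none))) * d hR (ev hR (η none)))
    - ((c + 2 * ((N : ℂ) - M)) / 12) • (d hR (ev hR (ξ none)) * ev hR (η none))
    + (Complex.I / 2) • (ev hR (ξ.div p) * d hR (ev hR (η none))
      - d hR (ev hR (ξ none)) * ev hR (η.div r))

theorem ext_eq (hR : R.IsRep c k₁ k₂) (p r : ZMod 2) (ξ η : VF N M) :
    R.ext c k₁ k₂ p r ξ η = -Complex.I • tr hR (extDensity hR p r ξ η) := by
  have h : ∀ A : Fld W, (1 / (2 * Real.pi * Complex.I) : ℂ) • integ A = -Complex.I • A 0 := by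
    intro A
    rw [integ, smul_smul]
    congr 1
    have h1 := two_pi_ne_zero
    have h2 := Complex.I_ne_zero
    field_simp
    rw [Complex.I_sq, neg_neg]
  rw [TrajOps.ext, h, tr_apply]
  refine congrArg _ (congrFun ?_ 0)
  simp only [extDensity, kin, accel, fld_add, fld_sub, fld_smul, fld_sum, fld_mul, fld_d, fld_ev,
    evDot_eq (hR := hR), evDot2_eq (hR := hR)]
  abel

/-- The origin of the shift by 2(N - M): every direction contributes the same double contraction,
with opposite signs for commuting and anticommuting variables. -/
theorem sum_sgn_sdeg : ∑ i : SIdx N M, sgn (sdeg i) = (N : ℂ) - M := by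
  rw [Fintype.sum_sum_type]
  simp [sdeg, sgn, sub_eq_add_neg]

/-- The velocity parts are diagonal, so off-diagonal pairs contribute only the product of Jacobians.
On the diagonal the terms linear in a Jacobian sum to supertraces, evaluated by `sum_sgn_jac`, and
those without one merely count the directions. -/
theorem sum_contr_eq (hξ : ξ.IsHomog p) (hη : η.IsHomog r) :
    ∑ i, ∑ j, sgn ((p + r + sdeg i) * sdeg i) •
      (contr (jac hR ξ i j) (jac hR η j i) (jacd hR p ξ i j) (jacd hR r η j i)).fld 0 =
    -Complex.I • (∑ i, ∑ j, sgn ((p + r + sdeg i) * sdeg i) •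
      tr hR (d hR (jac hR ξ i j) * jac hR η j i))
    + tr hR ((-(Complex.I / 2) • d hR (d hR (ev hR (ξ none))) - (1 / 2 : ℂ) • d hR (ev hR (ξ none)))
      * (ev hR (η.div r) - d hR (ev hR (η none))))
    + tr hR (((Complex.I / 2) • d hR (d hR (ev hR (ξ.div p) - d hR (ev hR (ξ none))))
      - (1 / 2 : ℂ) • d hR (ev hR (ξ.div p) - d hR (ev hR (ξ none)))) * ev hR (η none))
    + (((N : ℂ) - M) * (Complex.I / 6)) • tr hR
      ((d hR (d hR (d hR (ev hR (ξ none)))) + d hR (ev hR (ξ none))) * ev hR (η none)) := by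
  have hz : ∀ i j : SIdx N M, i ≠ j → jacd hR p ξ i j = 0 ∧ jacd hR r η j i = 0 := fun i j h =>
    ⟨if_neg h, if_neg (Ne.symm h)⟩
  have key : ∀ i j, sgn ((p + r + sdeg i) * sdeg i) •
      (contr (jac hR ξ i j) (jac hR η j i) (jacd hR p ξ i j) (jacd hR r η j i)).fld 0 =
      -Complex.I • sgn ((p + r + sdeg i) * sdeg i) • tr hR (d hR (jac hR ξ i j) * jac hR η j i)
      + if i = j then
        tr hR ((-(Complex.I / 2) • d hR (d hR (ev hR (ξ none))) -
          (1 / 2 : ℂ) • d hR (ev hR (ξ none))) * sgn (r * sdeg i + sdeg i) • jac hR η i i)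
        + tr hR (((Complex.I / 2) • d hR (d hR (sgn (p * sdeg i + sdeg i) • jac hR ξ i i))
          - (1 / 2 : ℂ) • d hR (sgn (p * sdeg i + sdeg i) • jac hR ξ i i)) * ev hR (η none))
        + (sgn (sdeg i) * (Complex.I / 6)) • tr hR
          ((d hR (d hR (d hR (ev hR (ξ none)))) + d hR (ev hR (ξ none))) * ev hR (η none))
        else 0 := by
    intro i j
    rw [← tr_apply, contr]
    split_ifs with h
    · subst h
      have hS : sgn ((p + r + sdeg i) * sdeg i) =
          sgn (p * sdeg i) * (sgn (r * sdeg i) * sgn (sdeg i)) := by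
        rw [← sgn_add, ← sgn_add]
        congr 1
        have : ∀ p r a : ZMod 2, (p + r + a) * a = p * a + (r * a + a) := by decide
        exact this _ _ _
      have hu := sgn_mul_self (p * sdeg i)
      have hv := sgn_mul_self (r * sdeg i)
      rw [jacd, jacd, if_pos rfl, if_pos rfl, hS, sgn_add, sgn_add]
      simp only [map_add, map_sub, map_smul, sub_mul, mul_smul_comm, smul_mul_assoc, add_mul]
      generalize sgn (p * sdeg i) = u at *
      generalize sgn (r * sdeg i) = v at *
      generalize sgn (sdeg i) = z at *
      match_scalars
      · ring
      · linear_combination (-v * z * Complex.I / 2) * hu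
      · linear_combination (-v * z / 2) * hu
      · linear_combination (u * z * Complex.I / 2) * hv
      · linear_combination (-u * z / 2) * hv
      · linear_combination (z * Complex.I / 6) * (u * u * hv + hu)
      · linear_combination (z * Complex.I / 6) * (u * u * hv + hu)
    · obtain ⟨h1, h2⟩ := hz i j h
      simp only [h1, h2, map_zero, smul_zero, zero_mul, mul_zero, sub_zero, add_zero, map_smul]
      rw [smul_comm]
  simp only [key, Finset.sum_add_distrib, Finset.sum_ite_eq, Finset.mem_univ, if_true]
  rw [← sum_sgn_jac hξ, ← sum_sgn_jac hη, ← sum_sgn_sdeg, ← add_assoc, ← add_assoc]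
  refine congrArg₂ _ (congrArg₂ _ (congrArg₂ _ ?_ ?_) ?_) ?_
  · simp only [Finset.smul_sum]
  · rw [Finset.mul_sum, map_sum]
  · simp only [map_sum, Finset.smul_sum, ← Finset.sum_sub_distrib, Finset.sum_mul]
  · rw [← Finset.sum_smul, ← Finset.sum_mul]

/-- Everything matches after integration by parts. The counting term i(N - M)/6 joins ic/12. Of the
coefficient 2 of ξ̈^0 η̇^0, one unit comes from the product of Jacobians and one half from each of
the two mixed contractions; the terms ξ̇^0 η̇^0 of the latter cancel. -/
theorem contraction_eq_ext (hξ : ξ.IsHomog p) (hη : η.IsHomog r) :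
    (∑ i, ∑ j, sgn ((p + r + sdeg i) * sdeg i) •
        (contr (jac hR ξ i j) (jac hR η j i) (jacd hR p ξ i j) (jacd hR r η j i)).fld 0)
      + (Complex.I * (c / 12)) •
        ((d hR (d hR (d hR (ev hR (ξ none)))) + d hR (ev hR (ξ none))) * ev hR (η none)).fld 0
      - Complex.I • (k₁ • (∑ μ, ∑ ν, sgn ((p + r + deg ν) * deg ν) •
        (d hR (ev hR (pd ν (ξ μ))) * ev hR (pd μ (η ν))).fld 0)
      + k₂ • (d hR (ev hR (ξ.div p)) * ev hR (η.div r)).fld 0) = R.ext c k₁ k₂ p r ξ η := by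
  have hk : tr hR (kin hR (p + r) ξ η) = ∑ μ, ∑ ν, sgn ((p + r + deg ν) * deg ν) •
        (d hR (ev hR (pd ν (ξ μ))) * ev hR (pd μ (η ν))).fld 0 := by
    simp only [kin, map_sum, map_smul, tr_apply]
  rw [sum_contr_eq hξ hη, tr_sum_d_jac_mul_jac hξ hη, ext_eq hR, extDensity, ← hk, ← tr_apply,
    ← tr_apply]
  set x := ev hR (ξ none)
  set y := ev hR (η none)
  set D := ev hR (ξ.div p)
  set F := ev hR (η.div r)
  have e1 := tr_d_mul (d hR x) F
  have e2 := tr_d_mul (d hR D) y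
  have e3 := tr_d_mul D y
  have e4 := tr_d_mul (d hR x) y
  have e5 := tr_d_mul (d hR (d hR x)) y
  simp only [map_add, map_sub, map_smul, sub_mul, mul_sub, add_mul, smul_mul_assoc,
    e1, e2, e3, e4, e5, neg_smul, map_neg, neg_mul, smul_neg]
  match_scalars <;> first | ring1 | (ring_nf; rw [Complex.I_sq]; norm_num)

end QRing

end TrajOps

end SuperTraj

namespace SuperTraj

/-! ### Parity of the extension, action on the trajectory, non-centrality -/

namespace TrajOps

variable {N M : ℕ} {W : Type*} [AddCommGroup W] [Module ℂ W] {R : TrajOps N M W}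
  {p r s t u : ZMod 2} {c k₁ k₂ : ℂ}

namespace QRing

variable {hR : R.IsRep c k₁ k₂} {ξ η : VF N M}

theorem hom_div (hξ : ξ.IsHomog p) : Hom p (ev hR (ξ.div p)) := by
  rw [VF.div, map_sum]
  refine Hom.sum _ fun μ _ => ?_
  rw [map_smul]
  exact ((hom_ev_pd hξ μ μ).cast (by rw [add_assoc, zmod_two_add_self, add_zero])).smul _

theorem hom_ev2 {f : STFun N M} (hf : HasParity p f) : Hom p (ev2 hR f) := by
  refine Hom.sum _ fun μ _ => ((hom_qd μ).mul (hom_ev (hf.pd μ)).d).cast ?_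
  rw [add_left_comm, zmod_two_add_self, add_zero]

theorem hom_extDensity (hξ : ξ.IsHomog p) (hη : η.IsHomog r) :
    Hom (p + r) (extDensity hR p r ξ η) := by
  have e1 : ∀ p r a b : ZMod 2, p + a + b + (r + b + a) = p + r := by decide
  have e2 : ∀ p r a : ZMod 2, p + 0 + a + (r + a) = p + r := by decide
  have e3 : ∀ p r a : ZMod 2, p + a + (r + 0 + a) = p + r := by decide
  have h1 : Hom (p + r) (kin hR (p + r) ξ η) := Hom.sum _ fun μ _ => Hom.sum _ fun ν _ =>
    (((hom_ev_pd hξ ν μ).d.mul (hom_ev_pd hη μ ν)).cast (e1 _ _ _ _)).smul _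
  have hx := hom_ev_none (hR := hR) hξ
  have hy := hom_ev_none (hR := hR) hη
  have hx2 : Hom p (ev2 hR (ξ none)) := (hom_ev2 (hξ none)).cast (add_zero p)
  have hy2 : Hom r (ev2 hR (η none)) := (hom_ev2 (hη none)).cast (add_zero r)
  have h2 : Hom (p + r) (accel hR (p + r) ξ η) := by
    refine Hom.add (Hom.sub (Hom.sub (Hom.sum _ fun ν _ => ?_) (Hom.sum _ fun μ _ => ?_))
      (hx.d.mul hy2)) (hx2.mul hy.d)
    · exact (((hom_ev_pd hξ ν none).mul (hom_ev2 (hη ν))).cast (e2 _ _ _)).smul _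
    · exact (((hom_ev2 (hξ μ)).mul (hom_ev_pd hη μ none)).cast (e3 _ _ _))
  have hD := hom_div (hR := hR) hξ
  have hF := hom_div (hR := hR) hη
  exact (((((((h1.smul _).add ((hD.d.mul hF).smul _)).add h2).add ((hD.d.mul hy.d).smul _)).sub
    ((hx.d.mul hF.d).smul _)).sub ((hx.d.d.mul hy.d).smul _)).sub
    ((hx.d.mul hy).smul _)).add (((hD.mul hy.d).sub (hx.d.mul hF)).smul _)

/-- The density of the extension involves neither p nor L nor T. It is a homogeneous functional of
the trajectory, so its zero mode supercommutes with all modes of q. -/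
theorem sbr_ext_q (hR : R.IsRep c k₁ k₂) (hξ : ξ.IsHomog p) (hη : η.IsHomog r) (i : SIdx N M) (n : ℤ) :
    sbr ((p + r) * sdeg i) (R.ext c k₁ k₂ p r ξ η) (R.q i n) = 0 := by
  rw [ext_eq hR, sbr_smul_left, tr_apply, ← fld_qv (hR := hR),
    (hom_extDensity hξ hη).sbr (hom_qv i), smul_zero]

theorem sbr_gen_gen_eq (hR : R.IsRep c k₁ k₂) (hξ : ξ.IsHomog p) (hη : η.IsHomog r) :
    sbr (p * r) (R.gen p ξ) (R.gen r η) =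
      R.gen (p + r) (VF.bracket p r ξ η) + R.ext c k₁ k₂ p r ξ η := by
  rw [sbr_gen_gen (hR := hR) hξ hη, contraction_eq_ext hξ hη]

theorem sbr_gen_q (hR : R.IsRep c k₁ k₂) (hξ : ξ.IsHomog p) (i : SIdx N M) (n : ℤ) :
    sbr (p * sdeg i) (R.gen p ξ) (R.q i n) = R.xiTilde ξ i n := by
  have hL : sbr (p * sdeg i) (lop hR ξ) (R.q i n) = 0 := by
    have := sbr_cop_eq_zero (s := sdeg i) (X := R.q i n) (hom_ev_none (hR := hR) hξ) (isExt_L hR)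
      (fun m => (hom_ev_none hξ).sbr (hom_qv i) m n) (fun m => (isExt_L hR).q m i n)
    rwa [add_zero] at this
  have hT : sbr (p * sdeg i) (topp hR p ξ) (R.q i n) = 0 := by
    simp only [topp, sbr_sum_left, sbr_smul_left]
    refine Finset.sum_eq_zero fun μ _ => Finset.sum_eq_zero fun ν _ => ?_
    have := sbr_cop_eq_zero (s := sdeg i) (X := R.q i n) (hom_ev_pd (hR := hR) hξ ν μ)
      (isExt_T hR ν μ) (fun m => (hom_ev_pd hξ ν μ).sbr (hom_qv i) m n)
      (fun m => (isExt_T hR ν μ).q m i n)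
    have e : ∀ a b d : ZMod 2, a + b + d + (d + b) = a := by decide
    rw [e] at this
    rw [this, smul_zero]
  rw [gen_eq hR, sbr_add_left, sbr_add_left, hL, hT, add_zero, add_zero,
    sbr_dop_q (hom_tld hξ), fld_tld]

theorem isHomog_single {μ : Idx N M} {f : STFun N M} (hf : HasParity (p + deg μ) f) :
    VF.IsHomog p (Pi.single μ f) := fun ν => by
  by_cases h : ν = μ
  · subst h; rwa [Pi.single_eq_same]
  · rw [Pi.single_eq_of_ne h]; exact HasParity.zero

theorem div_single_none (p : ZMod 2) (f : STFun N M) :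
    VF.div p (Pi.single none f) = pd none f := by
  rw [VF.div, Fintype.sum_option]
  simp [deg]

/-- The extension of `e^{-it} ∂_0` and `x^i ∂_0` is the mode `q^i_{-1}`. -/
theorem ext_expo_mulX (hR : R.IsRep c k₁ k₂) (i : SIdx N M) :
    R.ext c k₁ k₂ 0 (sdeg i) (Pi.single none (STFun.expo (-1)))
      (Pi.single none (STFun.mulX i (STFun.expo 0))) = R.q i (-1) := by
  have hx : ∀ j : SIdx N M, Pi.single (M := fun _ : Idx N M => STFun N M) none
    (STFun.expo (-1)) (some j) = 0 := fun j => Pi.single_eq_of_ne (by simp) _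
  have hy : ∀ j : SIdx N M, Pi.single (M := fun _ : Idx N M => STFun N M) none
    (STFun.mulX i (STFun.expo 0)) (some j) = 0 := fun j => Pi.single_eq_of_ne (by simp) _
  have h0 : pd none (STFun.mulX i (STFun.expo 0) : STFun N M) = 0 := by
    rw [STFun.pd_none_mulX, STFun.pd_none_expo]; simp
  have hq : ev hR (STFun.mulX i (STFun.expo 0)) = qv hR i := by
    rw [ev_mulX, ev_expo, E_zero, mul_one]
  have hz : ev2 hR (0 : STFun N M) = 0 := by simp [ev2]
  have h2x : ev2 hR (STFun.expo (-1)) = -E hR (-1) := by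
    rw [ev2_eq]
    simp [d_E, ev_expo, smul_smul]
  have h2y : ev2 hR (STFun.mulX i (STFun.expo 0)) = 0 := by
    rw [ev2_eq, h0]
    simp only [map_zero, zero_add]
    refine Finset.sum_eq_zero fun j _ => ?_
    have : ∃ a : ℂ, ev hR (pd (some j) (STFun.mulX i (STFun.expo 0) : STFun N M)) = a • E hR 0 := by
      rw [STFun.pd_some_mulX]
      by_cases h : i = j
      · exact ⟨1, by simp [h, ev_expo]⟩
      · exact ⟨0, by simp [h]⟩
    obtain ⟨a, ha⟩ := this
    rw [ha, map_smul, d_E]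
    simp
  have hE : ∀ A : QRing hR, tr hR (E hR (-1) * A) = A.fld (-1) := fun A => by
    rw [tr_apply, fld_E_mul, zero_add]
  rw [ext_eq hR, extDensity, kin, accel]
  simp only [Fintype.sum_option, hx, hy, div_single_none, Pi.single_eq_same, h0, hq, hz, h2x, h2y,
    map_zero, mul_zero, zero_mul, smul_zero, Finset.sum_const_zero, add_zero, sub_zero, zero_add,
    STFun.pd_none_expo, map_smul, ev_expo, d_E]
  have hd : (d hR (qv hR i)).fld (-1) = Complex.I • R.q i (-1) := by
    rw [fld_d_apply]; simp
  simp only [map_add, map_sub, map_smul, smul_mul_assoc, neg_mul, map_neg, hE, hd, fld_qv]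
  have I2 := Complex.I_mul_I
  match_scalars
  -- The terms with c + 2(N - M) cancel for all values of the constants, because the cocycle is
  -- built from the third derivative plus the first, which annihilates e^{-it}.
  linear_combination (2 * Complex.I ^ 2 - 1 -
    (c + 2 * ((N : ℂ) - M)) / 12 * Complex.I ^ 2) * I2

/-- The extension is not central. -/
theorem sbr_gen_ext_ne_zero [Nontrivial W] (hR : R.IsRep c k₁ k₂) (i : SIdx N M) :
    sbr (sdeg i * (0 + sdeg i)) (R.gen (sdeg i) (Pi.single (some i) (STFun.expo 1)))
      (R.ext c k₁ k₂ 0 (sdeg i) (Pi.single none (STFun.expo (-1)))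
        (Pi.single none (STFun.mulX i (STFun.expo 0)))) ≠ 0 := by
  have hζ : VF.IsHomog (N := N) (M := M) (sdeg i) (Pi.single (some i) (STFun.expo 1)) :=
    isHomog_single (by
      rw [show sdeg i + deg (some i) = 0 from zmod_two_add_self _]; exact STFun.hasParity_expo 1)
  -- The field e^{it}∂_i sends q^i_{-1} to the mode of frequency -1 of e^{it}, which is the identity
  -- of `W`.
  rw [ext_expo_mulX hR, zero_add, sbr_gen_q hR hζ, ← fld_tld (hR := hR), tld,
    Pi.single_eq_same, Pi.single_eq_of_ne (by simp), map_zero, zero_mul, sub_zero, ev_expo]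
  simp [fexp]

end QRing

end TrajOps

end SuperTraj

namespace SuperTraj

namespace Fock

variable {N M : ℕ}

/-! ### The Heisenberg algebra on the Fock module -/

/-- The endomorphisms of a complex vector space. -/
abbrev EndOf (W : Type*) [AddCommGroup W] [Module ℂ W] := Module.End ℂ W

theorem mulVar_inl (i : Fin N) (k : ℤ) : (mulVar (Sum.inl i) k : Fock N M →ₗ[ℂ] _) =
    evenOp (fun a => a + Finsupp.single (i, k) 1) fun _ => 1 := rfl

theorem derVar_inl (i : Fin N) (k : ℤ) : (derVar (Sum.inl i) k : Fock N M →ₗ[ℂ] _) =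
    evenOp (fun a => a - Finsupp.single (i, k) 1) fun a => (a (i, k) : ℂ) := rfl

theorem mulVar_inr (j : Fin M) (k : ℤ) :
    (mulVar (Sum.inr j) k : Fock N M →ₗ[ℂ] _) = mulOdd (toLex (j, k)) := rfl

theorem derVar_inr (j : Fin M) (k : ℤ) :
    (derVar (Sum.inr j) k : Fock N M →ₗ[ℂ] _) = derOdd (toLex (j, k)) := rfl

theorem sbr_eq_zero_of_comm {W : Type*} [AddCommGroup W] [Module ℂ W] {A B : Module.End ℂ W}
    (h : ∀ w, A (B w) = B (A w)) : sbr 0 A B = 0 :=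
  LinearMap.ext fun w => by simp [sbr_def, h]

theorem sbr_one_left (A : Module.End ℂ (Fock N M)) : sbr 0 1 A = 0 :=
  sbr_eq_zero_of_comm fun _ => rfl

theorem sbr_mulVar_mulVar (i j : SIdx N M) (k l : ℤ) :
    sbr (sdeg i * sdeg j) (mulVar i k) (mulVar j l) = 0 := by
  rcases i with i | i <;> rcases j with j | j <;>
    simp only [sdeg, mul_zero, zero_mul, mulVar_inl, mulVar_inr]
  · exact sbr_eq_zero_of_comm (evenOp_comm (fun _ => rfl) fun a _ => add_right_comm _ _ _)
  · exact sbr_eq_zero_of_comm (evenOp_mulOdd _ _ _)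
  · exact sbr_eq_zero_of_comm fun f => (evenOp_mulOdd _ _ _ f).symm
  · refine LinearMap.ext fun f => ?_
    simp only [sbr_def, mul_one, LinearMap.sub_apply, LinearMap.smul_apply,
      Module.End.mul_apply]
    rw [mulOdd_mulOdd]
    simp [sgn]

theorem sbr_derVar_derVar (i j : SIdx N M) (k l : ℤ) :
    sbr (sdeg i * sdeg j) (derVar i k) (derVar j l) = 0 := by
  rcases i with i | i <;> rcases j with j | j <;>
    simp only [sdeg, mul_zero, zero_mul, derVar_inl, derVar_inr]
  · refine sbr_eq_zero_of_comm (evenOp_comm (fun a => ?_) fun a _ => tsub_right_comm)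
    by_cases h : (i, k) = (j, l)
    · rw [h]
    · simp [Finsupp.single_eq_of_ne h, Finsupp.single_eq_of_ne (Ne.symm h), mul_comm]
  · exact sbr_eq_zero_of_comm (evenOp_derOdd _ _ _)
  · exact sbr_eq_zero_of_comm fun f => (evenOp_derOdd _ _ _ f).symm
  · refine LinearMap.ext fun f => ?_
    simp only [sbr_def, mul_one, LinearMap.sub_apply, LinearMap.smul_apply,
      Module.End.mul_apply]
    rw [derOdd_derOdd]
    simp [sgn]

theorem sbr_derVar_mulVar (i j : SIdx N M) (k l : ℤ) :
    sbr (sdeg i * sdeg j) (derVar i k) (mulVar j l) = if i = j ∧ k = l then 1 else 0 := by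
  rcases i with i | i <;> rcases j with j | j
  · refine superPoly_ext fun m => ?_
    simp only [sbr_def, sdeg, mul_zero, sgn_zero, one_smul, LinearMap.sub_apply,
      Module.End.mul_apply, mulVar_inl, derVar_inl, evenOp_single, Sum.inl.injEq, one_mul, mul_one,
      Finsupp.coe_add, Pi.add_apply]
    by_cases h : (i, k) = (j, l)
    · obtain ⟨rfl, rfl⟩ := Prod.mk.inj h
      simp only [add_tsub_cancel_right, Finsupp.single_eq_same, and_self, if_true,
        Module.End.one_apply]
      by_cases h0 : m.1 (i, k) = 0
      · simp [h0]
      · rw [STFun.sub_single_add _ _ _ (Or.inr h0), add_tsub_cancel_right, ← Finsupp.single_sub]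
        simp
    · rw [if_neg fun h' => h (Prod.ext h'.1 h'.2), STFun.sub_single_add _ _ _ (Or.inl h),
        Finsupp.single_eq_of_ne h]
      simp
  · simp only [sdeg, zero_mul, reduceCtorEq, false_and, if_false, derVar_inl, mulVar_inr]
    exact sbr_eq_zero_of_comm (evenOp_mulOdd _ _ _)
  · simp only [sdeg, mul_zero, reduceCtorEq, false_and, if_false, derVar_inr, mulVar_inl]
    exact sbr_eq_zero_of_comm fun f => (evenOp_derOdd _ _ _ f).symm
  · refine LinearMap.ext fun f => ?_
    simp only [sbr_def, sdeg, mul_one, derVar_inr, mulVar_inr, LinearMap.sub_apply, LinearMap.smul_apply,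
      Module.End.mul_apply, derOdd_mulOdd, Sum.inr.injEq]
    have h1 : toLex (j, l) = toLex (i, k) ↔ i = j ∧ k = l := by
      rw [EmbeddingLike.apply_eq_iff_eq, Prod.mk.injEq, eq_comm, eq_comm (a := l)]
    simp only [h1]
    split_ifs <;> simp [sgn]

theorem sbr_mulVar_derVar (i j : SIdx N M) (k l : ℤ) :
    sbr (sdeg i * sdeg j) (mulVar i k) (derVar j l) =
      if i = j ∧ k = l then -(sgn (sdeg i)) • 1 else 0 := by
  by_cases h : i = j ∧ k = l
  · obtain ⟨rfl, rfl⟩ := h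
    have hsq : ∀ a : ZMod 2, a * a = a := by decide
    rw [sbr_swap, sbr_derVar_mulVar, if_pos ⟨rfl, rfl⟩, if_pos ⟨rfl, rfl⟩, hsq]
    exact (neg_smul (sgn (sdeg i)) (1 : EndOf (Fock N M))).symm
  · rw [if_neg h]
    refine sbr_swap_zero ?_
    rw [mul_comm, sbr_derVar_mulVar, if_neg fun h' => h ⟨h'.1.symm, h'.2.symm⟩]

/-- When p is the creation operator, the bracket of a variable with its derivative carries the sign
-(-)^i. The prefactor of the derivative in `q` is chosen to undo it, so that both halves of the
frequencies give +1. -/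
theorem sbr_p_q (j i : SIdx N M) (m n : ℤ) :
    sbr (sdeg j * sdeg i) (p j m) (q i n) = if i = j ∧ m + n = 0 then 1 else 0 := by
  unfold p q
  split_ifs with h1 h2 h3 h3 h2 h3 h3
  · omega
  · exact sbr_mulVar_mulVar _ _ _ _
  · obtain ⟨rfl, h⟩ := h3
    rw [sbr_smul_right, sbr_mulVar_derVar, if_pos ⟨rfl, by omega⟩, smul_smul, neg_mul_neg,
      sgn_mul_self, one_smul]
  · rw [sbr_smul_right, sbr_mulVar_derVar, if_neg fun h => h3 ⟨h.1.symm, by omega⟩, smul_zero]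
  · rw [sbr_derVar_mulVar, if_pos ⟨h3.1.symm, by omega⟩]
  · rw [sbr_derVar_mulVar, if_neg fun h => h3 ⟨h.1.symm, by omega⟩]
  · omega
  · rw [sbr_smul_right, sbr_derVar_derVar, smul_zero]

theorem sbr_q_q (i j : SIdx N M) (m n : ℤ) : sbr (sdeg i * sdeg j) (q i m) (q j n) = 0 := by
  unfold q
  split_ifs with h1 h2 h2
  · exact sbr_mulVar_mulVar _ _ _ _
  · rw [sbr_smul_right, sbr_mulVar_derVar, if_neg (by omega), smul_zero]
  · rw [sbr_smul_left, sbr_derVar_mulVar, if_neg (by omega), smul_zero]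
  · rw [sbr_smul_left, sbr_smul_right, sbr_derVar_derVar, smul_zero, smul_zero]

theorem sbr_p_p (i j : SIdx N M) (m n : ℤ) : sbr (sdeg i * sdeg j) (p i m) (p j n) = 0 := by
  unfold p
  split_ifs with h1 h2 h2
  · exact sbr_mulVar_mulVar _ _ _ _
  · rw [sbr_mulVar_derVar, if_neg (by omega)]
  · rw [sbr_derVar_mulVar, if_neg (by omega)]
  · exact sbr_derVar_derVar _ _ _ _

/-! ### The grading operators -/

theorem koszul_single (a : ZMod 2) (m : ((Fin N × ℤ) →₀ ℕ) × Finset (Fin M ×ₗ ℤ)) (b : ℂ) :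
    koszul a (Finsupp.single m b : Fock N M) =
      Finsupp.single m (b * sgn (a * (m.2.card : ZMod 2))) := by
  rw [koszul, Finsupp.linearCombination_single, Finsupp.smul_single, smul_eq_mul]

theorem koszul_zero : (koszul 0 : Module.End ℂ (Fock N M)) = 1 :=
  superPoly_ext fun m => by simp [koszul_single]

theorem koszul_mul (a b : ZMod 2) :
    (koszul a * koszul b : Module.End ℂ (Fock N M)) = koszul (a + b) :=
  superPoly_ext fun m => by
    simp [koszul_single, add_mul, sgn_add, mul_comm]

theorem sgn_card_insert (a : ZMod 2) {S : Finset (Fin M ×ₗ ℤ)} {o : Fin M ×ₗ ℤ} (h : o ∉ S) :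
    sgn (a * ((insert o S).card : ZMod 2)) = sgn a * sgn (a * (S.card : ZMod 2)) := by
  rw [Finset.card_insert_of_notMem h, Nat.cast_add, Nat.cast_one, mul_add, mul_one, add_comm,
    sgn_add]

theorem sbr_koszul_mulVar (a : ZMod 2) (i : SIdx N M) (k : ℤ) :
    sbr (a * sdeg i) (koszul a) (mulVar i k) = 0 := by
  refine superPoly_ext fun m => ?_
  rcases i with i | j
  · simp [sbr_def, sdeg, mulVar_inl, evenOp_single, koszul_single]
  · by_cases h : toLex (j, k) ∈ m.2
    · simp [sbr_def, mulVar, mulOdd_single, koszul_single, h]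
    · simp only [sbr_def, mulVar_inr, sdeg, mul_one, LinearMap.sub_apply, LinearMap.smul_apply,
        Module.End.mul_apply, mulOdd_single, koszul_single, h, if_false, one_mul,
        sgn_card_insert a h]
      rw [Finsupp.smul_single, ← Finsupp.single_sub, LinearMap.zero_apply, ← Finsupp.single_zero]
      congr 1
      rw [smul_eq_mul]
      ring

theorem sbr_koszul_derVar (a : ZMod 2) (i : SIdx N M) (k : ℤ) :
    sbr (a * sdeg i) (koszul a) (derVar i k) = 0 := by
  refine superPoly_ext fun m => ?_
  rcases i with i | j
  · simp [sbr_def, sdeg, derVar_inl, evenOp_single, koszul_single, mul_comm]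
  · by_cases h : toLex (j, k) ∈ m.2
    · have h2 := sgn_card_insert a (Finset.notMem_erase (toLex (j, k)) m.2)
      rw [Finset.insert_erase h] at h2
      have h3 := sgn_mul_self a
      simp only [sbr_def, derVar, sdeg, mul_one, LinearMap.sub_apply, LinearMap.smul_apply,
        Module.End.mul_apply, derOdd_single, koszul_single, h, if_true, one_mul, h2]
      rw [Finsupp.smul_single, ← Finsupp.single_sub, LinearMap.zero_apply, ← Finsupp.single_zero]
      congr 1
      rw [smul_eq_mul]
      linear_combination (-oddSign (toLex (j, k)) m.2 *
        sgn (a * ((m.2.erase (toLex (j, k))).card : ZMod 2))) * h3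
    · simp [sbr_def, derVar, derOdd_single, koszul_single, h]

theorem sbr_koszul_q (a : ZMod 2) (i : SIdx N M) (n : ℤ) :
    sbr (a * sdeg i) (koszul a) (q i n) = 0 := by
  unfold q
  split_ifs
  · exact sbr_koszul_mulVar _ _ _
  · rw [sbr_smul_right, sbr_koszul_derVar, smul_zero]

theorem sbr_koszul_p (a : ZMod 2) (i : SIdx N M) (n : ℤ) :
    sbr (a * sdeg i) (koszul a) (p i n) = 0 := by
  unfold p
  split_ifs
  · exact sbr_koszul_mulVar _ _ _
  · exact sbr_koszul_derVar _ _ _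

/-! ### The energy condition on the Fock module -/

theorem truncated_of_single {A : ℤ → Module.End ℂ (Fock N M)}
    (h : ∀ m, ∃ K : ℤ, ∀ n < K, A n (Finsupp.single m 1) = 0) : Truncated A := fun f => by
  induction f using Finsupp.induction_linear with
  | zero => exact ⟨0, fun n _ => map_zero _⟩
  | add f g hf hg =>
    obtain ⟨K, hK⟩ := hf
    obtain ⟨L, hL⟩ := hg
    exact ⟨min K L, fun n hn => by rw [map_add, hK n (by omega), hL n (by omega), add_zero]⟩
  | single m a =>
    obtain ⟨K, hK⟩ := h m
    refine ⟨K, fun n hn => ?_⟩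
    rw [← mul_one a, ← smul_eq_mul, ← Finsupp.smul_single, map_smul, hK n hn, smul_zero]

theorem exists_lt_of_finite {s : Set ℤ} (hs : s.Finite) : ∃ K : ℤ, ∀ n < K, n ∉ s := by
  obtain ⟨K, hK⟩ := hs.bddBelow
  exact ⟨K, fun n hn h => absurd (hK h) (by omega)⟩

/-- The number of times that the variable `(i, k)` occurs in a monomial. -/
def mult (i : SIdx N M) (k : ℤ) (m : ((Fin N × ℤ) →₀ ℕ) × Finset (Fin M ×ₗ ℤ)) : ℕ :=
  match i with
  | Sum.inl i => m.1 (i, k)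
  | Sum.inr j => if toLex (j, k) ∈ m.2 then 1 else 0

theorem finite_mult (i : SIdx N M) (m : ((Fin N × ℤ) →₀ ℕ) × Finset (Fin M ×ₗ ℤ)) :
    {k | mult i k m ≠ 0}.Finite := by
  rcases i with i | j
  · refine (m.1.support.finite_toSet.preimage
      (Prod.mk_right_injective i).injOn).subset fun k hk => ?_
    simpa [mult] using hk
  · refine (m.2.finite_toSet.preimage (f := fun k : ℤ => toLex (j, k))
      (toLex.injective.comp (Prod.mk_right_injective j)).injOn).subset fun k hk => ?_
    simpa [mult] using hk

theorem derVar_single_eq_zero {i : SIdx N M} {k : ℤ}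
    {m : ((Fin N × ℤ) →₀ ℕ) × Finset (Fin M ×ₗ ℤ)} (h : mult i k m = 0) :
    derVar i k (Finsupp.single m 1) = 0 := by
  rcases i with i | j
  · rw [derVar_inl, evenOp_single]
    simp [show m.1 (i, k) = 0 from h]
  · have : toLex (j, k) ∉ m.2 := by simpa [mult] using h
    simp [derVar, derOdd_single, this]

/-- The number operator of one variable. For an odd variable the removal and insertion signs agree
and square to one. -/
theorem mulVar_derVar_single (i : SIdx N M) (k : ℤ)
    (m : ((Fin N × ℤ) →₀ ℕ) × Finset (Fin M ×ₗ ℤ)) :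
    mulVar i k (derVar i k (Finsupp.single m 1)) = (mult i k m : ℂ) • Finsupp.single m 1 := by
  rcases i with i | j
  · rw [derVar_inl, mulVar_inl, evenOp_single, evenOp_single]
    by_cases h : m.1 (i, k) = 0
    · simp [mult, h]
    · rw [STFun.sub_single_add _ _ _ (Or.inr h), add_tsub_cancel_right]
      simp [mult]
  · by_cases h : toLex (j, k) ∈ m.2
    · simp [derVar, mulVar, derOdd_single, mulOdd_single, h, mult, oddSign_erase,
        oddSign_mul_self]
    · simp [derVar, derOdd_single, h, mult]

/-- A monomial contains finitely many variables, and modes of negative frequency differentiate with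
respect to variables that are absent once the frequency is low enough. -/
theorem truncated_q (i : SIdx N M) : Truncated (q i : ℤ → Module.End ℂ (Fock N M)) :=
  truncated_of_single fun m => by
    obtain ⟨K, hK⟩ := exists_lt_of_finite (finite_mult i m)
    refine ⟨min K 0, fun n hn => ?_⟩
    rw [q, if_neg (by omega), LinearMap.smul_apply,
      derVar_single_eq_zero (not_not.1 (hK n (by omega))), smul_zero]

theorem truncated_p (i : SIdx N M) : Truncated (p i : ℤ → Module.End ℂ (Fock N M)) :=
  truncated_of_single fun m => by
    obtain ⟨K, hK⟩ := exists_lt_of_finite ((finite_mult i m).preimage neg_injective.injOn)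
    refine ⟨min K 0, fun n hn => ?_⟩
    rw [p, if_neg (by omega), derVar_single_eq_zero (not_not.1 (hK n (by omega)))]

/-! ### The tensor product -/

section TensorProduct

variable {V : Type*} [AddCommGroup V] [Module ℂ V]

variable (N M V) in
/-- The tensor product of the Fock module and `V`. -/
def FockTensor := Fock N M ⊗[ℂ] V

instance : AddCommGroup (FockTensor N M V) := inferInstanceAs (AddCommGroup (Fock N M ⊗[ℂ] V))

instance : Module ℂ (FockTensor N M V) := inferInstanceAs (Module ℂ (Fock N M ⊗[ℂ] V))

/-- The pure tensor `f ⊗ v`. -/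
def pure (f : Fock N M) (v : V) : FockTensor N M V := f ⊗ₜ v

theorem pure_zero_left (v : V) : pure (0 : Fock N M) v = 0 := TensorProduct.zero_tmul _ _

theorem pure_zero_right (f : Fock N M) : pure f (0 : V) = 0 := TensorProduct.tmul_zero _ _

theorem pure_add_left (f g : Fock N M) (v : V) : pure (f + g) v = pure f v + pure g v :=
  TensorProduct.add_tmul _ _ _

theorem pure_add_right (f : Fock N M) (v w : V) : pure f (v + w) = pure f v + pure f w :=
  TensorProduct.tmul_add _ _ _

theorem pure_smul_left (a : ℂ) (f : Fock N M) (v : V) : pure (a • f) v = a • pure f v := rfl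

theorem pure_smul_right (a : ℂ) (f : Fock N M) (v : V) : pure f (a • v) = a • pure f v :=
  TensorProduct.tmul_smul _ _ _

theorem FockTensor.induction {P : FockTensor N M V → Prop} (h0 : P 0)
    (hpure : ∀ f v, P (pure f v)) (hadd : ∀ x y, P x → P y → P (x + y)) (x : FockTensor N M V) :
    P x := TensorProduct.induction_on x h0 hpure hadd

/-- The operator `A ⊗ B` on the tensor product with the Fock module. -/
def tmap (A : Module.End ℂ (Fock N M)) (B : Module.End ℂ V) : Module.End ℂ (FockTensor N M V) :=
  TensorProduct.map A B

theorem tmap_tmul (A : Module.End ℂ (Fock N M)) (B : Module.End ℂ V) (f : Fock N M) (v : V) :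
    tmap A B (pure f v) = pure (A f) (B v) := rfl

theorem tmap_ext {A B : Module.End ℂ (FockTensor N M V)} (h : ∀ f v, A (pure f v) = B (pure f v)) : A = B :=
  TensorProduct.ext' h

theorem tmap_one : tmap (1 : Module.End ℂ (Fock N M)) (1 : Module.End ℂ V) = 1 :=
  tmap_ext fun _ _ => rfl

theorem tmap_zero_left (B : Module.End ℂ V) : tmap (0 : Module.End ℂ (Fock N M)) B = 0 :=
  tmap_ext fun _ _ => TensorProduct.zero_tmul _ _

theorem tmap_zero_right (A : Module.End ℂ (Fock N M)) : tmap A (0 : Module.End ℂ V) = 0 :=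
  tmap_ext fun _ _ => TensorProduct.tmul_zero _ _

theorem tmap_mul (A A' : Module.End ℂ (Fock N M)) (B B' : Module.End ℂ V) :
    tmap A B * tmap A' B' = tmap (A * A') (B * B') := tmap_ext fun _ _ => rfl

theorem tmap_smul_right (a : ℂ) (A : Module.End ℂ (Fock N M)) (B : Module.End ℂ V) :
    tmap A (a • B) = a • tmap A B := tmap_ext fun _ _ => TensorProduct.tmul_smul _ _ _

theorem tmap_smul_left (a : ℂ) (A : Module.End ℂ (Fock N M)) (B : Module.End ℂ V) :
    tmap (a • A) B = a • tmap A B := tmap_ext fun _ _ => rfl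

theorem tmap_add_right (A : Module.End ℂ (Fock N M)) (B B' : Module.End ℂ V) :
    tmap A (B + B') = tmap A B + tmap A B' := tmap_ext fun _ _ => TensorProduct.tmul_add _ _ _

theorem tmap_sub_right (A : Module.End ℂ (Fock N M)) (B B' : Module.End ℂ V) :
    tmap A (B - B') = tmap A B - tmap A B' := tmap_ext fun _ _ => TensorProduct.tmul_sub _ _ _

theorem tmap_sub_left (A A' : Module.End ℂ (Fock N M)) (B : Module.End ℂ V) :
    tmap (A - A') B = tmap A B - tmap A' B := tmap_ext fun _ _ => TensorProduct.sub_tmul _ _ _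

theorem truncated_map_left {A : ℤ → Module.End ℂ (Fock N M)} {B : ℤ → Module.End ℂ V}
    (hA : Truncated A) : Truncated fun n => tmap (A n) (B n) := fun x => by
  induction x using FockTensor.induction with
  | h0 => exact ⟨0, fun n _ => map_zero _⟩
  | hpure f v =>
    obtain ⟨K, hK⟩ := hA f
    exact ⟨K, fun n hn => by rw [tmap_tmul, hK n hn, pure_zero_left]⟩
  | hadd x y hx hy =>
    obtain ⟨K, hK⟩ := hx
    obtain ⟨L, hL⟩ := hy
    exact ⟨min K L, fun n hn => by rw [map_add, hK n (by omega), hL n (by omega), add_zero]⟩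

theorem truncated_map_right {A : ℤ → Module.End ℂ (Fock N M)} {B : ℤ → Module.End ℂ V}
    (hB : Truncated B) : Truncated fun n => tmap (A n) (B n) := fun x => by
  induction x using FockTensor.induction with
  | h0 => exact ⟨0, fun n _ => map_zero _⟩
  | hpure f v =>
    obtain ⟨K, hK⟩ := hB v
    exact ⟨K, fun n hn => by rw [tmap_tmul, hK n hn, pure_zero_right]⟩
  | hadd x y hx hy =>
    obtain ⟨K, hK⟩ := hx
    obtain ⟨L, hL⟩ := hy
    exact ⟨min K L, fun n hn => by rw [map_add, hK n (by omega), hL n (by omega), add_zero]⟩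

theorem sbr_map_of_comm_right (s : ZMod 2) (A A' : Module.End ℂ (Fock N M)) {B B' : Module.End ℂ V}
    (h : B * B' = B' * B) : sbr s (tmap A B) (tmap A' B') =
      tmap (sbr s A A') (B * B') := by
  rw [sbr_def, sbr_def, tmap_mul, tmap_mul, ← h, tmap_sub_left, tmap_smul_left]

theorem sbr_map_of_comm_left (s : ZMod 2) {A A' : Module.End ℂ (Fock N M)} (B B' : Module.End ℂ V)
    (h : A * A' = A' * A) : sbr s (tmap A B) (tmap A' B') =
      tmap (A * A') (sbr s B B') := by
  rw [sbr_def, sbr_def, tmap_mul, tmap_mul, ← h, tmap_sub_right, tmap_smul_right]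

variable {c k₁ k₂ : ℂ} {L : ℤ → Module.End ℂ V} {T : Idx N M → Idx N M → ℤ → Module.End ℂ V}

variable (L T) in
/-- The operators on the tensor product with the Fock module. -/
def tops : TrajOps N M (FockTensor N M V) := ops L T

theorem tops_q (i : SIdx N M) (n : ℤ) : (tops L T).q i n = tmap (q i n) 1 := rfl
theorem tops_p (i : SIdx N M) (n : ℤ) : (tops L T).p i n = tmap (p i n) 1 := rfl
theorem tops_L (n : ℤ) : (tops L T).L n = tmap 1 (L n) := rfl
theorem tops_T (μ ν : Idx N M) (n : ℤ) :
    (tops L T).T μ ν n = tmap (koszul (deg μ + deg ν)) (T μ ν n) := rfl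

/-- The parity operators attached to the currents commute and multiply by adding exponents. Their
product has the total parity of the pair, which is the parity of each current on the right; where a
central term occurs this parity is 0, so the operator is the identity there. -/
theorem isVirKM_tops (h : IsVirKM c k₁ k₂ L T) :
    IsVirKM c k₁ k₂ (tops L T).L (tops L T).T where
  vir m n := by
    rw [tops_L, tops_L, sbr_map_of_comm_left _ _ _ rfl, h.vir, mul_one, tmap_sub_right,
      tmap_smul_right, tmap_smul_right, tmap_one]
    rfl
  compat m n μ ν := by
    rw [tops_L, tops_T, sbr_map_of_comm_left _ _ _ (by rw [one_mul, mul_one]), h.compat,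
      one_mul, tmap_smul_right]
    rfl
  km m n μ ν σ τ := by
    rw [tops_T, tops_T, sbr_map_of_comm_left _ _ _ (by rw [koszul_mul, koszul_mul, add_comm]),
      koszul_mul, h.km, tmap_add_right, tmap_sub_right, tmap_smul_right, tmap_smul_right]
    have e1 : ∀ a b d : ZMod 2, a + b + (b + d) = a + d := by decide
    have e2 : ∀ a b d : ZMod 2, a + b + (d + a) = d + b := by decide
    have e3 : ∀ a b : ZMod 2, a + b + (b + a) = 0 := by decide
    have e4 : ∀ a b : ZMod 2, a + a + (b + b) = 0 := by decide
    refine congrArg₂ _ (congrArg₂ _ ?_ (congrArg _ ?_)) ?_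
    · split_ifs with h1
      · subst h1; rw [tops_T, e1]
      · exact tmap_zero_right _
    · split_ifs with h1
      · subst h1; rw [tops_T, e2]
      · exact tmap_zero_right _
    · by_cases h1 : μ = τ ∧ σ = ν
      · obtain ⟨rfl, rfl⟩ := h1
        rw [e3, koszul_zero, tmap_one]
      · by_cases h2 : μ = ν ∧ σ = τ
        · obtain ⟨rfl, rfl⟩ := h2
          rw [e4, koszul_zero, tmap_one]
        · simp [h1, h2]

theorem isRep_tops (h : IsVirKM c k₁ k₂ L T) (hL : Truncated L) (hT : ∀ μ ν, Truncated (T μ ν)) :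
    (tops L T).IsRep c k₁ k₂ where
  pq j i m n := by
    rw [tops_p, tops_q, sbr_map_of_comm_right _ _ _ rfl, sbr_p_q]
    split_ifs
    · exact tmap_one
    · exact tmap_zero_left _
  qq i j m n := by
    rw [tops_q, tops_q, sbr_map_of_comm_right _ _ _ rfl, sbr_q_q, tmap_zero_left]
  pp i j m n := by
    rw [tops_p, tops_p, sbr_map_of_comm_right _ _ _ rfl, sbr_p_p, tmap_zero_left]
  virkm := isVirKM_tops h
  Lq m i n := by
    rw [tops_L, tops_q, sbr_map_of_comm_right _ _ _ (by rw [one_mul, mul_one]),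
      sbr_one_left,
      tmap_zero_left]
  Lp m i n := by
    rw [tops_L, tops_p, sbr_map_of_comm_right _ _ _ (by rw [one_mul, mul_one]),
      sbr_one_left,
      tmap_zero_left]
  Tq μ ν m i n := by
    rw [tops_T, tops_q, sbr_map_of_comm_right _ _ _ (by rw [one_mul, mul_one]), sbr_koszul_q, tmap_zero_left]
  Tp μ ν m i n := by
    rw [tops_T, tops_p, sbr_map_of_comm_right _ _ _ (by rw [one_mul, mul_one]), sbr_koszul_p, tmap_zero_left]
  trunc_q i := truncated_map_left (truncated_q i)
  trunc_p i := truncated_map_left (truncated_p i)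
  trunc_L := truncated_map_right hL
  trunc_T μ ν := truncated_map_right (hT μ ν)

end TensorProduct

end Fock

end SuperTraj

namespace SuperTraj

/-! ### Negative frequencies -/

theorem HasLS.apply_eq_zero {ι W : Type*} [AddCommGroup W] [Module ℂ W] {f : ι → Module.End ℂ W}
    {S : Module.End ℂ W} (hS : HasLS f S) {w : W} (h : ∀ b, f b w = 0) : S w = 0 := by
  rw [← hS.2 w, finsum_congr h, finsum_zero]

theorem HasLS.apply_eq_nat_smul {ι W : Type*} [AddCommGroup W] [Module ℂ W]
    {f : ι → Module.End ℂ W} {S : Module.End ℂ W} (hS : HasLS f S) {w : W} (a : ι → ℕ)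
    (h : ∀ b, f b w = (a b : ℂ) • w) : ∃ k : ℕ, S w = (k : ℂ) • w := by
  refine ⟨∑ b ∈ (hS.1 w).toFinset, a b, ?_⟩
  rw [← hS.2 w, finsum_eq_sum _ (hS.1 w), Nat.cast_sum, Finset.sum_smul]
  exact Finset.sum_congr rfl fun b _ => h b

namespace STFun

variable {N M : ℕ}

theorem pd_mem_supported {f : STFun N M} (ν : Idx N M)
    (hf : f ∈ Finsupp.supported ℂ ℂ {m : (ℤ × (Fin N →₀ ℕ)) × Finset (Fin M) | m.1.1 < 0}) :
    pd ν f ∈ Finsupp.supported ℂ ℂ {m : (ℤ × (Fin N →₀ ℕ)) × Finset (Fin M) | m.1.1 < 0} := by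
  rw [Finsupp.supported_eq_span_single] at hf
  induction hf using Submodule.span_induction with
  | mem f hf =>
    obtain ⟨m, hm, rfl⟩ := hf
    rcases ν with _ | i | j
    · rw [pd_none_eq, evenOp_single]
      exact Finsupp.single_mem_supported ℂ _ hm
    · rw [pd_inl_eq, evenOp_single]
      exact Finsupp.single_mem_supported ℂ _ hm
    · rw [pd_inr_eq, derOdd_single]
      split_ifs
      · exact Finsupp.single_mem_supported ℂ _ hm
      · exact Submodule.zero_mem _
  | zero => rw [map_zero]; exact Submodule.zero_mem _
  | add f g _ _ hf hg => rw [map_add]; exact Submodule.add_mem _ hf hg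
  | smul a f _ hf => rw [map_smul]; exact Submodule.smul_mem _ a hf

end STFun

namespace TrajOps

variable {N M : ℕ} {W : Type*} [AddCommGroup W] [Module ℂ W] {R : TrajOps N M W}
  {p r s t u : ZMod 2} {c k₁ k₂ : ℂ}

variable (R) in
/-- The vectors of lowest energy. -/
structure IsVacuum (w : W) : Prop where
  q : ∀ i, ∀ n < 0, R.q i n w = 0
  p : ∀ i, ∀ n ≤ 0, R.p i n w = 0
  L : ∀ n < 0, R.L n w = 0
  T : ∀ μ ν, ∀ n < 0, R.T μ ν n w = 0

namespace QRing

variable {hR : R.IsRep c k₁ k₂} {A B : QRing hR} {ξ : VF N M} {w : W} {j : ℤ}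

/-- The modes of frequency below `j` annihilate `w`. -/
def Low (A : QRing hR) (j : ℤ) (w : W) : Prop := ∀ n < j, A.fld n w = 0

theorem Low.sub (hA : A.Low j w) (hB : B.Low j w) : (A - B).Low j w := fun n hn => by
  rw [fld_sub, Pi.sub_apply, LinearMap.sub_apply, hA n hn, hB n hn, sub_zero]

theorem Low.smul (hA : A.Low j w) (a : ℂ) : (a • A).Low j w := fun n hn => by
  rw [fld_smul, Pi.smul_apply, LinearMap.smul_apply, hA n hn, smul_zero]

theorem Low.sum {ι : Type*} (f : Finset ι) {A : ι → QRing hR} (hA : ∀ i ∈ f, (A i).Low j w) :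
    (∑ i ∈ f, A i).Low j w := fun n hn => by
  rw [fld_sum, Finset.sum_apply, LinearMap.sum_apply]
  exact Finset.sum_eq_zero fun i hi => hA i hi n hn

theorem Low.d (hA : A.Low j w) : (d hR A).Low j w := fun n hn => by
  rw [fld_d_apply, LinearMap.smul_apply, hA n hn, smul_zero]

theorem Low.mul (hA : A.Low j w) (hB : B.Low 0 w) (hpA : Hom p A) (hrB : Hom r B) :
    (A * B).Low j w := fun n hn => by
  refine (hasLS_mul A B n).apply_eq_zero fun b => ?_
  rw [Module.End.mul_apply]
  rcases lt_or_ge b 0 with hb | hb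
  · rw [hB b hb, map_zero]
  · have h := LinearMap.congr_fun (sbr_eq_zero_iff.1 (hpA.sbr hrB (n - b) b)) w
    simp only [Module.End.mul_apply, LinearMap.smul_apply] at h
    rw [h, hA _ (by omega), map_zero, smul_zero]

theorem low_wordProd (hw : R.IsVacuum w) (l : List (SIdx N M)) : (wordProd hR l).Low 0 w := by
  induction l with
  | nil =>
    intro n hn
    change (1 : QRing hR).fld n w = 0
    rw [fld_one, fexp, if_neg (by omega), LinearMap.zero_apply]
  | cons i l ih =>
    obtain ⟨p, hp⟩ := hom_wordProd (hR := hR) l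
    rw [wordProd, List.map_cons, List.prod_cons]
    exact Low.mul (fun n hn => hw.q i n hn) ih (hom_qv i) hp

/-- On a vacuum vector a product of trajectories has no modes of frequency below 0. A factor e^{imt}
with m ≤ -1 shifts frequencies by m, which improves the bound from 0 to 1. -/
theorem low_ev (hw : R.IsVacuum w) {f : STFun N M}
    (hf : f ∈ Finsupp.supported ℂ ℂ {m : (ℤ × (Fin N →₀ ℕ)) × Finset (Fin M) | m.1.1 < 0}) :
    (ev hR f).Low 1 w := by
  rw [← f.sum_single, Finsupp.sum, map_sum]
  refine Low.sum _ fun m hm => ?_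
  rw [ev_single]
  refine Low.smul (fun n hn => ?_) _
  have hm' : m.1.1 < 0 := hf hm
  rw [fld_E_mul]
  exact low_wordProd hw _ _ (by omega)

theorem low_tld (hw : R.IsVacuum w) (hξ : ξ.IsHomog p)
    (h : ∀ μ, ξ μ ∈ Finsupp.supported ℂ ℂ
      {m : (ℤ × (Fin N →₀ ℕ)) × Finset (Fin M) | m.1.1 < 0}) (i : SIdx N M) :
    (tld hR ξ i).Low 1 w :=
  (low_ev hw (h _)).sub ((low_ev hw (h _)).mul (Low.d (A := qv hR i) fun n hn => hw.q i n hn)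
    (hom_ev_none hξ) (hom_qd (some i)))

theorem pop_apply_eq_zero (hw : R.IsVacuum w) (hA : A.Low 1 w) (i : SIdx N M) :
    pop i t A w = 0 := (hasLS_pop i t A).apply_eq_zero fun n => by
  rw [nord]
  split_ifs with h
  · rw [Module.End.mul_apply, hw.p i n h, map_zero]
  · rw [LinearMap.smul_apply, Module.End.mul_apply, hA _ (by omega), map_zero, smul_zero]

/-- The bound 1 on A is needed at n = 0, where P_0 need not kill the vector and the zero mode of A
must. -/
theorem cop_apply_eq_zero (hA : A.Low 1 w) (hpA : Hom p A) {P : ℤ → Module.End ℂ W}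
    (hP : R.IsExt t P) (h : ∀ n < 0, P n w = 0) : cop A P w = 0 :=
  (hasLS_cop hpA hP).apply_eq_zero fun n => by
    rw [Module.End.mul_apply]
    rcases lt_or_ge n 0 with hn | hn
    · rw [h n hn, map_zero]
    · have h := LinearMap.congr_fun (sbr_eq_zero_iff.1 (sbr_swap_zero (hP.comm hpA n (-n)))) w
      simp only [Module.End.mul_apply, LinearMap.smul_apply] at h
      rw [h, hA _ (by omega), map_zero, smul_zero]

theorem gen_apply_eq_zero (hR : R.IsRep c k₁ k₂) (hw : R.IsVacuum w) (hξ : ξ.IsHomog p)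
    (h : ∀ μ, ∀ m ∈ (ξ μ).support, m.1.1 < 0) : R.gen p ξ w = 0 := by
  have h' : ∀ μ, ξ μ ∈ Finsupp.supported ℂ ℂ
      {m : (ℤ × (Fin N →₀ ℕ)) × Finset (Fin M) | m.1.1 < 0} := fun μ m hm => h μ m hm
  rw [gen_eq hR, dop, lop, topp]
  simp only [LinearMap.add_apply, LinearMap.sum_apply, LinearMap.smul_apply]
  rw [cop_apply_eq_zero (low_ev hw (h' none)) (hom_ev_none hξ) (isExt_L hR)
      (fun n hn => by rw [LinearMap.smul_apply, hw.L n hn, smul_zero]),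
    Finset.sum_eq_zero fun i _ => pop_apply_eq_zero hw (low_tld hw hξ h' i) i, add_zero, zero_add]
  refine Finset.sum_eq_zero fun μ _ => Finset.sum_eq_zero fun ν _ => ?_
  rw [cop_apply_eq_zero (low_ev hw (STFun.pd_mem_supported ν (h' μ))) (hom_ev_pd hξ ν μ)
    (isExt_T hR ν μ) (hw.T ν μ), smul_zero]

/-! ### The energy operator -/

theorem time_eq : VF.time N M = Pi.single none (STFun.expo 0) := by
  funext μ
  by_cases h : μ = none
  · subst h; rw [Pi.single_eq_same]; rfl
  · rw [Pi.single_eq_of_ne h, VF.time, if_neg h]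

/-- The components of ∂_0 are constant, so the currents T drop out, and ξ̃^i = -q̇^i: the energy is
that of the normal-ordered oscillators plus that of L. -/
theorem gen_time (hR : R.IsRep c k₁ k₂) : R.gen 0 (VF.time N M) =
    dop 0 (fun i => -d hR (qv hR i)) + Complex.I • R.L 0 := by
  have h1 : tld hR (VF.time N M) = fun i => -d hR (qv hR i) := by
    funext i
    rw [tld, time_eq, Pi.single_eq_same, Pi.single_eq_of_ne (by simp), map_zero, ev_expo, E_zero,
      one_mul, zero_sub]
    rfl
  have h2 : lop hR (VF.time N M) = Complex.I • R.L 0 := by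
    rw [lop, time_eq, Pi.single_eq_same, ev_expo, E_zero]
    refine (hasLS_cop Hom.one (isExt_L hR)).unique ?_
    have := HasLS.single (f := fun n => (1 : QRing hR).fld (-n) * Complex.I • R.L n) 0
      fun n hn => by
        rw [fld_one, fexp, if_neg (by omega), zero_mul]
    simpa [fexp] using this
  have h3 : topp hR 0 (VF.time N M) = 0 := by
    refine Finset.sum_eq_zero fun μ _ => Finset.sum_eq_zero fun ν _ => ?_
    have : pd ν (VF.time N M μ) = 0 := by
      rw [time_eq]
      by_cases h : μ = none
      · subst h
        rw [Pi.single_eq_same]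
        rcases ν with _ | i
        · rw [STFun.pd_none_expo]; simp
        · exact STFun.pd_some_expo i 0
      · rw [Pi.single_eq_of_ne h, map_zero]
    rw [this, map_zero, cop_zero (isExt_T hR ν μ), smul_zero]
  rw [gen_eq hR, h1, h2, h3, add_zero]

end QRing

end TrajOps

/-! ### The energy spectrum and the vacuum of the Fock module -/

namespace Fock

variable {N M : ℕ} {V : Type*} [AddCommGroup V] [Module ℂ V] {c k₁ k₂ : ℂ}
  {L : ℤ → Module.End ℂ V} {T : Idx N M → Idx N M → ℤ → Module.End ℂ V}

open TrajOps.QRing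

/-- For n ≤ 0 the term creates with q after annihilating with p, for n > 0 the reverse, and in both
cases normal ordering leaves |n| times a number operator without a vacuum constant. Hence every
contribution to the energy is a natural number. -/
theorem nord_apply (hR : (tops L T).IsRep c k₁ k₂) (i : SIdx N M) (n : ℤ)
    (m : ((Fin N × ℤ) →₀ ℕ) × Finset (Fin M ×ₗ ℤ)) (v : V) :
    (-Complex.I • nord ((0 + sdeg i) * sdeg i) n ((-d hR (qv hR i)).fld (-n))
      ((tops L T).p i n)) (pure (Finsupp.single m 1) v) =
      ((n.natAbs * mult i (-n) m : ℕ) : ℂ) • pure (Finsupp.single m 1) v := by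
  have hsq : ∀ a : ZMod 2, a * a = a := by decide
  have I2 := Complex.I_mul_I
  have key := mulVar_derVar_single i (-n) m
  rw [zero_add, hsq, fld_neg, Pi.neg_apply, fld_d_neg, fld_qv, nord]
  split_ifs with h
  · have hn : (n : ℂ) = -(n.natAbs : ℂ) := by
      rw [← Int.cast_natCast, Int.natCast_natAbs, abs_of_nonpos h]; push_cast; ring
    rw [tops_q, tops_p, q, p, if_pos (by omega), if_neg (by omega)]
    simp only [LinearMap.smul_apply, Module.End.mul_apply, tmap_tmul, key,
      Module.End.one_apply, pure_smul_left, smul_smul, ← neg_smul, hn]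
    congr 1
    push_cast
    linear_combination (-(n.natAbs : ℂ) * (mult i (-n) m)) * I2
  · have hn : (n : ℂ) = (n.natAbs : ℂ) := by
      rw [← Int.cast_natCast, Int.natCast_natAbs, abs_of_pos (by omega)]
    rw [tops_q, tops_p, q, p, if_pos (by omega), if_neg (by omega)]
    simp only [LinearMap.smul_apply, Module.End.mul_apply, tmap_tmul, key,
      Module.End.one_apply, pure_smul_left, smul_smul, ← neg_smul, hn, map_smul]
    congr 1
    push_cast
    linear_combination (-(n.natAbs : ℂ) * (mult i (-n) m)) * I2
      - (n.natAbs : ℂ) * (mult i (-n) m) * Complex.I ^ 2 * sgn_mul_self (sdeg i)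

theorem energy_apply {h : ℂ} {v : V} (hv : L 0 v = h • v)
    (f : Fock N M) : (-Complex.I • Complex.I • (tops L T).L 0) (pure f v) = h • pure f v := by
  rw [smul_smul, neg_mul, Complex.I_mul_I, neg_neg, one_smul, tops_L, tmap_tmul, hv,
    pure_smul_right]
  rfl

theorem energy_single (hR : (tops L T).IsRep c k₁ k₂) {h : ℂ} {v : V} (hv : L 0 v = h • v)
    (m : ((Fin N × ℤ) →₀ ℕ) × Finset (Fin M ×ₗ ℤ)) : ∃ k : ℕ,
    (-Complex.I • (tops L T).gen 0 (VF.time N M)) (pure (Finsupp.single m 1) v) =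
      (h + k) • pure (Finsupp.single m 1) v := by
  have hk := fun i => ((hasLS_pop i ((0 + sdeg i) * sdeg i) (-d hR (qv hR i))).smul
    (-Complex.I)).apply_eq_nat_smul _ fun n => nord_apply hR i n m v
  choose k hk using hk
  refine ⟨∑ i, k i, ?_⟩
  rw [gen_time hR, smul_add, LinearMap.add_apply, energy_apply hv, dop, Finset.smul_sum,
    LinearMap.sum_apply, Finset.sum_congr rfl fun i _ => hk i, ← Finset.sum_smul, ← add_smul,
    add_comm]
  push_cast
  rfl

/-- Products of a monomial with an eigenvector of L_0 span the tensor product, and each is an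
eigenvector whose eigenvalue is raised by the natural number found in `energy_single`. -/
theorem iSup_eigenspace_energy (hR : (tops L T).IsRep c k₁ k₂) {h : ℂ}
    (hL : (⨆ k : ℕ, Module.End.eigenspace (L 0) (h + k)) = ⊤) :
    (⨆ k : ℕ, Module.End.eigenspace (-Complex.I • (tops L T).gen 0 (VF.time N M)) (h + k)) = ⊤ := by
  refine eq_top_iff.2 fun x hx => ?_
  clear hx
  induction x using FockTensor.induction with
  | h0 => exact Submodule.zero_mem _
  | hadd x y hx hy => exact Submodule.add_mem _ hx hy
  | hpure f v =>
    induction f using Finsupp.induction_linear with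
    | zero => rw [pure_zero_left]; exact Submodule.zero_mem _
    | add f g hf hg => rw [pure_add_left]; exact Submodule.add_mem _ hf hg
    | single m a =>
      rw [← mul_one a, ← smul_eq_mul, ← Finsupp.smul_single, pure_smul_left]
      refine Submodule.smul_mem _ _ ?_
      have hv : v ∈ ⨆ k : ℕ, Module.End.eigenspace (L 0) (h + k) := hL ▸ Submodule.mem_top
      induction hv using Submodule.iSup_induction' with
      | mem k v hv =>
        obtain ⟨l, hl⟩ := energy_single hR (Module.End.mem_eigenspace_iff.1 hv) m
        refine Submodule.mem_iSup_of_mem (k + l) (Module.End.mem_eigenspace_iff.2 ?_)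
        rw [hl, Nat.cast_add, add_assoc]
      | zero => rw [pure_zero_right]; exact Submodule.zero_mem _
      | add v w _ _ hv hw => rw [pure_add_right]; exact Submodule.add_mem _ hv hw

theorem isVacuum_vac {v : V} (hL : ∀ n < 0, L n v = 0) (hT : ∀ μ ν, ∀ n < 0, T μ ν n v = 0) :
    (tops L T).IsVacuum (pure (vac N M) v) := by
  have hd : ∀ (i : SIdx N M) k, derVar i k (vac N M) = 0 := fun i k =>
    derVar_single_eq_zero (by rcases i with i | i <;> simp [mult])
  refine ⟨fun i n hn => ?_, fun i n hn => ?_, fun n hn => ?_, fun μ ν n hn => ?_⟩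
  · rw [tops_q, tmap_tmul, q, if_neg (by omega), LinearMap.smul_apply, hd, smul_zero,
      pure_zero_left]
  · rw [tops_p, tmap_tmul, p, if_neg (by omega), hd, pure_zero_left]
  · rw [tops_L, tmap_tmul, hL n hn, pure_zero_right]
  · rw [tops_T, tmap_tmul, hT μ ν n hn, pure_zero_right]

theorem energy_vac (hR : (tops L T).IsRep c k₁ k₂) {h : ℂ} {v : V} (hv : L 0 v = h • v) :
    -Complex.I • (tops L T).gen 0 (VF.time N M) (pure (vac N M) v) = h • pure (vac N M) v := by
  have hm : ∀ (i : SIdx N M) k, mult i k ((0, ∅) : ((Fin N × ℤ) →₀ ℕ) × Finset (Fin M ×ₗ ℤ)) = 0 :=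
    fun i k => by rcases i with i | i <;> simp [mult]
  rw [← LinearMap.smul_apply, gen_time hR, smul_add, LinearMap.add_apply, energy_apply hv, dop,
    Finset.smul_sum, LinearMap.sum_apply, Finset.sum_eq_zero fun i _ => ?_, zero_add]
  refine ((hasLS_pop i ((0 + sdeg i) * sdeg i) (-d hR (qv hR i))).smul
    (-Complex.I)).apply_eq_zero fun n => ?_
  rw [vac, nord_apply, hm, mul_zero, Nat.cast_zero, zero_smul]

end Fock

end SuperTraj

end

/-! ### Assembly of the theorem -/

theorem theorem3p4 (N M : ℕ) (c k₁ k₂ : ℂ) :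
    -- the normal-ordered generators in an arbitrary module with energy bounded from below
    (∀ (W : Type*) [AddCommGroup W] [Module ℂ W] (R : SuperTraj.TrajOps N M W),
      R.IsRep c k₁ k₂ →
      -- all products of fields in the definitions are locally finite sums
      ((∀ p r A B, R.QFun p A → R.QFun r B → SuperTraj.MulOK A B) ∧
        (∀ p A, R.QFun p A →
          (∀ i, SuperTraj.MulOK A (SuperTraj.fneg (R.pField i)) ∧
            SuperTraj.MulOK (SuperTraj.fpos (R.pField i)) A) ∧
          SuperTraj.MulOK A R.LField ∧ ∀ μ ν, SuperTraj.MulOK A (R.TField μ ν))) ∧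
      -- the bracket of two generators
      (∀ (p r : ZMod 2) (ξ η : SuperTraj.VF N M), ξ.IsHomog p → η.IsHomog r →
        SuperTraj.sbr (p * r) (R.gen p ξ) (R.gen r η) =
          R.gen (p + r) (SuperTraj.VF.bracket p r ξ η) + R.ext c k₁ k₂ p r ξ η) ∧
      -- the transformation law of the trajectory
      (∀ (p : ZMod 2) (ξ : SuperTraj.VF N M), ξ.IsHomog p → ∀ i n,
        SuperTraj.sbr (p * SuperTraj.sdeg i) (R.gen p ξ) (R.q i n) = R.xiTilde ξ i n) ∧
      -- the extension is made of functionals of the trajectory, which commute among themselves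
      (∀ (p r : ZMod 2) (ξ η : SuperTraj.VF N M), ξ.IsHomog p → η.IsHomog r → ∀ i n,
        SuperTraj.sbr ((p + r) * SuperTraj.sdeg i) (R.ext c k₁ k₂ p r ξ η) (R.q i n) = 0) ∧
      -- the extension is not central
      (0 < N + M → Nontrivial W →
        ∃ (p r s : ZMod 2) (ξ η ζ : SuperTraj.VF N M),
          ξ.IsHomog p ∧ η.IsHomog r ∧ ζ.IsHomog s ∧
          SuperTraj.sbr (s * (p + r)) (R.gen s ζ) (R.ext c k₁ k₂ p r ξ η) ≠ 0)) ∧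
    -- the Fock module, tensored with a lowest-energy module of the Virasoro and Kac-Moody algebras
    (∀ (V : Type*) [AddCommGroup V] [Module ℂ V] (L : ℤ → Module.End ℂ V)
      (T : SuperTraj.Idx N M → SuperTraj.Idx N M → ℤ → Module.End ℂ V),
      SuperTraj.IsVirKM c k₁ k₂ L T → SuperTraj.Truncated L →
      (∀ μ ν, SuperTraj.Truncated (T μ ν)) →
      (SuperTraj.Fock.ops L T).IsRep c k₁ k₂ ∧
      -- the energy is bounded from below
      (∀ h : ℂ, (⨆ k : ℕ, Module.End.eigenspace (L 0) (h + k)) = ⊤ →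
        (⨆ k : ℕ, Module.End.eigenspace
          (-Complex.I • (SuperTraj.Fock.ops L T).gen 0 (SuperTraj.VF.time N M)) (h + k)) = ⊤) ∧
      -- lowest-energy vectors
      (∀ (h : ℂ) (v : V), L 0 v = h • v → (∀ n < 0, L n v = 0) →
        (∀ μ ν, ∀ n < 0, T μ ν n v = 0) →
        -Complex.I • (SuperTraj.Fock.ops L T).gen 0 (SuperTraj.VF.time N M)
            (SuperTraj.Fock.vac N M ⊗ₜ[ℂ] v) = h • (SuperTraj.Fock.vac N M ⊗ₜ[ℂ] v) ∧
        ∀ (p : ZMod 2) (ξ : SuperTraj.VF N M), ξ.IsHomog p →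
          (∀ μ, ∀ m ∈ (ξ μ).support, m.1.1 < 0) →
          (SuperTraj.Fock.ops L T).gen p ξ (SuperTraj.Fock.vac N M ⊗ₜ[ℂ] v) = 0)) := by
  refine ⟨fun W _ _ R hR => ⟨⟨fun p r A B hA hB => ?_, fun p A hA => ⟨fun i => ⟨?_, ?_⟩, ?_, ?_⟩⟩,
    fun p r ξ η hξ hη => ?_, fun p ξ hξ i n => ?_, fun p r ξ η hξ hη i n => ?_, fun h _ => ?_⟩,
    fun V _ _ L T h hL hT => ?_⟩
  · exact SuperTraj.TrajOps.mulOK_of_mem hR hA.mem_qspan hB.mem_qspan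
  · exact SuperTraj.TrajOps.mulOK_fneg (SuperTraj.TrajOps.trunc_pField hR i)
  · exact SuperTraj.TrajOps.mulOK_fpos (hA.truncated hR)
  · refine hA.mulOK_ext hR (t := 0) (P := R.LField) ⟨hR.trunc_L.smul _, fun n i m => ?_,
      fun n i m => ?_⟩
    · rw [zero_mul, SuperTraj.TrajOps.LField, SuperTraj.sbr_smul_left, hR.Lq, smul_zero]
    · rw [zero_mul, SuperTraj.TrajOps.LField, SuperTraj.sbr_smul_left, hR.Lp, smul_zero]
  · intro μ ν
    refine hA.mulOK_ext hR (t := SuperTraj.deg μ + SuperTraj.deg ν) (P := R.TField μ ν)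
      ⟨(hR.trunc_T μ ν).smul _, fun n i m => ?_, fun n i m => ?_⟩
    · rw [SuperTraj.TrajOps.TField, SuperTraj.sbr_smul_left, hR.Tq, smul_zero]
    · rw [SuperTraj.TrajOps.TField, SuperTraj.sbr_smul_left, hR.Tp, smul_zero]
  · exact SuperTraj.TrajOps.QRing.sbr_gen_gen_eq hR hξ hη
  · exact SuperTraj.TrajOps.QRing.sbr_gen_q hR hξ i n
  · exact SuperTraj.TrajOps.QRing.sbr_ext_q hR hξ hη i n
  · have hi : Nonempty (SuperTraj.SIdx N M) := by
      rw [← Fintype.card_pos_iff, Fintype.card_sum, Fintype.card_fin, Fintype.card_fin]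
      exact h
    obtain ⟨i⟩ := hi
    -- The witnesses are ξ = e^{-it}∂_0, η = x^i∂_0 and ζ = e^{it}∂_i, where i is any spatial
    -- direction.
    refine ⟨0, SuperTraj.sdeg i, SuperTraj.sdeg i, _, _, _, ?_, ?_, ?_,
      SuperTraj.TrajOps.QRing.sbr_gen_ext_ne_zero hR i⟩
    · exact SuperTraj.TrajOps.QRing.isHomog_single (SuperTraj.STFun.hasParity_expo (-1))
    · refine SuperTraj.TrajOps.QRing.isHomog_single ?_
      exact ((SuperTraj.STFun.hasParity_expo 0).mulX i).cast (add_comm _ _)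
    · refine SuperTraj.TrajOps.QRing.isHomog_single ((SuperTraj.STFun.hasParity_expo 1).cast ?_)
      exact (SuperTraj.zmod_two_add_self _).symm
  · have hR := SuperTraj.Fock.isRep_tops h hL hT
    refine ⟨hR, fun e he => SuperTraj.Fock.iSup_eigenspace_energy hR he,
      fun e v hv hL0 hT0 => ⟨SuperTraj.Fock.energy_vac hR hv, fun p ξ hξ hneg => ?_⟩⟩
    exact SuperTraj.TrajOps.QRing.gen_apply_eq_zero hR (SuperTraj.Fock.isVacuum_vac hL0 hT0) hξ hneg
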